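/- Let $K/F$ be a Galois extension of fields of characteristic different from $2$, with (profinite) Galois group $G=\operatorname{Gal}(K/F)$. For an open subgroup $H\le G$ let $A(H)$ be the Burnside ring of finite continuous $H$-sets; the rings $\underline A_G(G/H)=A(H)$, with restriction, transfer ($X\mapsto H\times_L X$), norm ($X\mapsto \operatorname{Map}_L(H,X)$, extended to formal differences) and conjugation, form the Burnside Tambara functor $\underline A_G$. The Dress map $\mathcal D_H\colon A(H)\to GW(K^H)$ is the additive map sending the transitive $H$-set $H/L$ to the class of the trace form $x\mapsto \operatorname{tr}_{K^L/K^H}(x^2)$ on $K^L$ in the Grothendieck–Witt ring of $K^H$. The trace ideal of $K/F$ is the family $\mathcal I(G/H)=\ker\mathcal D_H$, $H\le G$ open. A Tambara ideal of $\underline A_G$ is a family of ring ideals $\mathcal J(G/H)\subseteq A(H)$ closed under restriction, transfer and conjugation and such that $N_L^H(\mathcal J(G/L))\subseteq \mathcal J(G/H)+N_L^H(0)$; the Tambara ideal $\langle\!\langle S\rangle\!\rangle$ generated by a set $S$ of elements of various levels is the intersection of all Tambara ideals containing $S$. Suppose that $G\cong\mathbb Z_p$ as topological groups, $p$ a prime,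 and for $n,m\ge 0$ let $t_{p^n,p^m}\in A(p^n\mathbb Z_p)$ be the class of the transitive $p^n\mathbb Z_p$-set $p^n\mathbb Z_p/p^{n+m}\mathbb Z_p$. If $p$ is odd, then for every $n\ge 0$ the trace ideal at level $\mathbb Z_p/p^n\mathbb Z_p$ is the ring ideal $$\mathcal I(\mathbb Z_p/p^n\mathbb Z_p)=\bigl(t_{p^n,p^m}-p^m : m\ge 0\bigr)\subseteq A(p^n\mathbb Z_p),$$ and the trace ideal is the Tambara ideal $$\mathcal I=\langle\!\langle\, t_{p^i,p}-p : i\ge 0\,\rangle\!\rangle .$$ If $p=2$, then for every $n\ge 0$ $$\mathcal I(\mathbb Z_2/2^n\mathbb Z_2)=\bigl(t_{2^n,2^m}+t_{2^n,2}-2^m-2 : m\ge 1\bigr)\subseteq A(2^n\mathbb Z_2),$$ and $$\mathcal I=\langle\!\langle\, t_{2^i,4}-t_{2^i,2}-2 : i\ge 0\,\rangle\!\rangle .$$ -/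

import Mathlib

universe u v

namespace GalTambara

section FiniteSets

/-- A finite `G`-set with continuous action (discrete topology), i.e. with open stabilizers. -/
structure FinGSet (G : Type v) [Group G] [TopologicalSpace G] : Type (v + 1) where
  carrier : Type v
  [action : MulAction G carrier]
  [finite : Finite carrier]
  isOpen_stabilizer : ∀ x : carrier, IsOpen (MulAction.stabilizer G x : Set G)

attribute [instance] FinGSet.action FinGSet.finite

variable {G : Type v} [Group G] [TopologicalSpace G]

/-- Isomorphism of finite `G`-sets. -/
def FinGSet.Iso (X Y : FinGSet G) : Prop :=
  ∃ e : X.carrier ≃ Y.carrier, ∀ (g : G) (x : X.carrier), e (g • x) = g • e x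

instance FinGSet.setoid (G : Type v) [Group G] [TopologicalSpace G] : Setoid (FinGSet G) where
  r := FinGSet.Iso
  iseqv :=
    { refl := fun _ => ⟨Equiv.refl _, fun _ _ => rfl⟩
      symm := by
        rintro X Y ⟨e, he⟩
        exact ⟨e.symm, fun g y => by rw [Equiv.symm_apply_eq, he, Equiv.apply_symm_apply]⟩
      trans := by
        rintro X Y Z ⟨e, he⟩ ⟨f, hf⟩
        exact ⟨e.trans f, fun g x => by simp [he, hf]⟩ }

/-- Disjoint union. -/
def FinGSet.sum (X Y : FinGSet G) : FinGSet G where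
  carrier := X.carrier ⊕ Y.carrier
  isOpen_stabilizer := by
    rintro (x | y)
    · convert X.isOpen_stabilizer x using 1
      ext g; simp [MulAction.mem_stabilizer_iff]
    · convert Y.isOpen_stabilizer y using 1
      ext g; simp [MulAction.mem_stabilizer_iff]

/-- Cartesian product, with the diagonal action. -/
def FinGSet.prod (X Y : FinGSet G) : FinGSet G where
  carrier := X.carrier × Y.carrier
  isOpen_stabilizer := by
    rintro ⟨x, y⟩
    convert (X.isOpen_stabilizer x).inter (Y.isOpen_stabilizer y) using 1
    ext g; simp [MulAction.mem_stabilizer_iff]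

/-- The empty `G`-set. -/
def FinGSet.empty (G : Type v) [Group G] [TopologicalSpace G] : FinGSet G where
  carrier := PEmpty
  action := { smul := fun _ x => x, one_smul := fun _ => rfl, mul_smul := fun _ _ _ => rfl }
  isOpen_stabilizer := fun x => x.elim

/-- The one-point `G`-set. -/
def FinGSet.point (G : Type v) [Group G] [TopologicalSpace G] : FinGSet G where
  carrier := PUnit
  action := { smul := fun _ x => x, one_smul := fun _ => rfl, mul_smul := fun _ _ _ => rfl }
  isOpen_stabilizer := fun x => by
    convert isOpen_univ using 1
    exact Set.eq_univ_of_forall fun _ => rfl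

/-- The semiring of isomorphism classes of finite `G`-sets. -/
def FinGSetClass (G : Type v) [Group G] [TopologicalSpace G] : Type (v + 1) :=
  Quotient (FinGSet.setoid G)

/-- The isomorphism class of a finite `G`-set. -/
def FinGSet.cls (X : FinGSet G) : FinGSetClass G := Quotient.mk _ X

theorem FinGSet.cls_eq {X Y : FinGSet G} (e : X.carrier ≃ Y.carrier)
    (he : ∀ (g : G) (x : X.carrier), e (g • x) = g • e x) : X.cls = Y.cls :=
  Quotient.sound ⟨e, he⟩

instance : Add (FinGSetClass G) where
  add := Quotient.map₂ FinGSet.sum (by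
    rintro X X' ⟨e, he⟩ Y Y' ⟨f, hf⟩
    refine ⟨Equiv.sumCongr e f, ?_⟩
    rintro g (x | y)
    · exact congrArg Sum.inl (he g x)
    · exact congrArg Sum.inr (hf g y))

instance : Mul (FinGSetClass G) where
  mul := Quotient.map₂ FinGSet.prod (by
    rintro X X' ⟨e, he⟩ Y Y' ⟨f, hf⟩
    refine ⟨Equiv.prodCongr e f, ?_⟩
    rintro g ⟨x, y⟩
    exact Prod.ext (he g x) (hf g y))

instance : Zero (FinGSetClass G) := ⟨(FinGSet.empty G).cls⟩

instance : One (FinGSetClass G) := ⟨(FinGSet.point G).cls⟩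

instance : CommSemiring (FinGSetClass G) where
  nsmul := nsmulRec
  add_assoc := by
    rintro ⟨X⟩ ⟨Y⟩ ⟨Z⟩
    refine FinGSet.cls_eq (Equiv.sumAssoc _ _ _) ?_
    rintro g ((x | y) | z) <;> rfl
  zero_add := by
    rintro ⟨X⟩
    refine FinGSet.cls_eq (X := (FinGSet.empty G).sum X) (Equiv.emptySum PEmpty _) ?_
    rintro g (x | x)
    · exact x.elim
    · rfl
  add_zero := by
    rintro ⟨X⟩
    refine FinGSet.cls_eq (X := X.sum (FinGSet.empty G)) (Equiv.sumEmpty _ PEmpty) ?_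
    rintro g (x | x)
    · rfl
    · exact x.elim
  add_comm := by
    rintro ⟨X⟩ ⟨Y⟩
    refine FinGSet.cls_eq (Equiv.sumComm _ _) ?_
    rintro g (x | y) <;> rfl
  mul_assoc := by
    rintro ⟨X⟩ ⟨Y⟩ ⟨Z⟩
    exact FinGSet.cls_eq (Equiv.prodAssoc _ _ _) (fun _ _ => rfl)
  one_mul := by
    rintro ⟨X⟩
    exact FinGSet.cls_eq (X := (FinGSet.point G).prod X) (Equiv.punitProd _) (fun _ _ => rfl)
  mul_one := by
    rintro ⟨X⟩
    exact FinGSet.cls_eq (X := X.prod (FinGSet.point G)) (Equiv.prodPUnit _) (fun _ _ => rfl)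
  mul_comm := by
    rintro ⟨X⟩ ⟨Y⟩
    exact FinGSet.cls_eq (Equiv.prodComm _ _) (fun _ _ => rfl)
  zero_mul := by
    rintro ⟨X⟩
    exact FinGSet.cls_eq (X := (FinGSet.empty G).prod X) (Y := FinGSet.empty G)
      (Equiv.pemptyProd _) (fun _ x => x.1.elim)
  mul_zero := by
    rintro ⟨X⟩
    exact FinGSet.cls_eq (X := X.prod (FinGSet.empty G)) (Y := FinGSet.empty G)
      (Equiv.prodPEmpty _) (fun _ x => x.2.elim)
  left_distrib := by
    rintro ⟨X⟩ ⟨Y⟩ ⟨Z⟩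
    refine FinGSet.cls_eq (X := X.prod (Y.sum Z)) (Y := (X.prod Y).sum (X.prod Z))
      (Equiv.prodSumDistrib _ _ _) ?_
    rintro g ⟨x, y | z⟩ <;> rfl
  right_distrib := by
    rintro ⟨X⟩ ⟨Y⟩ ⟨Z⟩
    refine FinGSet.cls_eq (X := (X.sum Y).prod Z) (Y := (X.prod Z).sum (Y.prod Z))
      (Equiv.sumProdDistrib _ _ _) ?_
    rintro g ⟨x | y, z⟩ <;> rfl

/-- Pulling back the action along a continuous homomorphism. -/
def FinGSet.pullback {G' : Type v} [Group G'] [TopologicalSpace G'] (f : G' →* G)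
    (hf : Continuous f) (X : FinGSet G) : FinGSet G' where
  carrier := X.carrier
  action := MulAction.compHom X.carrier f
  isOpen_stabilizer := fun x => (X.isOpen_stabilizer x).preimage hf

/-- `FinGSet.pullback` on isomorphism classes, as a homomorphism of semirings. -/
def FinGSetClass.pullback {G' : Type v} [Group G'] [TopologicalSpace G'] (f : G' →* G)
    (hf : Continuous f) : FinGSetClass G →+* FinGSetClass G' where
  toFun := Quotient.map (FinGSet.pullback f hf) (by
    rintro X Y ⟨e, he⟩
    exact ⟨e, fun g x => he (f g) x⟩)
  map_zero' := FinGSet.cls_eq (X := (FinGSet.empty G).pullback f hf) (Y := FinGSet.empty G')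
    (Equiv.refl _) (fun _ x => x.elim)
  map_one' := FinGSet.cls_eq (X := (FinGSet.point G).pullback f hf) (Y := FinGSet.point G')
    (Equiv.refl _) (fun _ _ => rfl)
  map_add' := by
    rintro ⟨X⟩ ⟨Y⟩
    refine FinGSet.cls_eq (X := (X.sum Y).pullback f hf)
      (Y := (X.pullback f hf).sum (Y.pullback f hf)) (Equiv.refl _) ?_
    rintro g (x | y) <;> rfl
  map_mul' := by
    rintro ⟨X⟩ ⟨Y⟩
    exact FinGSet.cls_eq (X := (X.prod Y).pullback f hf)
      (Y := (X.pullback f hf).prod (Y.pullback f hf)) (Equiv.refl _) (fun _ _ => rfl)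

end FiniteSets

section Grothendieck

/-- The Grothendieck ring of a commutative semiring. -/
def GrothendieckRing (S : Type u) [CommSemiring S] : Type u := Algebra.GrothendieckAddGroup S

namespace GrothendieckRing

variable {S : Type u} [CommSemiring S]

instance : AddCommGroup (GrothendieckRing S) :=
  inferInstanceAs (AddCommGroup (Algebra.GrothendieckAddGroup S))

/-- The canonical map from a semiring to its Grothendieck ring. -/
def of : S →+ GrothendieckRing S := Algebra.GrothendieckAddGroup.of

/-- The extension of an additive map to the Grothendieck ring. -/
noncomputable def liftAdd {A : Type*} [AddCommGroup A] (f : S →+ A) : GrothendieckRing S →+ A :=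
  Algebra.GrothendieckAddGroup.lift f

theorem liftAdd_of {A : Type*} [AddCommGroup A] (f : S →+ A) (a : S) : liftAdd f (of a) = f a :=
  DFunLike.congr_fun (Algebra.GrothendieckAddGroup.lift.symm_apply_apply f) a

theorem exists_rep (x : GrothendieckRing S) : ∃ a b : S, x = of a - of b := by
  obtain ⟨⟨a, b⟩, hab⟩ := (AddLocalization.addMonoidOf (⊤ : AddSubmonoid S)).surj x
  exact ⟨a, b, eq_sub_of_add_eq hab⟩

theorem of_eq_of {a b : S} : of a = of b ↔ ∃ c, a + c = b + c := by
  refine ((AddLocalization.addMonoidOf (⊤ : AddSubmonoid S)).eq_iff_exists).trans ?_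
  constructor
  · rintro ⟨c, hc⟩
    exact ⟨c, by rw [add_comm a, add_comm b]; exact hc⟩
  · rintro ⟨c, hc⟩
    exact ⟨⟨c, trivial⟩, by rw [add_comm _ a, add_comm _ b]; exact hc⟩

theorem induction {P : GrothendieckRing S → Prop} (h : ∀ a, P (of a))
    (hs : ∀ x y, P x → P y → P (x - y)) (x : GrothendieckRing S) : P x := by
  obtain ⟨a, b, rfl⟩ := exists_rep x
  exact hs _ _ (h a) (h b)

/-- Multiplication, as the biadditive extension of that of `S`. -/
noncomputable def mulHom : GrothendieckRing S →+ GrothendieckRing S →+ GrothendieckRing S :=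
  liftAdd
    { toFun := fun a => liftAdd (of.comp (AddMonoidHom.mulLeft a))
      map_zero' := by
        ext x
        induction x using induction with
        | h b => simp [liftAdd_of]
        | hs x y hx hy => simp only [map_sub, hx, hy]
      map_add' := fun a a' => by
        ext x
        induction x using induction with
        | h b => simp [liftAdd_of, add_mul]
        | hs x y hx hy => simp only [map_sub, hx, hy] }

noncomputable instance : Mul (GrothendieckRing S) := ⟨fun x y => mulHom x y⟩

instance : One (GrothendieckRing S) := ⟨of 1⟩

theorem mul_def (x y : GrothendieckRing S) : x * y = mulHom x y := rfl

theorem of_mul (a b : S) : (of (a * b) : GrothendieckRing S) = of a * of b := by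
  simp [mul_def, mulHom, liftAdd_of]

noncomputable instance : CommRing (GrothendieckRing S) :=
  { (inferInstance : AddCommGroup (GrothendieckRing S)) with
    mul := (· * ·)
    one := 1
    left_distrib := fun x y z => by simp only [mul_def, map_add]
    right_distrib := fun x y z => by simp only [mul_def, map_add, AddMonoidHom.add_apply]
    zero_mul := fun x => by simp only [mul_def, map_zero, AddMonoidHom.zero_apply]
    mul_zero := fun x => by simp only [mul_def, map_zero]
    mul_assoc := fun x y z => by
      induction x using induction with
      | hs x x' hx hx' => simp only [mul_def, map_sub, AddMonoidHom.sub_apply] at *; rw [hx, hx']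
      | h a =>
      induction y using induction with
      | hs x x' hx hx' => simp only [mul_def, map_sub, AddMonoidHom.sub_apply] at *; rw [hx, hx']
      | h b =>
      induction z using induction with
      | hs x x' hx hx' => simp only [mul_def, map_sub] at *; rw [hx, hx']
      | h c => simp only [← of_mul, mul_assoc]
    mul_comm := fun x y => by
      induction x using induction with
      | hs x x' hx hx' => simp only [mul_def, map_sub, AddMonoidHom.sub_apply] at *; rw [hx, hx']
      | h a =>
      induction y using induction with
      | hs x x' hx hx' => simp only [mul_def, map_sub, AddMonoidHom.sub_apply] at *; rw [hx, hx']
      | h b => simp only [← of_mul, mul_comm]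
    one_mul := fun x => by
      induction x using induction with
      | hs x x' hx hx' => simp only [mul_def, map_sub] at *; rw [hx, hx']
      | h a => exact (of_mul 1 a).symm.trans (by rw [one_mul])
    mul_one := fun x => by
      induction x using induction with
      | hs x x' hx hx' => simp only [mul_def, map_sub, AddMonoidHom.sub_apply] at *; rw [hx, hx']
      | h a => exact (of_mul a 1).symm.trans (by rw [mul_one]) }

/-- Functoriality of the Grothendieck ring. -/
noncomputable def map {S' : Type u} [CommSemiring S'] (f : S →+* S') :
    GrothendieckRing S →+* GrothendieckRing S' :=
  { liftAdd (of.comp f.toAddMonoidHom) with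
    map_one' := (liftAdd_of _ _).trans (congrArg of f.map_one)
    map_mul' := fun x y => by
      change liftAdd _ _ = liftAdd _ _ * liftAdd _ _
      induction x using induction with
      | hs x x' hx hx' => rw [sub_mul, map_sub, map_sub, sub_mul, hx, hx']
      | h a =>
      induction y using induction with
      | hs x x' hx hx' => rw [mul_sub, map_sub, map_sub, mul_sub, hx, hx']
      | h b => simp [← of_mul, liftAdd_of] }

end GrothendieckRing
end Grothendieck

section Newton
open Finset
variable {S : Type u} [AddCommMonoid S] {B : Type v} [AddCommGroup B]

/-- Newton extrapolation: if `k ↦ f (x + k • y)` is polynomial of degree at most `n`, this is the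
value of that polynomial at `k = -1`. -/
def newton (f : S → B) (n : ℕ) (x y : S) : B :=
  ∑ k ∈ range (n + 1), ((-1) ^ k * ((n + 1).choose (k + 1) : ℤ)) • f (x + k • y)

/-- `f` is polynomial of degree at most `n` along every line: all `(n + 1)`-st finite differences
in a constant direction vanish. -/
def IsPoly (f : S → B) (n : ℕ) : Prop :=
  ∀ x w : S, ∑ k ∈ range (n + 2), ((-1) ^ k * ((n + 1).choose k : ℤ)) • f (x + k • w) = 0

theorem newton_ring_identity {R : Type*} [CommRing R] (a : R) (n : ℕ) :
    a * ∑ k ∈ range (n + 1), (-1) ^ k * ((n + 1).choose (k + 1) : R) * a ^ k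
      = 1 - (1 - a) ^ (n + 1) := by
  have h : (1 - a) ^ (n + 1) = (-a + 1) ^ (n + 1) := by ring
  rw [h, add_pow, sum_range_succ' _ (n + 1), mul_sum]
  simp only [one_pow, mul_one, pow_zero, Nat.choose_zero_right, Nat.cast_one]
  rw [sub_add_eq_sub_sub, sub_right_comm, sub_self, zero_sub, ← sum_neg_distrib]
  refine sum_congr rfl fun k _ => ?_
  rw [neg_pow a (k + 1)]
  ring

theorem newton_zero (f : S → B) (n : ℕ) (x : S) : newton f n x 0 = f x := by
  have h := newton_ring_identity (1 : ℤ) n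
  simp only [one_mul, one_pow, mul_one, sub_self, ne_eq, Nat.add_eq_zero_iff, one_ne_zero,
    and_false, not_false_eq_true, zero_pow, sub_zero] at h
  simp only [newton, smul_zero, add_zero]
  rw [← sum_smul, h, one_smul]

theorem newton_add_right_aux {R : Type*} [CommRing R] {f : S → B} {n : ℕ} (hf : IsPoly f n)
    (T : S → R) (hT : ∀ s t, T (s + t) = T s * T t) (hTk : ∀ (k : ℕ) s, T (k • s) = T s ^ k)
    (hspan : ∀ r : R, r ∈ AddSubgroup.closure (Set.range T)) (Φ : R →+ B)
    (hΦ : ∀ s, f s = Φ (T s)) (x y z : S) :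
    newton f n (x + z) (y + z) = newton f n x y := by
  have hkill : ∀ (r : R) (w : S), Φ (r * (1 - T w) ^ (n + 1)) = 0 := by
    intro r w
    induction hspan r using AddSubgroup.closure_induction with
    | mem r hr =>
      obtain ⟨s, rfl⟩ := hr
      have h : (1 - T w) ^ (n + 1) = (-T w + 1) ^ (n + 1) := by ring
      rw [h, add_pow, mul_sum, map_sum, ← hf s w]
      refine sum_congr rfl fun k _ => ?_
      rw [hΦ, ← map_zsmul, hT, hTk, neg_pow, zsmul_eq_mul]
      congr 1
      push_cast
      ring
    | zero => rw [zero_mul, map_zero]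
    | add a b _ _ ha hb => rw [add_mul, map_add, ha, hb, add_zero]
    | neg a _ ha => rw [neg_mul, map_neg, ha, neg_zero]
  let q : R → R := fun a =>
    ∑ k ∈ range (n + 1), (-1) ^ k * ((n + 1).choose (k + 1) : R) * a ^ k
  have hq : ∀ a, a * q a = 1 - (1 - a) ^ (n + 1) := fun a => newton_ring_identity a n
  have hN : ∀ x y, newton f n x y = Φ (T x * q (T y)) := by
    intro x y
    rw [newton, mul_sum, map_sum]
    refine sum_congr rfl fun k _ => ?_
    rw [hΦ, ← map_zsmul, hT, hTk, zsmul_eq_mul]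
    congr 1
    push_cast
    ring
  rw [hN, hN, ← sub_eq_zero, ← map_sub, hT x z]
  have h1 := hq (T y)
  have h2 := hq (T (y + z))
  have e : T x * T z * q (T (y + z)) - T x * q (T y)
      = T x * T z * q (T (y + z)) * (1 - T y) ^ (n + 1)
        - T x * q (T y) * (1 - T (y + z)) ^ (n + 1) := by
    have h1' : (1 - T y) ^ (n + 1) = 1 - T y * q (T y) := by rw [h1]; ring
    have h2' : (1 - T (y + z)) ^ (n + 1) = 1 - T y * T z * q (T (y + z)) := by
      rw [← hT, h2]; ring
    rw [h1', h2']; ring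
  rw [e, map_sub, hkill, hkill, sub_zero]

/-- The extrapolated value depends only on the formal difference `x - y`. -/
theorem newton_add_right {f : S → B} {n : ℕ} (hf : IsPoly f n) (x y z : S) :
    newton f n (x + z) (y + z) = newton f n x y := by
  refine newton_add_right_aux (R := AddMonoidAlgebra ℤ S) hf
    (fun s => AddMonoidAlgebra.single s 1) ?_ ?_ ?_
    ((Finsupp.liftAddHom fun s => zmultiplesHom B (f s)).comp
      AddMonoidAlgebra.coeffAddEquiv.toAddMonoidHom) ?_ x y z
  · intro s t
    simp [AddMonoidAlgebra.single_mul_single]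
  · intro k s
    simp [AddMonoidAlgebra.single_pow]
  · intro r
    induction r using AddMonoidAlgebra.induction_linear with
    | zero => exact zero_mem _
    | add a b ha hb => exact add_mem ha hb
    | single s c =>
      have : (AddMonoidAlgebra.single s c : AddMonoidAlgebra ℤ S)
          = c • AddMonoidAlgebra.single s 1 := by simp
      rw [this]
      exact zsmul_mem (AddSubgroup.subset_closure (Set.mem_range_self s)) c
  · intro s
    simp

end Newton

section Tambara

variable {G : Type v} [Group G] [TopologicalSpace G]

/-- The inclusion of one open subgroup in another. -/
def incl {L H : OpenSubgroup G} (h : L ≤ H) : L →* H :=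
  Subgroup.inclusion (H := (L : Subgroup G)) (K := (H : Subgroup G)) h

theorem coe_incl {L H : OpenSubgroup G} (h : L ≤ H) (l : L) : ((incl h l : H) : G) = l := rfl

theorem continuous_incl {L H : OpenSubgroup G} (h : L ≤ H) : Continuous (incl h) :=
  Continuous.subtype_mk continuous_subtype_val _

theorem isOpenMap_incl {L H : OpenSubgroup G} (h : L ≤ H) : IsOpenMap (incl h) := by
  rintro U hU
  obtain ⟨O, hO, rfl⟩ := isOpen_induced_iff.mp hU
  refine isOpen_induced_iff.mpr ⟨O ∩ L, hO.inter L.isOpen, ?_⟩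
  ext g
  constructor
  · rintro ⟨h1, h2⟩
    exact ⟨⟨g, h2⟩, h1, rfl⟩
  · rintro ⟨l, hl, rfl⟩
    exact ⟨hl, l.2⟩

theorem exists_of_quotient_eq {L H : OpenSubgroup G} (h : L ≤ H) {a b : H}
    (hab : (a : H ⧸ (L : Subgroup G).subgroupOf (H : Subgroup G)) = b) :
    ∃ l : L, b = a * incl h l := by
  have := QuotientGroup.eq.mp hab
  exact ⟨⟨_, this⟩, by ext; simp [coe_incl]⟩

section MapL

variable {L H : OpenSubgroup G} (h : L ≤ H)

/-- The set `Map_L(H, X)` of `L`-equivariant maps `H → X`. -/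
def MapL (X : FinGSet L) : Type v :=
  {φ : H → X.carrier // ∀ (l : L) (g : H), φ (incl h l * g) = l • φ g}

/-- `H` acts on `Map_L(H, X)` by `(k φ)(g) = φ (g k)`. -/
instance (X : FinGSet L) : MulAction H (MapL h X) where
  smul k φ := ⟨fun g => φ.1 (g * k), fun _ _ => (congrArg φ.1 (mul_assoc _ _ _)).trans (φ.2 _ _)⟩
  one_smul φ := Subtype.ext (funext fun g => congrArg φ.1 (mul_one g))
  mul_smul k k' φ := Subtype.ext (funext fun g => congrArg φ.1 (mul_assoc g k k').symm)

theorem MapL.smul_apply (X : FinGSet L) (k : H) (φ : MapL h X) (g : H) :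
    (k • φ).1 g = φ.1 (g * k) := rfl

/-- The number of cosets of `L` in `H`. -/
noncomputable def cosetIndex (L H : OpenSubgroup G) : ℕ :=
  (L : Subgroup G).relIndex (H : Subgroup G)

/-- A representative of a right coset `L g`. -/
noncomputable def rep (q : H ⧸ (L : Subgroup G).subgroupOf (H : Subgroup G)) : H := (q.out)⁻¹

theorem exists_eq_incl_mul_rep (g : H) :
    ∃ (l : L) (q : H ⧸ (L : Subgroup G).subgroupOf (H : Subgroup G)), g = incl h l * rep q := by
  obtain ⟨l, hl⟩ := exists_of_quotient_eq h
    (Quotient.out_eq' ((g⁻¹ : H) : H ⧸ (L : Subgroup G).subgroupOf (H : Subgroup G)))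
  refine ⟨l⁻¹, ((g⁻¹ : H) : H ⧸ (L : Subgroup G).subgroupOf (H : Subgroup G)), ?_⟩
  rw [rep, ← inv_inj, mul_inv_rev, inv_inv, map_inv, inv_inv]
  exact hl

end MapL

variable [IsTopologicalGroup G]

instance (H : OpenSubgroup G) : IsTopologicalGroup H :=
  inferInstanceAs (IsTopologicalGroup (H : Subgroup G))

/-- A subgroup containing a neighbourhood of the identity is open. -/
theorem isOpen_stabilizer_of_subset {H : Type v} [Group H] [TopologicalSpace H]
    [IsTopologicalGroup H] {X : Type v} [MulAction H X] (x : X) (U : Set H) (hU : IsOpen U)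
    (h1 : (1 : H) ∈ U) (hs : ∀ k ∈ U, k • x = x) : IsOpen (MulAction.stabilizer H x : Set H) :=
  Subgroup.isOpen_of_mem_nhds (g := 1) _ (Filter.mem_of_superset (hU.mem_nhds h1) hs)

variable [CompactSpace G]

instance finite_quotient (L H : OpenSubgroup G) :
    Finite (H ⧸ (L : Subgroup G).subgroupOf (H : Subgroup G)) := by
  have : CompactSpace H := isCompact_iff_compactSpace.mp H.isClosed.isCompact
  exact Subgroup.quotient_finite_of_isOpen _ (Subgroup.subgroupOf_isOpen _ _ L.isOpen)

section Coset

/-- The transitive `H`-set `H / L`. -/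
def cosetSet (H L : OpenSubgroup G) : FinGSet H where
  carrier := H ⧸ (L : Subgroup G).subgroupOf (H : Subgroup G)
  isOpen_stabilizer := by
    intro x
    induction x using QuotientGroup.induction_on with
    | H g =>
    refine isOpen_stabilizer_of_subset _
      {k : H | g⁻¹ * k * g ∈ (L : Subgroup G).subgroupOf (H : Subgroup G)} ?_ ?_ ?_
    · exact (Subgroup.subgroupOf_isOpen (H : Subgroup G) _ L.isOpen).preimage
        ((continuous_const.mul continuous_id).mul continuous_const)
    · simp
    · intro k hk
      refine (QuotientGroup.eq.mpr ?_).symm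
      simpa [mul_assoc] using hk

end Coset

section Induction

variable {L H : OpenSubgroup G} (h : L ≤ H)

/-- The relation on `H × X` defining `H ×_L X`: `(g l⁻¹, l x)` is identified with `(g, x)`. -/
def indSetoid (X : FinGSet L) : Setoid (H × X.carrier) where
  r a b := ∃ l : L, b = (a.1 * (incl h l)⁻¹, l • a.2)
  iseqv :=
    { refl := fun a => ⟨1, by simp⟩
      symm := by
        rintro a b ⟨l, rfl⟩
        exact ⟨l⁻¹, by simp⟩
      trans := by
        rintro a b c ⟨l, rfl⟩ ⟨m, rfl⟩
        exact ⟨m * l, by simp [mul_assoc, mul_smul]⟩ }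

/-- The induced `H`-set `H ×_L X`, with `H` acting by left multiplication on the first factor. -/
def FinGSet.ind (X : FinGSet L) : FinGSet H where
  carrier := Quotient (indSetoid h X)
  action :=
    { smul := fun k => Quotient.map (fun a => (k * a.1, a.2)) (by
        rintro a b ⟨l, rfl⟩
        exact ⟨l, by simp [mul_assoc]⟩)
      one_smul := by
        rintro ⟨a⟩
        exact congrArg (Quotient.mk _) (by simp)
      mul_smul := by
        rintro k k' ⟨a⟩
        exact congrArg (Quotient.mk _) (by simp [mul_assoc]) }
  finite := by
    let f : (H ⧸ (L : Subgroup G).subgroupOf (H : Subgroup G)) × X.carrier →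
      Quotient (indSetoid h X) := fun a => Quotient.mk _ (a.1.out, a.2)
    refine Finite.of_surjective f ?_
    rintro ⟨g, x⟩
    obtain ⟨l, hl⟩ := exists_of_quotient_eq h
      (Quotient.out_eq' (g : H ⧸ (L : Subgroup G).subgroupOf (H : Subgroup G)))
    refine ⟨(g, l • x), ?_⟩
    refine (Quotient.sound ⟨l, ?_⟩ : Quotient.mk (indSetoid h X) (g, x) = _).symm
    refine Prod.ext ?_ rfl
    conv_rhs => rw [hl]
    simp
  isOpen_stabilizer := by
    rintro ⟨g, x⟩
    refine @isOpen_stabilizer_of_subset H _ _ _ _ (_) _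
      {k : H | g⁻¹ * k * g ∈ incl h '' (MulAction.stabilizer L x : Set L)} ?_ ?_ ?_
    · exact (isOpenMap_incl h _ (X.isOpen_stabilizer x)).preimage
        ((continuous_const.mul continuous_id).mul continuous_const)
    · exact ⟨1, one_mem _, by simp⟩
    · rintro k ⟨l, hl, hk⟩
      refine (Quotient.sound ⟨l, ?_⟩ : Quotient.mk (indSetoid h X) (k * g, x) = _)
      refine Prod.ext ?_ (MulAction.mem_stabilizer_iff.mp hl).symm
      change g = k * g * (incl h l)⁻¹
      rw [hk]; group

/-- Induction on isomorphism classes, as an additive map. -/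
def FinGSetClass.ind : FinGSetClass L →+ FinGSetClass H where
  toFun := Quotient.map (FinGSet.ind h) (by
    rintro X Y ⟨e, he⟩
    refine ⟨Quotient.congr (Equiv.prodCongr (Equiv.refl _) e) ?_, ?_⟩
    · rintro ⟨a, x⟩ ⟨b, y⟩
      constructor
      · rintro ⟨l, hl⟩
        obtain ⟨rfl, rfl⟩ := Prod.ext_iff.mp hl
        exact ⟨l, Prod.ext rfl (he _ _)⟩
      · rintro ⟨l, hl⟩
        obtain ⟨h1, h2⟩ := Prod.ext_iff.mp hl
        exact ⟨l, Prod.ext h1 (e.injective (h2.trans (he _ _).symm))⟩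
    · rintro k ⟨a⟩
      rfl)
  map_zero' := by
    refine FinGSet.cls_eq (X := (FinGSet.empty L).ind h) (Y := FinGSet.empty H)
      ⟨fun q => (Quotient.out q).2.elim, fun x => x.elim, fun q => (Quotient.out q).2.elim,
        fun x => x.elim⟩ (fun k q => (Quotient.out q).2.elim)
  map_add' := by
    rintro ⟨X⟩ ⟨Y⟩
    let f : (X.ind h).carrier ⊕ (Y.ind h).carrier → ((X.sum Y).ind h).carrier :=
      Sum.elim
        (Quotient.map (fun a => (a.1, Sum.inl a.2)) (by rintro a b ⟨l, rfl⟩; exact ⟨l, rfl⟩))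
        (Quotient.map (fun a => (a.1, Sum.inr a.2)) (by rintro a b ⟨l, rfl⟩; exact ⟨l, rfl⟩))
    have hf : Function.Bijective f := by
      constructor
      · rintro (⟨a, x⟩ | ⟨a, x⟩) (⟨b, y⟩ | ⟨b, y⟩) hab
        · obtain ⟨l, hl⟩ := Quotient.exact hab
          obtain ⟨h1, h2⟩ := Prod.ext_iff.mp hl
          exact congrArg Sum.inl (Quotient.sound ⟨l, Prod.ext h1 (Sum.inl_injective h2)⟩)
        · obtain ⟨l, hl⟩ := Quotient.exact hab
          exact absurd (Prod.ext_iff.mp hl).2 Sum.inr_ne_inl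
        · obtain ⟨l, hl⟩ := Quotient.exact hab
          exact absurd (Prod.ext_iff.mp hl).2 Sum.inl_ne_inr
        · obtain ⟨l, hl⟩ := Quotient.exact hab
          obtain ⟨h1, h2⟩ := Prod.ext_iff.mp hl
          exact congrArg Sum.inr (Quotient.sound ⟨l, Prod.ext h1 (Sum.inr_injective h2)⟩)
      · rintro ⟨a, x | y⟩
        · exact ⟨Sum.inl (Quotient.mk _ (a, x)), rfl⟩
        · exact ⟨Sum.inr (Quotient.mk _ (a, y)), rfl⟩
    refine (FinGSet.cls_eq (X := (X.ind h).sum (Y.ind h)) (Y := (X.sum Y).ind h)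
      (Equiv.ofBijective f hf) ?_).symm
    rintro k (a | a) <;> induction a using Quotient.ind <;> rfl

end Induction

section Coinduction

variable {L H : OpenSubgroup G} (h : L ≤ H)

/-- The coinduced `H`-set `Map_L(H, X)`. -/
def FinGSet.coind (X : FinGSet L) : FinGSet H where
  carrier := MapL h X
  finite := by
    refine Finite.of_injective (β := (H ⧸ (L : Subgroup G).subgroupOf (H : Subgroup G)) →
      X.carrier) (fun φ q => φ.1 (rep q)) ?_
    intro φ ψ hφψ
    refine Subtype.ext (funext fun g => ?_)
    obtain ⟨l, q, rfl⟩ := exists_eq_incl_mul_rep h g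
    rw [φ.2, ψ.2]
    exact congrArg _ (congrFun hφψ q)
  isOpen_stabilizer := by
    intro φ
    refine isOpen_stabilizer_of_subset φ
      (⋂ q : H ⧸ (L : Subgroup G).subgroupOf (H : Subgroup G),
        {k : H | rep q * k * (rep q)⁻¹ ∈
          incl h '' (MulAction.stabilizer L (φ.1 (rep q)) : Set L)}) ?_ ?_ ?_
    · refine isOpen_iInter_of_finite fun q => ?_
      exact (isOpenMap_incl h _ (X.isOpen_stabilizer _)).preimage
        ((continuous_const.mul continuous_id).mul continuous_const)
    · exact Set.mem_iInter.mpr fun q => ⟨1, one_mem _, by simp⟩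
    · intro k hk
      refine Subtype.ext (funext fun g => ?_)
      obtain ⟨l, q, rfl⟩ := exists_eq_incl_mul_rep h g
      obtain ⟨m, hm, hmk⟩ := Set.mem_iInter.mp hk q
      rw [MapL.smul_apply, mul_assoc, φ.2, φ.2]
      have : rep q * k = incl h m * rep q := by rw [hmk]; group
      rw [this, φ.2, MulAction.mem_stabilizer_iff.mp hm]

/-- Coinduction on isomorphism classes (it is multiplicative, but not additive). -/
def FinGSetClass.coind : FinGSetClass L → FinGSetClass H :=
  Quotient.map (FinGSet.coind h) (by
    rintro X Y ⟨e, he⟩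
    refine ⟨Equiv.subtypeEquiv (Equiv.piCongrRight fun _ => e) fun φ => ?_, fun k φ => rfl⟩
    refine forall_congr' fun l => forall_congr' fun g => ?_
    change _ ↔ e (φ _) = l • e (φ _)
    rw [← he, e.apply_eq_iff_eq])

end Coinduction

end Tambara

section Polynomial

section Sub
variable {H : Type v} [Group H] [TopologicalSpace H]

/-- The sub-`H`-set cut out by an invariant predicate. -/
def FinGSet.sub (M : FinGSet H) (P : M.carrier → Prop) (hP : ∀ (k : H) m, P (k • m) ↔ P m) :
    FinGSet H where
  carrier := {m // P m}
  action :=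
    { smul := fun k m => ⟨k • m.1, (hP k m.1).mpr m.2⟩
      one_smul := fun m => Subtype.ext (one_smul H m.1)
      mul_smul := fun k k' m => Subtype.ext (mul_smul k k' m.1) }
  isOpen_stabilizer := fun m => by
    convert M.isOpen_stabilizer m.1 using 1
    ext k
    exact Subtype.ext_iff

theorem FinGSet.cls_sub_congr (M : FinGSet H) {P Q : M.carrier → Prop}
    (hP : ∀ (k : H) m, P (k • m) ↔ P m) (hQ : ∀ (k : H) m, Q (k • m) ↔ Q m)
    (hPQ : ∀ m, P m ↔ Q m) : (M.sub P hP).cls = (M.sub Q hQ).cls := by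
  obtain rfl : P = Q := funext fun m => propext (hPQ m)
  rfl

theorem FinGSet.cls_sub_or (M : FinGSet H) (P Q : M.carrier → Prop)
    (hP : ∀ (k : H) m, P (k • m) ↔ P m) (hQ : ∀ (k : H) m, Q (k • m) ↔ Q m)
    (hPQ : ∀ m, P m → ¬ Q m) :
    (M.sub (fun m => P m ∨ Q m) fun k m => or_congr (hP k m) (hQ k m)).cls
      = (M.sub P hP).cls + (M.sub Q hQ).cls := by
  let f : {m // P m} ⊕ {m // Q m} → {m // P m ∨ Q m} :=
    Sum.elim (fun m => ⟨m.1, Or.inl m.2⟩) (fun m => ⟨m.1, Or.inr m.2⟩)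
  have hf : Function.Bijective f := by
    constructor
    · rintro (⟨a, ha⟩ | ⟨a, ha⟩) (⟨b, hb⟩ | ⟨b, hb⟩) hab
      · obtain rfl : a = b := congrArg Subtype.val hab
        rfl
      · obtain rfl : a = b := congrArg Subtype.val hab
        exact absurd hb (hPQ _ ha)
      · obtain rfl : a = b := congrArg Subtype.val hab
        exact absurd ha (hPQ _ hb)
      · obtain rfl : a = b := congrArg Subtype.val hab
        rfl
    · rintro ⟨a, ha | ha⟩
      · exact ⟨Sum.inl ⟨a, ha⟩, rfl⟩
      · exact ⟨Sum.inr ⟨a, ha⟩, rfl⟩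
  refine (FinGSet.cls_eq (X := (M.sub P hP).sum (M.sub Q hQ)) (Y := M.sub (fun m => P m ∨ Q m) _)
    (Equiv.ofBijective f hf) ?_).symm
  rintro k (a | a) <;> rfl

theorem FinGSet.cls_sub_of_forall_not (M : FinGSet H) (P : M.carrier → Prop)
    (hP : ∀ (k : H) m, P (k • m) ↔ P m) (h0 : ∀ m, ¬ P m) : (M.sub P hP).cls = 0 :=
  FinGSet.cls_eq (X := M.sub P hP) (Y := FinGSet.empty H)
    ⟨fun m => (h0 m.1 m.2).elim, fun x => x.elim, fun m => (h0 m.1 m.2).elim, fun x => x.elim⟩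
    (fun _ m => (h0 m.1 m.2).elim)

theorem FinGSet.cls_sub_mem {I : Type*} (M : FinGSet H) (c : M.carrier → I)
    (hc : ∀ (k : H) m, c (k • m) = c m) (T : Finset I) :
    (M.sub (fun m => c m ∈ T) fun k m => by rw [hc]).cls
      = ∑ t ∈ T, (M.sub (fun m => c m = t) fun k m => by rw [hc]).cls := by
  classical
  induction T using Finset.induction_on with
  | empty =>
    rw [Finset.sum_empty]
    exact M.cls_sub_of_forall_not _ _ fun m => Finset.notMem_empty _
  | insert t T ht ih =>
    rw [Finset.sum_insert ht, ← ih, ← M.cls_sub_or]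
    · exact M.cls_sub_congr _ _ fun m => Finset.mem_insert
    · rintro m rfl
      exact ht

/-- The disjoint union of copies of an `H`-set, indexed by a finite type. -/
def FinGSet.copies (ι : Type) [Finite ι] (W : FinGSet H) : FinGSet H where
  carrier := ι × W.carrier
  action :=
    { smul := fun k a => (a.1, k • a.2)
      one_smul := fun a => Prod.ext rfl (one_smul H a.2)
      mul_smul := fun k k' a => Prod.ext rfl (mul_smul k k' a.2) }
  isOpen_stabilizer := fun a => by
    convert W.isOpen_stabilizer a.2 using 1
    ext k
    exact Prod.ext_iff.trans (and_iff_right rfl)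

theorem FinGSet.cls_copies (ι : Type) [Finite ι] (W : FinGSet H) :
    (W.copies ι).cls = Nat.card ι • W.cls := by
  suffices ∀ hι : Finite ι, (W.copies ι).cls = Nat.card ι • W.cls from this inferInstance
  refine Finite.induction_empty_option
    (P := fun ι => ∀ hι : Finite ι, (W.copies ι).cls = Nat.card ι • W.cls) ?_ ?_ ?_ ι
  · intro α β e h hβ
    have hα : Finite α := Finite.of_equiv β e.symm
    rw [← Nat.card_congr e, ← h hα]
    exact (FinGSet.cls_eq (X := W.copies α) (Y := W.copies β)
      (Equiv.prodCongr e (Equiv.refl _)) fun _ _ => rfl).symm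
  · intro h0
    rw [Nat.card_of_isEmpty, zero_nsmul]
    exact FinGSet.cls_eq (X := W.copies PEmpty) (Y := FinGSet.empty H)
      ⟨fun a => a.1.elim, fun a => a.elim, fun a => a.1.elim, fun a => a.elim⟩
      fun _ a => a.1.elim
  · intro α _ h hα
    rw [Finite.card_option, add_nsmul, one_nsmul, ← h inferInstance]
    let f : (α × W.carrier) ⊕ W.carrier → Option α × W.carrier :=
      Sum.elim (fun a => (some a.1, a.2)) (fun w => (none, w))
    have hf : Function.Bijective f := by
      constructor
      · rintro (⟨a, x⟩ | x) (⟨b, y⟩ | y) hab <;> simp [f] at hab ⊢ <;> exact hab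
      · rintro ⟨_ | a, w⟩
        · exact ⟨Sum.inr w, rfl⟩
        · exact ⟨Sum.inl (a, w), rfl⟩
    refine (FinGSet.cls_eq (X := (W.copies α).sum W) (Y := W.copies (Option α))
      (Equiv.ofBijective f hf) ?_).symm
    rintro k (a | a) <;> rfl

end Sub

variable {G : Type v} [Group G] [TopologicalSpace G]
variable {L H : OpenSubgroup G} (h : L ≤ H)

open Classical in
/-- The copies of `W` that are met by a map to `X ⊔ (copies of W)`. -/
noncomputable def hits {X W : FinGSet L} {m : ℕ} (φ : MapL h (X.sum (W.copies (Fin m)))) :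
    Finset (Fin m) := {i | ∃ g w, φ.1 g = Sum.inr (i, w)}

theorem mem_hits {X W : FinGSet L} {m : ℕ} (φ : MapL h (X.sum (W.copies (Fin m)))) (i : Fin m) :
    i ∈ hits h φ ↔ ∃ g w, φ.1 g = Sum.inr (i, w) := by
  simp [hits]

theorem hits_smul {X W : FinGSet L} {m : ℕ} (k : H) (φ : MapL h (X.sum (W.copies (Fin m)))) :
    hits h (k • φ) = hits h φ := by
  ext i
  rw [mem_hits, mem_hits]
  constructor
  · rintro ⟨g, w, hg⟩
    exact ⟨g * k, w, hg⟩
  · rintro ⟨g, w, hg⟩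
    refine ⟨g * k⁻¹, w, ?_⟩
    rw [MapL.smul_apply, inv_mul_cancel_right]
    exact hg

theorem card_hits_le [IsTopologicalGroup G] [CompactSpace G] {X W : FinGSet L} {m : ℕ} (φ : MapL h (X.sum (W.copies (Fin m)))) :
    (hits h φ).card ≤ cosetIndex L H := by
  classical
  have := Fintype.ofFinite (H ⧸ (L : Subgroup G).subgroupOf (H : Subgroup G))
  let c : X.carrier ⊕ (Fin m × W.carrier) → Option (Fin m) :=
    Sum.elim (fun _ => none) (fun a => some a.1)
  have hsub : (hits h φ).image some ⊆
      (Finset.univ : Finset (H ⧸ (L : Subgroup G).subgroupOf (H : Subgroup G))).image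
        (fun q => c (φ.1 (rep q))) := by
    intro o ho
    obtain ⟨i, hi, rfl⟩ := Finset.mem_image.mp ho
    obtain ⟨g, w, hg⟩ := (mem_hits h φ i).mp hi
    obtain ⟨l, q, rfl⟩ := exists_eq_incl_mul_rep h g
    refine Finset.mem_image.mpr ⟨q, Finset.mem_univ _, ?_⟩
    rw [φ.2] at hg
    rw [(eq_inv_smul_iff (g := l)).mpr hg]
    rfl
  have hcard := (Finset.card_le_card hsub).trans Finset.card_image_le
  rw [Finset.card_image_of_injective _ (Option.some_injective _), Finset.card_univ,
    ← Nat.card_eq_fintype_card] at hcard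
  exact hcard

variable [IsTopologicalGroup G] [CompactSpace G]

theorem cls_coind_eq {X W : FinGSet L} {m : ℕ} (s : Finset (Fin m)) :
    FinGSetClass.coind h (X.cls + s.card • W.cls)
      = (((X.sum (W.copies (Fin m))).coind h).sub (fun φ => hits h φ ⊆ s)
          fun k φ => Iff.of_eq (congrArg (· ⊆ s) (hits_smul h k φ))).cls := by
  have h1 : X.cls + s.card • W.cls = (X.sum (W.copies s)).cls := by
    have h2 := W.cls_copies s
    rw [Nat.card_eq_fintype_card, Fintype.card_coe] at h2
    rw [← h2]
    rfl
  rw [h1]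
  let j : (X.sum (W.copies s)).carrier → (X.sum (W.copies (Fin m))).carrier :=
    Sum.map id (Prod.map Subtype.val id)
  have hj : Function.Injective j :=
    Sum.map_injective.mpr ⟨Function.injective_id,
      Function.Injective.prodMap Subtype.val_injective Function.injective_id⟩
  have hjl : ∀ (l : L) (a : (X.sum (W.copies s)).carrier),
      j (l • a) = l • j a := by
    rintro l (a | a) <;> rfl
  let f : MapL h (X.sum (W.copies s)) →
      {φ : MapL h (X.sum (W.copies (Fin m))) // hits h φ ⊆ s} := fun φ =>
    ⟨⟨fun g => j (φ.1 g), fun l g => (congrArg j (φ.2 l g)).trans (hjl _ _)⟩, by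
      intro i hi
      obtain ⟨g, w, hg⟩ := (mem_hits h _ i).mp hi
      change j (φ.1 g) = _ at hg
      generalize φ.1 g = a at hg
      rcases a with a | ⟨a, w'⟩
      · exact absurd hg Sum.inl_ne_inr
      · have := congrArg Prod.fst (Sum.inr_injective hg)
        change a.1 = i at this
        rw [← this]
        exact a.2⟩
  have hf : Function.Bijective f := by
    constructor
    · intro φ ψ hφψ
      refine Subtype.ext (funext fun g => hj ?_)
      exact congrFun (congrArg (fun χ => χ.1.1) hφψ) g
    · rintro ⟨φ, hφ⟩
      have hex : ∀ g, ∃ a : (X.sum (W.copies s)).carrier, j a = φ.1 g := by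
        intro g
        rcases hg : φ.1 g with a | ⟨i, w⟩
        · exact ⟨Sum.inl a, rfl⟩
        · exact ⟨Sum.inr (⟨i, hφ ((mem_hits h φ i).mpr ⟨g, w, hg⟩)⟩, w), rfl⟩
      choose ψ hψ using hex
      refine ⟨⟨ψ, fun l g => hj ?_⟩, ?_⟩
      · rw [hjl, hψ, hψ, φ.2]
      · exact Subtype.ext (Subtype.ext (funext hψ))
  exact FinGSet.cls_eq (X := (X.sum (W.copies s)).coind h) (Equiv.ofBijective f hf)
    (fun k φ => rfl)

theorem sum_neg_one_pow_card_superset {m : ℕ} (t : Finset (Fin m)) (ht : t ≠ Finset.univ) :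
    ∑ s with t ⊆ s, (-1 : ℤ) ^ s.card = 0 := by
  classical
  obtain ⟨i, hi⟩ : ∃ i, i ∉ t := by
    by_contra! hcon
    exact ht (Finset.eq_univ_of_forall hcon)
  refine Finset.sum_involution (fun s _ => if i ∈ s then s.erase i else insert i s) ?_ ?_ ?_ ?_
  · intro s _
    by_cases his : i ∈ s
    · have := Finset.card_erase_add_one his
      simp only [his, if_true]
      rw [← this, pow_succ]; ring
    · simp only [his, if_false, Finset.card_insert_of_notMem his, pow_succ]; ring
  · intro s _ _ heq
    by_cases his : i ∈ s
    · simp only [his, if_true] at heq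
      exact Finset.notMem_erase i s (heq.symm ▸ his)
    · simp only [his, if_false] at heq
      exact his (heq ▸ Finset.mem_insert_self i s)
  · intro s hs
    simp only [Finset.mem_filter, Finset.mem_univ, true_and] at hs ⊢
    by_cases his : i ∈ s
    · simp only [his, if_true]
      exact Finset.subset_erase.mpr ⟨hs, hi⟩
    · simp only [his, if_false]
      exact hs.trans (Finset.subset_insert _ _)
  · intro s _
    by_cases his : i ∈ s <;> simp [his]

/-- `X ↦ [Map_L(H, X)]` is polynomial of degree at most the number of cosets of `L` in `H`. -/
theorem isPoly_coind :
    IsPoly (fun x : FinGSetClass L => GrothendieckRing.of (FinGSetClass.coind h x))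
      (cosetIndex L H) := by
  classical
  rintro ⟨X⟩ ⟨W⟩
  change ∑ k ∈ _, _ • GrothendieckRing.of (FinGSetClass.coind h (X.cls + k • W.cls)) = 0
  set n := cosetIndex L H with hn
  let E : Finset (Fin (n + 1)) → GrothendieckRing (FinGSetClass H) := fun t =>
    GrothendieckRing.of (((X.sum (W.copies (Fin (n + 1)))).coind h).sub
      (fun φ => hits h φ = t) fun k φ => Iff.of_eq (congrArg (· = t) (hits_smul h k φ))).cls
  have h1 : ∀ s : Finset (Fin (n + 1)),
      GrothendieckRing.of (FinGSetClass.coind h (X.cls + s.card • W.cls))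
        = ∑ t ∈ s.powerset, E t := by
    intro s
    have h3 := FinGSet.cls_sub_mem ((X.sum (W.copies (Fin (n + 1)))).coind h)
      (fun φ => hits h φ) (fun k φ => hits_smul h k φ) s.powerset
    rw [cls_coind_eq h s, ← map_sum, ← h3]
    exact congrArg _ (FinGSet.cls_sub_congr _ _ _ fun φ => Finset.mem_powerset.symm)
  have h2 : ∑ k ∈ Finset.range (n + 2), ((-1) ^ k * ((n + 1).choose k : ℤ)) •
        GrothendieckRing.of (FinGSetClass.coind h (X.cls + k • W.cls))
      = ∑ s : Finset (Fin (n + 1)), ((-1 : ℤ) ^ s.card) •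
        GrothendieckRing.of (FinGSetClass.coind h (X.cls + s.card • W.cls)) := by
    have := Finset.sum_powerset_apply_card (fun k => ((-1 : ℤ) ^ k) •
        GrothendieckRing.of (FinGSetClass.coind h (X.cls + k • W.cls)))
        (x := (Finset.univ : Finset (Fin (n + 1))))
    rw [Finset.powerset_univ, Finset.card_univ, Fintype.card_fin] at this
    rw [this]
    refine Finset.sum_congr rfl fun k _ => ?_
    rw [← natCast_zsmul, smul_smul, mul_comm]
  rw [h2]
  simp only [h1, Finset.smul_sum]
  rw [Finset.sum_comm' (t' := Finset.univ) (s' := fun t => {s | t ⊆ s})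
    (by intro s t; simp)]
  refine Finset.sum_eq_zero fun t _ => ?_
  rw [← Finset.sum_smul]
  by_cases ht : t = Finset.univ
  · have : E t = 0 := by
      refine (congrArg _ (FinGSet.cls_sub_of_forall_not _ _ _ fun φ hφ => ?_)).trans (map_zero _)
      have := card_hits_le h φ
      rw [show hits h φ = Finset.univ from hφ.trans ht, Finset.card_univ, Fintype.card_fin] at this
      omega
    rw [this, smul_zero]
  · rw [sum_neg_one_pow_card_superset t ht, zero_smul]

end Polynomial

section BurnsideTambara

/-- The Burnside ring of a topological group. For an open subgroup `H ≤ G`, the value of the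
Burnside Tambara functor of `G` at `G / H` is `Burnside H`. -/
abbrev Burnside (G : Type v) [Group G] [TopologicalSpace G] : Type (v + 1) :=
  GrothendieckRing (FinGSetClass G)

/-- The class of a finite `G`-set in the Burnside ring. -/
def FinGSet.toBurnside {G : Type v} [Group G] [TopologicalSpace G] (X : FinGSet G) : Burnside G :=
  GrothendieckRing.of X.cls

variable {G : Type v} [Group G] [TopologicalSpace G]

/-- Restriction: a finite `H`-set is viewed as an `L`-set. -/
noncomputable def burnsideRes {L H : OpenSubgroup G} (h : L ≤ H) : Burnside H →+* Burnside L :=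
  GrothendieckRing.map (FinGSetClass.pullback (incl h) (continuous_incl h))

theorem burnsideRes_toBurnside {L H : OpenSubgroup G} (h : L ≤ H) (X : FinGSet H) :
    burnsideRes h X.toBurnside = (X.pullback (incl h) (continuous_incl h)).toBurnside :=
  GrothendieckRing.liftAdd_of _ _

variable [IsTopologicalGroup G]

/-- The conjugate subgroup `g⁻¹ H g`. -/
def conjSubgroup (g : G) (H : OpenSubgroup G) : OpenSubgroup G :=
  H.comap (MulAut.conj g).toMonoidHom ((continuous_const.mul continuous_id).mul continuous_const)

/-- The isomorphism `k ↦ g k g⁻¹` from `g⁻¹ H g` to `H`. -/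
def conjHom (g : G) (H : OpenSubgroup G) : conjSubgroup g H →* H where
  toFun k := ⟨g * k * g⁻¹, k.2⟩
  map_one' := Subtype.ext (by simp)
  map_mul' a b := Subtype.ext (by simp)

theorem continuous_conjHom (g : G) (H : OpenSubgroup G) : Continuous (conjHom g H) :=
  Continuous.subtype_mk ((continuous_const.mul continuous_subtype_val).mul continuous_const) _

/-- Conjugation. -/
noncomputable def burnsideConj (g : G) (H : OpenSubgroup G) : Burnside H →+* Burnside (conjSubgroup g H) :=
  GrothendieckRing.map (FinGSetClass.pullback (conjHom g H) (continuous_conjHom g H))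

variable [CompactSpace G] {L H : OpenSubgroup G}

/-- Transfer: the additive extension of `X ↦ H ×_L X`. -/
noncomputable def burnsideTr (h : L ≤ H) : Burnside L →+ Burnside H :=
  GrothendieckRing.liftAdd (GrothendieckRing.of.comp (FinGSetClass.ind h))

/-- Norm: the extension of `X ↦ Map_L(H, X)` to formal differences of finite `L`-sets. Since
`k ↦ [Map_L(H, X ⊔ k Y)]` is polynomial in `k` of degree at most the number of cosets of `L` in `H`
(`isPoly_coind`), the value at `[X] - [Y]` is the value of that polynomial at `k = -1`; it depends
only on `[X] - [Y]` (`burnsideNorm_of_sub_of`). -/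
noncomputable def burnsideNorm (h : L ≤ H) (x : Burnside L) : Burnside H :=
  newton (fun a : FinGSetClass L => GrothendieckRing.of (FinGSetClass.coind h a))
    (cosetIndex L H) (GrothendieckRing.exists_rep x).choose
    (GrothendieckRing.exists_rep x).choose_spec.choose

theorem burnsideNorm_of_sub_of (h : L ≤ H) (a b : FinGSetClass L) :
    burnsideNorm h (GrothendieckRing.of a - GrothendieckRing.of b) =
      newton (fun a : FinGSetClass L => GrothendieckRing.of (FinGSetClass.coind h a))
        (cosetIndex L H) a b := by
  set x : Burnside L := GrothendieckRing.of a - GrothendieckRing.of b with hx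
  obtain ⟨c, hc⟩ := GrothendieckRing.of_eq_of.mp
    (show GrothendieckRing.of ((GrothendieckRing.exists_rep x).choose + b)
      = GrothendieckRing.of (a + (GrothendieckRing.exists_rep x).choose_spec.choose) by
      have := (GrothendieckRing.exists_rep x).choose_spec.choose_spec
      rw [map_add, map_add, ← sub_eq_sub_iff_add_eq_add, ← this, hx])
  rw [burnsideNorm]
  generalize (GrothendieckRing.exists_rep x).choose_spec.choose = b' at *
  generalize (GrothendieckRing.exists_rep x).choose = a' at *
  rw [← newton_add_right (isPoly_coind h) a' b' (b + c),
    ← newton_add_right (isPoly_coind h) a b (b' + c), ← add_assoc, hc]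
  congr 1 <;> abel

theorem burnsideNorm_toBurnside (h : L ≤ H) (X : FinGSet L) :
    burnsideNorm h X.toBurnside = (X.coind h).toBurnside := by
  have := burnsideNorm_of_sub_of h X.cls 0
  rw [map_zero, sub_zero, newton_zero] at this
  exact this

theorem burnsideTr_toBurnside (h : L ≤ H) (X : FinGSet L) :
    burnsideTr h X.toBurnside = (X.ind h).toBurnside := GrothendieckRing.liftAdd_of _ _

/-- The class of the transitive `H`-set `H / L` in the Burnside ring of `H`. -/
noncomputable def cosetClass (H L : OpenSubgroup G) : Burnside H := (cosetSet H L).toBurnside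

variable (G) in
/-- An ideal of the Burnside Tambara functor of the profinite group `G`. -/
structure TambaraIdeal where
  /-- The ideal at the level `G / H`. -/
  level : ∀ H : OpenSubgroup G, Ideal (Burnside H)
  res_mem : ∀ {L H : OpenSubgroup G} (h : L ≤ H) (x : Burnside H), x ∈ level H → burnsideRes h x ∈ level L
  tr_mem : ∀ {L H : OpenSubgroup G} (h : L ≤ H) (x : Burnside L), x ∈ level L → burnsideTr h x ∈ level H
  norm_mem : ∀ {L H : OpenSubgroup G} (h : L ≤ H) (x : Burnside L), x ∈ level L →
    burnsideNorm h x - burnsideNorm h 0 ∈ level H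
  conj_mem : ∀ (g : G) (H : OpenSubgroup G) (x : Burnside H), x ∈ level H →
    burnsideConj g H x ∈ level (conjSubgroup g H)

/-- The Tambara ideal generated by a set of elements of various levels: the intersection of all
Tambara ideals containing it. -/
noncomputable def TambaraIdeal.span (S : Set (Σ H : OpenSubgroup G, Burnside H)) :
    TambaraIdeal G where
  level H := ⨅ I : {I : TambaraIdeal G // ∀ a ∈ S, a.2 ∈ I.level a.1}, I.1.level H
  res_mem h x hx := by
    rw [Submodule.mem_iInf] at hx ⊢
    exact fun I => I.1.res_mem h x (hx I)
  tr_mem h x hx := by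
    rw [Submodule.mem_iInf] at hx ⊢
    exact fun I => I.1.tr_mem h x (hx I)
  norm_mem h x hx := by
    rw [Submodule.mem_iInf] at hx ⊢
    exact fun I => I.1.norm_mem h x (hx I)
  conj_mem g H x hx := by
    rw [Submodule.mem_iInf] at hx ⊢
    exact fun I => I.1.conj_mem g H x (hx I)

end BurnsideTambara

section GrothendieckWitt

/-- A regular quadratic space: a finite-dimensional vector space with a quadratic form whose polar
form `(x, y) ↦ Q (x + y) - Q x - Q y` is nondegenerate. -/
structure RegQuadSpace (E : Type v) [Field E] : Type (v + 1) where
  carrier : Type v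
  [addCommGroup : AddCommGroup carrier]
  [module : Module E carrier]
  [finiteDimensional : FiniteDimensional E carrier]
  form : QuadraticForm E carrier
  regular : form.polarBilin.SeparatingLeft

attribute [instance] RegQuadSpace.addCommGroup RegQuadSpace.module RegQuadSpace.finiteDimensional

variable {E : Type v} [Field E]

/-- Isometry of regular quadratic spaces. -/
instance RegQuadSpace.setoid (E : Type v) [Field E] : Setoid (RegQuadSpace E) where
  r V W := V.form.Equivalent W.form
  iseqv :=
    { refl := fun V => QuadraticMap.Equivalent.refl V.form
      symm := fun h => h.symm
      trans := fun h h' => h.trans h' }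

/-- The orthogonal sum. -/
def RegQuadSpace.sum (V W : RegQuadSpace E) : RegQuadSpace E where
  carrier := V.carrier × W.carrier
  form := QuadraticMap.prod V.form W.form
  regular := by
    rintro ⟨x, y⟩ hxy
    refine Prod.ext (V.regular x fun z => ?_) (W.regular y fun z => ?_)
    · simpa using hxy (z, 0)
    · simpa using hxy (0, z)

/-- The zero space. -/
def RegQuadSpace.zero (E : Type v) [Field E] : RegQuadSpace E where
  carrier := PUnit
  form := 0
  regular := fun _ _ => rfl

/-- The monoid of isometry classes of regular quadratic spaces under orthogonal sum. -/
def RegQuadClass (E : Type v) [Field E] : Type (v + 1) := Quotient (RegQuadSpace.setoid E)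

/-- The isometry class of a regular quadratic space. -/
def RegQuadSpace.cls (V : RegQuadSpace E) : RegQuadClass E := Quotient.mk _ V

instance : Add (RegQuadClass E) where
  add := Quotient.map₂ RegQuadSpace.sum fun _ _ h _ _ h' => QuadraticMap.Equivalent.prod h h'

instance : Zero (RegQuadClass E) := ⟨(RegQuadSpace.zero E).cls⟩

instance : AddCommMonoid (RegQuadClass E) where
  nsmul := nsmulRec
  add_assoc := by
    rintro ⟨U⟩ ⟨V⟩ ⟨W⟩
    refine Quotient.sound ⟨{ LinearEquiv.prodAssoc E _ _ _ with map_app' := ?_ }⟩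
    rintro ⟨⟨x, y⟩, z⟩
    exact (add_assoc (U.form x) (V.form y) (W.form z)).symm
  zero_add := by
    rintro ⟨V⟩
    refine Quotient.sound ⟨⟨(LinearEquiv.uniqueProd : (PUnit.{v + 1} × V.carrier) ≃ₗ[E] V.carrier), ?_⟩⟩
    rintro ⟨x, y⟩
    exact (zero_add (V.form y)).symm
  add_zero := by
    rintro ⟨V⟩
    refine Quotient.sound ⟨⟨(LinearEquiv.prodUnique : (V.carrier × PUnit.{v + 1}) ≃ₗ[E] V.carrier), ?_⟩⟩
    rintro ⟨x, y⟩
    exact (add_zero (V.form x)).symm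
  add_comm := by
    rintro ⟨V⟩ ⟨W⟩
    exact Quotient.sound ⟨QuadraticMap.IsometryEquiv.prodComm V.form W.form⟩

/-- The Grothendieck-Witt ring of a field of characteristic not `2`, as an additive group (its
multiplication plays no role for the kernel of a map into it). -/
abbrev GW (E : Type v) [Field E] : Type (v + 1) := Algebra.GrothendieckAddGroup (RegQuadClass E)

end GrothendieckWitt

section Dress

section TraceForm
variable {E : Type v} {K : Type v} [Field E] [NeZero (2 : E)] [Field K] [Algebra E K]

/-- The trace form `x ↦ tr_{M/E}(x²)` of a finite separable extension `M / E`. -/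
noncomputable def traceSpace (M : IntermediateField E K) [FiniteDimensional E M]
    [Algebra.IsSeparable E M] : RegQuadSpace E where
  carrier := M
  form := (Algebra.traceForm E M).toQuadraticMap
  regular := by
    intro x hx
    refine (traceForm_nondegenerate E M).1 x fun y => ?_
    have h := hx y
    rw [QuadraticMap.polarBilin_apply_apply, LinearMap.BilinMap.polar_toQuadraticMap,
      Algebra.traceForm_apply, Algebra.traceForm_apply, mul_comm y x, ← two_mul] at h
    exact (mul_eq_zero.mp h).resolve_left two_ne_zero

theorem traceSpace_cls_map (M M' : IntermediateField E K) [FiniteDimensional E M]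
    [Algebra.IsSeparable E M] [FiniteDimensional E M'] [Algebra.IsSeparable E M']
    (σ : K ≃ₐ[E] K) (h : M' = M.map (σ : K →ₐ[E] K)) :
    (traceSpace M).cls = (traceSpace M').cls := by
  subst h
  let e := IntermediateField.intermediateFieldMap σ M
  refine Quotient.sound ⟨⟨e.toLinearEquiv, fun x => ?_⟩⟩
  have h : ∀ y : M, Algebra.trace E _ (e y * e y) = Algebra.trace E _ (y * y) := fun y => by
    rw [← map_mul, Algebra.trace_eq_of_algEquiv]
  exact h x

end TraceForm

variable {F : Type u} {K : Type v} [Field F] [Field K] [Algebra F K]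

/-- The fixed field `K^H`. -/
noncomputable abbrev fixedFld (H : OpenSubgroup Gal(K/F)) : IntermediateField F K :=
  IntermediateField.fixedField (H : Subgroup Gal(K/F))

/-- For a subgroup `S` of `H`, the fixed field `K^S` as an extension of `K^H` inside `K`. -/
noncomputable def fixedExt (H : OpenSubgroup Gal(K/F)) (S : Subgroup H) :
    IntermediateField (fixedFld H) K :=
  IntermediateField.extendScalars (F := fixedFld H)
    (E := IntermediateField.fixedField
      (S.map (Subgroup.subtype (H : Subgroup Gal(K/F))))) (by
    intro x hx
    rw [IntermediateField.mem_fixedField_iff] at hx ⊢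
    rintro _ ⟨s, _, rfl⟩
    exact hx _ s.2)

theorem mem_fixedExt (H : OpenSubgroup Gal(K/F)) (S : Subgroup H) (x : K) :
    x ∈ fixedExt H S ↔ ∀ s ∈ S, (s : Gal(K/F)) x = x := by
  rw [fixedExt, IntermediateField.mem_extendScalars, IntermediateField.mem_fixedField_iff]
  constructor
  · intro hx s hs
    exact hx _ ⟨s, hs, rfl⟩
  · rintro hx _ ⟨s, hs, rfl⟩
    exact hx s hs

variable [IsGalois F K]

theorem finiteDimensional_fixedExt (H : OpenSubgroup Gal(K/F)) (S : Subgroup H)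
    (hS : IsOpen (S : Set H)) : FiniteDimensional (fixedFld H) (fixedExt H S) := by
  set T : Subgroup Gal(K/F) := S.map (Subgroup.subtype (H : Subgroup Gal(K/F))) with hT
  have hTo : IsOpen (T : Set Gal(K/F)) := by
    have := H.isOpen.isOpenMap_subtype_val _ hS
    convert this using 1
    ext g
    rfl
  have h1 : (IntermediateField.fixedField T).fixingSubgroup = T :=
    InfiniteGalois.fixingSubgroup_fixedField ⟨T, Subgroup.isClosed_of_isOpen _ hTo⟩
  have h2 : FiniteDimensional F (IntermediateField.fixedField T) :=
    (InfiniteGalois.isOpen_iff_finite _).mp (by rw [h1]; exact hTo)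
  have h3 : Module.Finite F (fixedExt H S) := h2
  exact Module.Finite.of_restrictScalars_finite F (fixedFld H) (fixedExt H S)

theorem isSeparable_fixedExt (H : OpenSubgroup Gal(K/F)) (S : Subgroup H) :
    Algebra.IsSeparable (fixedFld H) (fixedExt H S) := by
  infer_instance

instance neZero_two_fixedFld [NeZero (2 : F)] (H : OpenSubgroup Gal(K/F)) :
    NeZero (2 : fixedFld H) := by
  have h := NeZero.ne (2 : F)
  refine ⟨fun h' => h ((algebraMap F (fixedFld H)).injective ?_)⟩
  rw [map_ofNat, map_zero, h']

variable [NeZero (2 : F)]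

/-- The class in `GW(K^H)` of the trace form of `K^S / K^H`, for an open subgroup `S` of `H`. -/
noncomputable def traceClass (H : OpenSubgroup Gal(K/F)) (S : Subgroup H)
    (hS : IsOpen (S : Set H)) : GW (fixedFld H) :=
  haveI := finiteDimensional_fixedExt H S hS
  haveI := isSeparable_fixedExt H S
  Algebra.GrothendieckAddGroup.of (traceSpace (fixedExt H S)).cls

theorem traceClass_conj (H : OpenSubgroup Gal(K/F)) (S S' : Subgroup H)
    (hS : IsOpen (S : Set H)) (hS' : IsOpen (S' : Set H)) (g : H)
    (h : ∀ k, k ∈ S' ↔ g⁻¹ * k * g ∈ S) : traceClass H S hS = traceClass H S' hS' := by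
  have := finiteDimensional_fixedExt H S hS
  have := finiteDimensional_fixedExt H S' hS'
  let σ : K ≃ₐ[fixedFld H] K := IntermediateField.fixingSubgroupEquiv (fixedFld H)
    ⟨(g : Gal(K/F)), (IntermediateField.le_iff_le _ _).mp le_rfl g.2⟩
  have hσ : ∀ x, σ x = (g : Gal(K/F)) x := fun x => rfl
  refine congrArg _ (traceSpace_cls_map _ _ σ ?_)
  ext x
  rw [IntermediateField.mem_map, mem_fixedExt]
  constructor
  · intro hx
    refine ⟨(g⁻¹ : Gal(K/F)) x, (mem_fixedExt _ _ _).mpr fun s hs => ?_, ?_⟩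
    · have := hx (g * s * g⁻¹) ((h _).mpr (by simpa [mul_assoc] using hs))
      have h2 := congrArg ((g : Gal(K/F))⁻¹ : Gal(K/F)) this
      simpa [mul_assoc, AlgEquiv.mul_apply] using h2
    · change (g : Gal(K/F)) ((g⁻¹ : Gal(K/F)) x) = x
      rw [← AlgEquiv.mul_apply, mul_inv_cancel, AlgEquiv.one_apply]
  · rintro ⟨y, hy, rfl⟩ k hk
    have := (mem_fixedExt _ _ _).mp hy _ ((h k).mp hk)
    have h2 := congrArg (g : Gal(K/F)) this
    change (k : Gal(K/F)) ((g : Gal(K/F)) y) = (g : Gal(K/F)) y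
    simpa [mul_assoc, ← AlgEquiv.mul_apply] using h2

theorem traceClass_congr {H : OpenSubgroup Gal(K/F)} {S S' : Subgroup H}
    (hS : IsOpen (S : Set H)) (hS' : IsOpen (S' : Set H)) (h : S = S') :
    traceClass H S hS = traceClass H S' hS' := by
  subst h
  rfl

/-- The image under the Dress map of an orbit `H x ≅ H / Stab(x)` of a finite `H`-set: the class of
the trace form of `K^Stab(x) / K^H`. -/
noncomputable def orbitTraceClass {H : OpenSubgroup Gal(K/F)} (X : FinGSet H) :
    MulAction.orbitRel.Quotient H X.carrier → GW (fixedFld H) :=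
  Quotient.lift (fun x => traceClass H (MulAction.stabilizer H x) (X.isOpen_stabilizer x)) (by
    rintro _ y ⟨g, rfl⟩
    refine (traceClass_conj H _ _ _ _ g fun k => ?_).symm
    simp only [MulAction.mem_stabilizer_iff, mul_smul, inv_smul_eq_iff])

/-- The Dress map on a finite `H`-set: the sum over its orbits. -/
noncomputable def dressSet {H : OpenSubgroup Gal(K/F)} (X : FinGSet H) : GW (fixedFld H) :=
  ∑ᶠ o : MulAction.orbitRel.Quotient H X.carrier, orbitTraceClass X o

theorem dressSet_congr {H : OpenSubgroup Gal(K/F)} {X Y : FinGSet H} (h : X.Iso Y) :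
    dressSet X = dressSet Y := by
  obtain ⟨e, he⟩ := h
  have hstab : ∀ x, MulAction.stabilizer H (e x) = MulAction.stabilizer H x := by
    intro x
    ext k
    rw [MulAction.mem_stabilizer_iff, MulAction.mem_stabilizer_iff, ← he, e.apply_eq_iff_eq]
  let E : MulAction.orbitRel.Quotient H X.carrier ≃ MulAction.orbitRel.Quotient H Y.carrier :=
    Quotient.congr e (by
      intro a b
      constructor
      · rintro ⟨k, hk⟩
        exact ⟨k, by simpa [he] using congrArg e hk⟩
      · rintro ⟨k, hk⟩
        exact ⟨k, e.injective ((he _ _).trans hk)⟩)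
  refine finsum_eq_of_bijective E E.bijective ?_
  rintro ⟨x⟩
  exact traceClass_congr (X.isOpen_stabilizer x) (Y.isOpen_stabilizer (e x)) (hstab x).symm

theorem dressSet_sum {H : OpenSubgroup Gal(K/F)} (X Y : FinGSet H) :
    dressSet (X.sum Y) = dressSet X + dressSet Y := by
  let f : MulAction.orbitRel.Quotient H X.carrier ⊕ MulAction.orbitRel.Quotient H Y.carrier →
      MulAction.orbitRel.Quotient H (X.sum Y).carrier :=
    Sum.elim
      (Quotient.map Sum.inl (by rintro _ b ⟨k, rfl⟩; exact ⟨k, rfl⟩))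
      (Quotient.map Sum.inr (by rintro _ b ⟨k, rfl⟩; exact ⟨k, rfl⟩))
  have hf : Function.Bijective f := by
    constructor
    · have key : ∀ a b : (X.sum Y).carrier,
          Quotient.mk (MulAction.orbitRel H (X.sum Y).carrier) a = Quotient.mk _ b →
            ∃ k : H, k • b = a := fun a b hab => Quotient.exact hab
      rintro (a | a) (b | b) hab <;> induction a using Quotient.ind with | _ a <;>
        induction b using Quotient.ind with | _ b
      · obtain ⟨k, hk⟩ := key (Sum.inl a) (Sum.inl b) hab
        exact congrArg Sum.inl (Quotient.sound (s := MulAction.orbitRel H X.carrier)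
          ⟨k, Sum.inl_injective hk⟩)
      · obtain ⟨k, hk⟩ := key (Sum.inl a) (Sum.inr b) hab
        exact absurd hk Sum.inr_ne_inl
      · obtain ⟨k, hk⟩ := key (Sum.inr a) (Sum.inl b) hab
        exact absurd hk Sum.inl_ne_inr
      · obtain ⟨k, hk⟩ := key (Sum.inr a) (Sum.inr b) hab
        exact congrArg Sum.inr (Quotient.sound (s := MulAction.orbitRel H Y.carrier)
          ⟨k, Sum.inr_injective hk⟩)
    · rintro ⟨a | a⟩
      · exact ⟨Sum.inl (Quotient.mk _ a), rfl⟩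
      · exact ⟨Sum.inr (Quotient.mk _ a), rfl⟩
  have hX : Finite (MulAction.orbitRel.Quotient H X.carrier) := Quotient.finite _
  have hY : Finite (MulAction.orbitRel.Quotient H Y.carrier) := Quotient.finite _
  have hl : ∀ x : X.carrier, MulAction.stabilizer H (Sum.inl x : (X.sum Y).carrier)
      = MulAction.stabilizer H x := fun x => by
    ext k
    exact Sum.inl_injective.eq_iff (a := k • x) (b := x)
  have hr : ∀ y : Y.carrier, MulAction.stabilizer H (Sum.inr y : (X.sum Y).carrier)
      = MulAction.stabilizer H y := fun y => by
    ext k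
    exact Sum.inr_injective.eq_iff (a := k • y) (b := y)
  have := Fintype.ofFinite (MulAction.orbitRel.Quotient H X.carrier)
  have := Fintype.ofFinite (MulAction.orbitRel.Quotient H Y.carrier)
  rw [dressSet, dressSet, dressSet, finsum_eq_sum_of_fintype (orbitTraceClass X),
    finsum_eq_sum_of_fintype (orbitTraceClass Y), ← Fintype.sum_sumElim,
    ← finsum_eq_sum_of_fintype]
  refine (finsum_eq_of_bijective f hf ?_).symm
  rintro (x | y)
  · induction x using Quotient.ind with | _ x
    exact traceClass_congr (X.isOpen_stabilizer x) ((X.sum Y).isOpen_stabilizer (Sum.inl x))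
      (hl x).symm
  · induction y using Quotient.ind with | _ y
    exact traceClass_congr (Y.isOpen_stabilizer y) ((X.sum Y).isOpen_stabilizer (Sum.inr y))
      (hr y).symm

/-- The Dress map at level `G / H`, as an additive map `A(H) → GW(K^H)`. It sends `H / L` to the
trace form of `K^L / K^H` (`dress_cosetClass`). -/
noncomputable def dress (H : OpenSubgroup Gal(K/F)) : Burnside H →+ GW (fixedFld H) :=
  GrothendieckRing.liftAdd
    { toFun := Quotient.lift dressSet fun _ _ => dressSet_congr
      map_zero' := by
        change dressSet (FinGSet.empty H) = 0
        have : IsEmpty (MulAction.orbitRel.Quotient H (FinGSet.empty H).carrier) :=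
          ⟨fun o => (Quotient.out o).elim⟩
        exact finsum_of_isEmpty _
      map_add' := by
        rintro ⟨X⟩ ⟨Y⟩
        exact dressSet_sum X Y }

theorem dress_cosetClass (H L : OpenSubgroup Gal(K/F)) :
    dress H (cosetClass H L) =
      traceClass H ((L : Subgroup Gal(K/F)).subgroupOf (H : Subgroup Gal(K/F)))
        (Subgroup.subgroupOf_isOpen (H : Subgroup Gal(K/F)) _ L.isOpen) := by
  refine (GrothendieckRing.liftAdd_of _ _).trans ?_
  change dressSet (cosetSet H L) = _
  let o : MulAction.orbitRel.Quotient H (cosetSet H L).carrier :=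
    Quotient.mk _ ((1 : H) : H ⧸ (L : Subgroup Gal(K/F)).subgroupOf (H : Subgroup Gal(K/F)))
  have ho : ∀ o', o' = o := by
    intro o'
    induction o' using Quotient.ind with | _ x
    refine Quotient.sound (s := MulAction.orbitRel H (cosetSet H L).carrier) ?_
    induction x using QuotientGroup.induction_on with
    | H g => exact ⟨g, congrArg QuotientGroup.mk (mul_one g)⟩
  have : Unique (MulAction.orbitRel.Quotient H (cosetSet H L).carrier) := ⟨⟨o⟩, ho⟩
  rw [dressSet, finsum_unique, ho default]
  exact traceClass_congr ((cosetSet H L).isOpen_stabilizer _) _ (MulAction.stabilizer_quotient _)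

variable (F K) in
/-- The trace ideal of `K / F` at level `G / H`: the kernel of the Dress map. -/
noncomputable def traceIdeal (H : OpenSubgroup Gal(K/F)) : AddSubgroup (Burnside H) :=
  (dress H).ker

end Dress

section Padic

variable {p : ℕ} [Fact p.Prime] {G : Type v} [Group G] [TopologicalSpace G]

/-- The open subgroup of `G` corresponding to `p ^ n ℤ_p` under an isomorphism `G ≅ ℤ_p`. -/
def padicSubgroup (e : G ≃ₜ* Multiplicative ℤ_[p]) (n : ℕ) : OpenSubgroup G where
  carrier := {g | (p : ℤ_[p]) ^ n ∣ (e g).toAdd}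
  one_mem' := by simp
  mul_mem' {a b} ha hb := by simpa using dvd_add ha hb
  inv_mem' {a} ha := by simpa using ha
  isOpen' := by
    have h : IsOpen {z : ℤ_[p] | (p : ℤ_[p]) ^ n ∣ z} := by
      convert Metric.isOpen_ball (x := (0 : ℤ_[p])) (ε := (p : ℝ) ^ (-(n : ℤ) + 1)) using 1
      ext z
      rw [Set.mem_ofPred_eq, ← Ideal.mem_span_singleton, ← PadicInt.norm_le_pow_iff_mem_span_pow,
        PadicInt.norm_le_pow_iff_norm_lt_pow_add_one, mem_ball_zero_iff]
    exact h.preimage (continuous_toAdd.comp e.continuous)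

variable [IsTopologicalGroup G] [CompactSpace G]

/-- The class `t_{p^n, p^m}` of the transitive `p ^ n ℤ_p`-set `p ^ n ℤ_p / p ^ (n + m) ℤ_p`. -/
noncomputable def padicCoset (e : G ≃ₜ* Multiplicative ℤ_[p]) (n m : ℕ) :
    Burnside (padicSubgroup e n) :=
  cosetClass (padicSubgroup e n) (padicSubgroup e (n + m))

end Padic

end GalTambara

open GalTambara

/-! The kernel of the Dress map is identified, level by level, with an ideal that has nothing to do
with quadratic forms: `signIdeal`, the virtual finite sets of cardinality zero on which every group
element has sign `1`. That this family is a Tambara ideal is pure combinatorics. A group element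
acts on an induced or coinduced set by a monomial permutation over the cosets, and the sign of such
a permutation depends on its coefficients only through their signs. The multiplicative structure of
the Grothendieck-Witt rings, and norms between them, are therefore never needed.

The Burnside ring at level `n` is spanned additively by the classes `t_m` of `ℤ/p^m`, so the Dress
map is known once the trace forms of the layers are. For odd `p` an abelian extension of odd degree
has an orthonormal basis for the trace form (`exists_orthonormal_of_odd`), so the Dress map is
cardinality times `⟨1⟩`. All signs are `1`, and the rank recovers the cardinality.

For `p = 2` let `τ` be the trace form of the quadratic layer. Since the tower is infinite, this
layer and the quartic one lie in a cyclic octic extension. An element of that extension supplies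
three representations of one number by binary forms, which give (`traceFormSpace_octic_tower`) that
the quartic trace form is `τ + 2⟨1⟩`, that `2τ = 4⟨1⟩`, and, by discriminants, that `τ ≠ 2⟨1⟩`.
Transferring the first relation down the tower gives `t_m ↦ (2^m - 2)⟨1⟩ + τ` for `m ≥ 1`. So the
Dress map sees the cardinality and the parity of the number of nontrivial orbits. That parity is the
sign of a topological generator, which acts on each nontrivial orbit by a cycle of even length.

The same additive description shows that the proposed ring generators generate the kernel. A Tambara
ideal containing the proposed Tambara generators contains all the ring generators, by transfer and
multiplication. Conversely those Tambara generators lie in `signIdeal`, so the ideal they generate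
is contained in it, hence in the kernel. -/

namespace GalTambara

/-! ### Diagonal quadratic forms and their discriminants. -/

section DiagonalForms
variable {E : Type v} [Field E] [NeZero (2 : E)]

/-- The diagonal form `⟨c₀, …, cₙ₋₁⟩`. -/
def diagSpace {n : ℕ} (c : Fin n → E) (hc : ∀ i, c i ≠ 0) : RegQuadSpace E where
  carrier := Fin n → E
  form := QuadraticMap.weightedSumSquares E c
  regular := by
    intro x hx
    ext i
    have h := hx (Pi.single i 1)
    rw [QuadraticMap.polarBilin_apply_apply, QuadraticMap.polar] at h
    simp only [QuadraticMap.weightedSumSquares_apply, smul_eq_mul, Pi.add_apply,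
      ← Finset.sum_sub_distrib] at h
    rw [Finset.sum_eq_single i] at h
    · simp only [Pi.single_eq_same] at h
      have h2 : 2 * (c i * x i) = 0 := by linear_combination h
      simpa [hc i, NeZero.ne (2 : E)] using h2
    · intro j _ hj
      simp [Pi.single_eq_of_ne hj]
    · simp

/-- The class of the line `⟨c⟩` (and `0` when `c = 0`). -/
noncomputable def line (c : E) : RegQuadClass E :=
  open Classical in if h : c ≠ 0 then (diagSpace (fun _ : Fin 1 => c) fun _ => h).cls else 0

theorem diagSpace_cls {n : ℕ} (c : Fin n → E) (hc : ∀ i, c i ≠ 0) :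
    (diagSpace c hc).cls = ∑ i, line (c i) := by
  induction n with
  | zero =>
    rw [Finset.univ_eq_empty, Finset.sum_empty]
    let e : (Fin 0 → E) ≃ₗ[E] PUnit.{v + 1} := 0
    have h : ∀ x, (0 : E) = QuadraticMap.weightedSumSquares E c x := by simp
    exact Quotient.sound ⟨⟨e, fun x => h x⟩⟩
  | succ n ih =>
    rw [Fin.sum_univ_succ, ← ih (fun i => c i.succ) fun i => hc i.succ, line, dif_pos (hc 0)]
    let e : (Fin (n + 1) → E) ≃ₗ[E] (Fin 1 → E) × (Fin n → E) :=
      { toFun := fun x => (fun _ => x 0, fun i => x i.succ)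
        invFun := fun y => Fin.cons (y.1 0) y.2
        map_add' := fun _ _ => rfl
        map_smul' := fun _ _ => rfl
        left_inv := fun x => Fin.cons_self_tail (α := fun _ => E) x
        right_inv := fun y =>
          Prod.ext (funext fun i => congrArg y.1 (Subsingleton.elim 0 i)) rfl }
    have h : ∀ x, QuadraticMap.weightedSumSquares E (fun _ : Fin 1 => c 0) (e x).1 +
        QuadraticMap.weightedSumSquares E (fun i : Fin n => c i.succ) (e x).2 =
        QuadraticMap.weightedSumSquares E c x := by
      intro x
      simp only [QuadraticMap.weightedSumSquares_apply, Fin.sum_univ_succ, Fin.sum_univ_zero,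
        add_zero]
      rfl
    exact Quotient.sound ⟨⟨e, fun x => h x⟩⟩

/-- A regular space with an orthogonal basis is the sum of the lines spanned by the basis. -/
theorem cls_eq_sum_line (V : RegQuadSpace E) {n : ℕ} (b : Module.Basis (Fin n) E V.carrier)
    (c : Fin n → E) (hc : ∀ i, c i ≠ 0) (hbc : ∀ i, V.form (b i) = c i)
    (hb : ∀ i j, i ≠ j → QuadraticMap.polar V.form (b i) (b j) = 0) :
    V.cls = ∑ i, line (c i) := by
  obtain rfl : (fun i => V.form (b i)) = c := funext hbc
  rw [← diagSpace_cls _ hc]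
  have : Invertible (2 : E) := invertibleOfNonzero (NeZero.ne _)
  have h := QuadraticMap.basisRepr_eq_of_iIsOrtho V.form b (fun i j hij => by
    change QuadraticMap.associated V.form (b i) (b j) = 0
    rw [QuadraticMap.associated_apply]
    have h2 := hb i j hij
    rw [QuadraticMap.polar] at h2
    rw [h2, smul_zero])
  refine Quotient.sound ?_
  change V.form.Equivalent (QuadraticMap.weightedSumSquares E fun i => V.form (b i))
  rw [← h]
  exact ⟨QuadraticMap.isometryEquivBasisRepr V.form b⟩

/-- Diagonalisation, which needs `2` to be invertible. It serves to give the unknown summand in a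
stable isometry a discriminant. -/
theorem exists_cls_eq_sum_line (x : RegQuadClass E) :
    ∃ (n : ℕ) (c : Fin n → E), (∀ i, c i ≠ 0) ∧ x = ∑ i, line (c i) := by
  induction x using Quotient.ind with | _ V
  have : Invertible (2 : E) := invertibleOfNonzero (NeZero.ne _)
  obtain ⟨w, hw⟩ := QuadraticForm.equivalent_weightedSumSquares_units_of_nondegenerate' V.form
    (by
      intro x hx
      refine V.regular x fun y => ?_
      have := hx y
      rw [QuadraticMap.associated_apply] at this
      rw [QuadraticMap.polarBilin_apply_apply, QuadraticMap.polar]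
      have h2 := congrArg ((2 : E) • ·) this
      rw [smul_zero] at h2
      simpa [smul_smul, NeZero.ne (2 : E)] using h2)
  refine ⟨_, fun i => (w i : E), fun i => (w i).ne_zero, ?_⟩
  rw [← diagSpace_cls _ fun i => (w i).ne_zero]
  refine Quotient.sound ?_
  change V.form.Equivalent (QuadraticMap.weightedSumSquares E fun i => (w i : E))
  convert hw using 1
  ext x
  simp [Units.smul_def]

/-- The discriminant is an invariant of the isometry class. -/
theorem exists_prod_eq_of_sum_line_eq {n : ℕ} {c d : Fin n → E} (hc : ∀ i, c i ≠ 0)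
    (hd : ∀ i, d i ≠ 0) (h : ∑ i, line (c i) = ∑ i, line (d i)) :
    ∃ s : E, ∏ i, c i = s ^ 2 * ∏ i, d i := by
  rw [← diagSpace_cls c hc, ← diagSpace_cls d hd] at h
  obtain ⟨f⟩ : (diagSpace c hc).form.Equivalent (diagSpace d hd).form := Quotient.exact h
  let g : (Fin n → E) ≃ₗ[E] (Fin n → E) := f.toLinearEquiv
  have hg : QuadraticMap.weightedSumSquares E c =
      (QuadraticMap.weightedSumSquares E d).comp g.toLinearMap := by
    ext x
    exact (f.map_app x).symm
  have : Invertible (2 : E) := invertibleOfNonzero (NeZero.ne _)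
  have hdisc : ∀ c : Fin n → E,
      QuadraticForm.discr' (QuadraticMap.weightedSumSquares E c) = ∏ i, c i := by
    intro c
    rw [QuadraticForm.discr', ← Matrix.det_diagonal]
    congr 1
    ext i j
    rw [QuadraticForm.toMatrix', LinearMap.toMatrix₂'_apply, QuadraticMap.associated_apply]
    simp only [QuadraticMap.weightedSumSquares_apply, smul_eq_mul, Pi.add_apply,
      ← Finset.sum_sub_distrib]
    by_cases hij : i = j
    · subst hij
      rw [Matrix.diagonal_apply_eq, Finset.sum_eq_single i]
      · simp
        ring_nf
        rw [mul_right_comm, inv_mul_cancel₀ (NeZero.ne (2 : E)), one_mul]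
      · intro k _ hk
        simp [Pi.single_eq_of_ne hk]
      · simp
    · rw [Matrix.diagonal_apply_ne _ hij]
      rw [Finset.sum_eq_zero, smul_zero]
      intro k _
      by_cases hk : k = i
      · subst hk
        simp [Pi.single_eq_of_ne hij]
      · simp [Pi.single_eq_of_ne hk]
  have h2 := congrArg QuadraticForm.discr' hg
  rw [QuadraticForm.discr'_comp, hdisc, hdisc] at h2
  exact ⟨_, by rw [h2, sq]⟩

/-- The class of the line `⟨c⟩` in the Grothendieck-Witt group. -/
noncomputable def gwLine (c : E) : GW E := Algebra.GrothendieckAddGroup.of (line c)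

/-- `⟨c, kc⟩ = ⟨cr, kcr⟩` when `r ≠ 0` is represented by `⟨1, k⟩`. -/
theorem gwLine_add_gwLine_mul {c k s t : E} (hc : c ≠ 0) (hk : k ≠ 0)
    (hr : s ^ 2 + k * t ^ 2 ≠ 0) :
    gwLine c + gwLine (k * c) =
      gwLine (c * (s ^ 2 + k * t ^ 2)) + gwLine (k * c * (s ^ 2 + k * t ^ 2)) := by
  have h0 : ∀ i, ![c, k * c] i ≠ 0 := by
    intro i
    fin_cases i <;> simp [hc, hk]
  -- The first vector has value `c r` for `r = s² + k t²`, the second spans its orthogonal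
  -- complement and has value `k c r`. The determinant is `r`.
  let b : Fin 2 → (Fin 2 → E) := ![![s, t], ![-(k * t), s]]
  have hb : LinearIndependent E b := by
    have hdet : (Matrix.of b).det ≠ 0 := by
      rw [Matrix.det_fin_two]
      convert hr using 1
      simp [b]
      ring
    exact Matrix.linearIndependent_rows_of_det_ne_zero hdet
  let B : Module.Basis (Fin 2) E (Fin 2 → E) :=
    basisOfLinearIndependentOfCardEqFinrank hb (by simp)
  have hB : ∀ i, B i = b i := fun i => by
    simp [B]
  have h1 : ∀ i, (diagSpace ![c, k * c] h0).form (B i) =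
      ![c * (s ^ 2 + k * t ^ 2), k * c * (s ^ 2 + k * t ^ 2)] i := by
    intro i
    change QuadraticMap.weightedSumSquares E ![c, k * c] (B i) = _
    rw [hB]
    fin_cases i <;> simp [b, QuadraticMap.weightedSumSquares_apply, Fin.sum_univ_two] <;> ring
  have h2 := cls_eq_sum_line (diagSpace ![c, k * c] h0) B
      ![c * (s ^ 2 + k * t ^ 2), k * c * (s ^ 2 + k * t ^ 2)] (by
      intro i
      fin_cases i <;> simp [hc, hk, hr]) h1 (by
      intro i j hij
      change QuadraticMap.weightedSumSquares E ![c, k * c] (B i + B j) -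
        QuadraticMap.weightedSumSquares E ![c, k * c] (B i) -
        QuadraticMap.weightedSumSquares E ![c, k * c] (B j) = 0
      rw [hB, hB]
      simp only [QuadraticMap.weightedSumSquares_apply, Fin.sum_univ_two]
      fin_cases i <;> fin_cases j <;> first | exact absurd rfl hij | (simp [b]; ring))
  rw [diagSpace_cls] at h2
  simp only [Fin.sum_univ_two] at h2
  simp only [gwLine, ← map_add]
  exact congrArg _ h2

/-- Rescaling the basis vector by `s` multiplies its value by `s²`. -/
theorem gwLine_mul_sq {c s : E} (hc : c ≠ 0) (hs : s ≠ 0) : gwLine (c * s ^ 2) = gwLine c := by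
  let B : Module.Basis (Fin 1) E (Fin 1 → E) :=
    (Pi.basisFun E (Fin 1)).isUnitSMul (w := fun _ => s) fun _ => hs.isUnit
  have hB : ∀ i, B i = fun _ => s := fun i => by
    ext j
    rw [Subsingleton.elim j i]
    simp [B, Module.Basis.isUnitSMul_apply]
  have h1 : ∀ i, (diagSpace (fun _ : Fin 1 => c) fun _ => hc).form (B i) = c * s ^ 2 := by
    intro i
    change QuadraticMap.weightedSumSquares E (fun _ : Fin 1 => c) (B i) = _
    rw [hB]
    simp [QuadraticMap.weightedSumSquares_apply, sq]
  have h2 := cls_eq_sum_line (diagSpace (fun _ : Fin 1 => c) fun _ => hc) B (fun _ => c * s ^ 2)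
      (fun _ => by simp [hc, hs]) h1 (fun i j hij => absurd (Subsingleton.elim i j) hij)
  rw [diagSpace_cls] at h2
  simp only [Fin.sum_univ_one] at h2
  exact congrArg Algebra.GrothendieckAddGroup.of h2.symm

end DiagonalForms

/-! ### Rank and discriminant on the Grothendieck-Witt group. -/

section GWInvariants
variable {E : Type v} [Field E]

/-- The rank of an isometry class. -/
noncomputable def RegQuadClass.rank : RegQuadClass E →+ ℤ where
  toFun := Quotient.lift (fun V => (Module.finrank E V.carrier : ℤ)) (by
    rintro V W ⟨f⟩
    exact congrArg _ f.toLinearEquiv.finrank_eq)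
  map_zero' := by
    change ((Module.finrank E PUnit.{v + 1} : ℕ) : ℤ) = 0
    rw [Module.finrank_zero_of_subsingleton, Nat.cast_zero]
  map_add' := by
    rintro ⟨V⟩ ⟨W⟩
    change ((Module.finrank E (V.carrier × W.carrier) : ℕ) : ℤ) =
      (Module.finrank E V.carrier : ℕ) + (Module.finrank E W.carrier : ℕ)
    rw [Module.finrank_prod]
    push_cast
    rfl

/-- The rank homomorphism `GW(E) → ℤ`. -/
noncomputable def gwRank : GW E →+ ℤ := Algebra.GrothendieckAddGroup.lift RegQuadClass.rank

theorem gwRank_of (x : RegQuadClass E) :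
    gwRank (Algebra.GrothendieckAddGroup.of x) = RegQuadClass.rank x :=
  DFunLike.congr_fun (Algebra.GrothendieckAddGroup.lift.symm_apply_apply RegQuadClass.rank) x

theorem gw_of_eq_of {x y : RegQuadClass E}
    (h : Algebra.GrothendieckAddGroup.of x = Algebra.GrothendieckAddGroup.of y) :
    ∃ z, x + z = y + z := by
  obtain ⟨z, hz⟩ :=
    ((AddLocalization.addMonoidOf (⊤ : AddSubmonoid (RegQuadClass E))).eq_iff_exists).mp h
  exact ⟨z, by rw [add_comm x, add_comm y]; exact hz⟩

variable [NeZero (2 : E)]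

theorem gwRank_gwLine {c : E} (hc : c ≠ 0) : gwRank (gwLine c) = 1 := by
  rw [gwLine, gwRank_of, line, dif_pos hc]
  change ((Module.finrank E (Fin 1 → E) : ℕ) : ℤ) = 1
  simp

/-- Equality of binary forms in `GW` forces equality of discriminants modulo squares. -/
theorem isSquare_of_gwLine_add_eq {a b c d : E} (ha : a ≠ 0) (hb : b ≠ 0) (hc : c ≠ 0)
    (hd : d ≠ 0) (h : gwLine a + gwLine b = gwLine c + gwLine d) :
    ∃ s : E, a * b = s ^ 2 * (c * d) := by
  simp only [gwLine, ← map_add] at h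
  obtain ⟨z, hz⟩ := gw_of_eq_of h
  -- The common summand is diagonalised so that its nonzero discriminant cancels from both sides;
  -- Witt cancellation is not needed.
  obtain ⟨n, w, hw, rfl⟩ := exists_cls_eq_sum_line z
  have key : ∀ x y : E, x ≠ 0 → y ≠ 0 → ∀ i : Fin (n + 2),
      (Fin.cons x (Fin.cons y w) : Fin (n + 2) → E) i ≠ 0 := by
    intro x y hx hy i
    refine Fin.cases hx (fun i => ?_) i
    refine Fin.cases hy (fun i => ?_) i
    simpa using hw i
  obtain ⟨s, hs⟩ := exists_prod_eq_of_sum_line_eq (key a b ha hb) (key c d hc hd) (by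
    simpa [Fin.sum_univ_succ, add_assoc] using hz)
  refine ⟨s, ?_⟩
  simp only [Fin.prod_univ_succ, Fin.cons_zero, Fin.cons_succ] at hs
  have hW : ∏ i, w i ≠ 0 := Finset.prod_ne_zero_iff.mpr fun i _ => hw i
  exact mul_right_cancel₀ hW (by linear_combination hs)

end GWInvariants

/-! ### Transfer of quadratic forms along the trace. -/

section Transfer

section
variable (E M : Type v) [Field E] [NeZero (2 : E)] [Field M] [Algebra E M]
  [FiniteDimensional E M] [Algebra.IsSeparable E M]

/-- The trace form of a finite separable extension. -/
noncomputable def traceFormSpace : RegQuadSpace E where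
  carrier := M
  form := (Algebra.traceForm E M).toQuadraticMap
  regular := by
    intro x hx
    refine (traceForm_nondegenerate E M).1 x fun y => ?_
    have h := hx y
    rw [QuadraticMap.polarBilin_apply_apply, LinearMap.BilinMap.polar_toQuadraticMap,
      Algebra.traceForm_apply, Algebra.traceForm_apply, mul_comm y x, ← two_mul] at h
    exact (mul_eq_zero.mp h).resolve_left two_ne_zero

end

theorem traceFormSpace_cls_congr {E M N : Type v} [Field E] [NeZero (2 : E)] [Field M]
    [Algebra E M] [FiniteDimensional E M] [Algebra.IsSeparable E M] [Field N]
    [Algebra E N] [FiniteDimensional E N] [Algebra.IsSeparable E N] (e : M ≃ₐ[E] N) :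
    (traceFormSpace E M).cls = (traceFormSpace E N).cls := by
  refine Quotient.sound ⟨⟨e.toLinearEquiv, fun x => ?_⟩⟩
  have h : ∀ y : M, Algebra.trace E _ (e y * e y) = Algebra.trace E _ (y * y) := fun y => by
    rw [← map_mul, Algebra.trace_eq_of_algEquiv]
  exact h x

variable (E : Type v) {M : Type v} [Field E] [Field M] [Algebra E M]
  [FiniteDimensional E M] [Algebra.IsSeparable E M]

/-- The transfer of a quadratic space along the trace of a finite separable extension. -/
noncomputable def RegQuadSpace.transfer (V : RegQuadSpace M) : RegQuadSpace E :=
  letI : Module E V.carrier := Module.compHom V.carrier (algebraMap E M)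
  haveI : IsScalarTower E M V.carrier := IsScalarTower.of_algebraMap_smul fun _ _ => rfl
  { carrier := V.carrier
    finiteDimensional := Module.Finite.trans M V.carrier
    form := (Algebra.trace E M).compQuadraticMap' V.form
    regular := by
      have hpol : ∀ x y, QuadraticMap.polar ((Algebra.trace E M).compQuadraticMap' V.form) x y =
          Algebra.trace E M (QuadraticMap.polar V.form x y) := by
        intro x y
        simp [QuadraticMap.polar]
      intro x hx
      refine V.regular x fun y => ?_
      -- A value of the polar form over `M` is zero once all its `M`-multiples have trace zero;
      -- these multiples arise by replacing `y` with `c • y`.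
      refine (traceForm_nondegenerate E M).1 _ fun c => ?_
      have h := hx (c • y)
      rw [QuadraticMap.polarBilin_apply_apply, hpol, QuadraticMap.polar_smul_right] at h
      rw [Algebra.traceForm_apply, mul_comm]
      exact h }

/-- The transfer `GW(M) → GW(E)`. -/
noncomputable def gwTransfer : GW M →+ GW E :=
  Algebra.GrothendieckAddGroup.lift
    (Algebra.GrothendieckAddGroup.of.comp
      { toFun := Quotient.map (RegQuadSpace.transfer E) (by
          rintro V W ⟨f⟩
          let _ : Module E V.carrier := Module.compHom V.carrier (algebraMap E M)
          let _ : Module E W.carrier := Module.compHom W.carrier (algebraMap E M)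
          exact ⟨⟨{ f.toLinearEquiv with
            map_smul' := fun c x => f.toLinearEquiv.map_smul (algebraMap E M c) x },
            fun x => congrArg (Algebra.trace E M) (f.map_app x)⟩⟩)
        map_zero' := by
          let _ : Module E PUnit.{v + 1} := Module.compHom PUnit.{v + 1} (algebraMap E M)
          exact Quotient.sound ⟨⟨{ toFun := fun x => x
                                   invFun := fun x => x
                                   map_add' := fun _ _ => rfl
                                   map_smul' := fun _ _ => rfl
                                   left_inv := fun _ => rfl
                                   right_inv := fun _ => rfl },
            fun x => (map_zero (Algebra.trace E M)).symm⟩⟩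
        map_add' := by
          rintro ⟨V⟩ ⟨W⟩
          exact Quotient.sound ⟨⟨{ toFun := fun x => x
                                   invFun := fun x => x
                                   map_add' := fun _ _ => rfl
                                   map_smul' := fun _ _ => rfl
                                   left_inv := fun _ => rfl
                                   right_inv := fun _ => rfl },
            fun x => (map_add (Algebra.trace E M) (V.form x.1) (W.form x.2)).symm⟩⟩ })

theorem gwTransfer_of (V : RegQuadSpace M) :
    gwTransfer E (Algebra.GrothendieckAddGroup.of V.cls) =
      Algebra.GrothendieckAddGroup.of (V.transfer E).cls := by
  rw [gwTransfer]
  exact DFunLike.congr_fun (Algebra.GrothendieckAddGroup.lift.symm_apply_apply _) V.cls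

/-- Transitivity of the trace in `N / M / E`. It allows relations between trace forms over a higher
field of the tower to be pushed down. -/
theorem gwTransfer_traceFormSpace [NeZero (2 : E)] [NeZero (2 : M)] (N : Type v) [Field N] [Algebra M N]
    [FiniteDimensional M N] [Algebra.IsSeparable M N] [Algebra E N] [IsScalarTower E M N]
    [FiniteDimensional E N] [Algebra.IsSeparable E N] :
    gwTransfer E (Algebra.GrothendieckAddGroup.of (traceFormSpace M N).cls) =
      Algebra.GrothendieckAddGroup.of (traceFormSpace E N).cls := by
  rw [gwTransfer_of]
  refine congrArg _ (Quotient.sound ?_)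
  let _ : Module E (traceFormSpace M N).carrier := Module.compHom N (algebraMap E M)
  exact ⟨⟨{ toFun := fun x => x
            invFun := fun x => x
            map_add' := fun _ _ => rfl
            map_smul' := fun c x => (algebraMap_smul M c (show N from x))
            left_inv := fun _ => rfl
            right_inv := fun _ => rfl },
    fun x => (Algebra.trace_trace (R := E) (S := M)
      (HMul.hMul (α := N) (β := N) x x)).symm⟩⟩

end Transfer

/-! ### Relations between binary forms. -/

section GWRelations
variable {E : Type v} [Field E] [NeZero (2 : E)]

theorem gwLine_add_gwLine_neg {c : E} (hc : c ≠ 0) :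
    gwLine c + gwLine (-c) = gwLine 1 + gwLine (-1) := by
  have h2 : (2 : E) ≠ 0 := NeZero.ne _
  -- The hyperbolic plane represents every `c`, by the difference of squares.
  have h : ((c + 1) / 2) ^ 2 + -1 * ((c - 1) / 2) ^ 2 = c := by
    field_simp
    ring
  have := gwLine_add_gwLine_mul (c := 1) (k := -1) (s := (c + 1) / 2) (t := (c - 1) / 2)
    one_ne_zero (by simp) (by rwa [h])
  rw [h] at this
  simpa using this.symm

theorem gwLine_add_self_mul {c s t : E} (hc : c ≠ 0) (hr : s ^ 2 + t ^ 2 ≠ 0) :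
    gwLine c + gwLine c = gwLine (c * (s ^ 2 + t ^ 2)) + gwLine (c * (s ^ 2 + t ^ 2)) := by
  simpa using gwLine_add_gwLine_mul (k := 1) (s := s) (t := t) hc one_ne_zero (by simpa using hr)

/-- The case `2 = 1² + 1²` of the preceding relation. -/
theorem gwLine_two_mul_add_self {c : E} (hc : c ≠ 0) :
    gwLine (2 * c) + gwLine (2 * c) = gwLine c + gwLine c := by
  have h2 : (2 : E) ≠ 0 := NeZero.ne _
  have := gwLine_add_self_mul (c := c) (s := 1) (t := 1) hc (by
    rw [one_pow, one_add_one_eq_two]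
    exact h2)
  rw [this]
  norm_num [mul_comm]

/-- The relation between trace forms of the quadratic and the quartic layer of a cyclic octic
extension, with the arithmetic of that extension entering through the three displayed equations. -/
theorem gwLine_quartic_relation {d w u α s t s' t' : E} (hd : d ≠ 0) (hw : w ≠ 0)
    (h1 : w = u ^ 2 - 2 * α ^ 2) (h2 : w = d * (s ^ 2 + 2 * t ^ 2))
    (h3 : w ^ 2 = d * (t' ^ 2 + s' ^ 2)) :
    gwLine 4 + gwLine (4 * d) + gwLine (2 * w) + gwLine (2 * w) =
        gwLine 2 + gwLine (2 * d) + 2 • gwLine (1 : E) ∧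
      2 • (gwLine 2 + gwLine (2 * d)) = 4 • gwLine (1 : E) := by
  have t2 : (2 : E) ≠ 0 := NeZero.ne _
  set r := s ^ 2 + 2 * t ^ 2 with hr
  have hr0 : r ≠ 0 := right_ne_zero_of_mul (h2 ▸ hw)
  have hr' : t' ^ 2 + s' ^ 2 ≠ 0 := right_ne_zero_of_mul (h3 ▸ pow_ne_zero 2 hw)
  -- By `h3` the sum of squares `t'² + s'²` equals `d (w / d)²`, so up to squares `d` itself is a
  -- sum of two squares.
  have hA : ∀ c : E, c ≠ 0 → gwLine (d * c) + gwLine (d * c) = gwLine c + gwLine c := by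
    intro c hc
    rw [gwLine_add_self_mul hc hr']
    have : c * (t' ^ 2 + s' ^ 2) = d * c * (w / d) ^ 2 := by
      field_simp
      linear_combination -h3
    rw [this, gwLine_mul_sq (mul_ne_zero hd hc) (div_ne_zero hw hd)]
  have hC : gwLine (1 : E) + gwLine 2 = gwLine r + gwLine (2 * r) := by
    simpa using gwLine_add_gwLine_mul (c := (1 : E)) (k := 2) (s := s) (t := t) one_ne_zero t2 hr0
  -- By `h1` the form `⟨1, -2⟩` represents `w`, so `⟨d, -2d⟩ = ⟨dw, -2dw⟩`, and by `h2` the product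
  -- `d w` is `r d²`.
  have hD : gwLine d + gwLine (-(2 * d)) = gwLine r + gwLine (-(2 * r)) := by
    have hw' : u ^ 2 + -2 * α ^ 2 = w := by rw [h1]; ring
    have := gwLine_add_gwLine_mul (c := d) (k := -2) (s := u) (t := α) hd (by simpa using t2)
      (by rwa [hw'])
    rw [hw'] at this
    have e1 : d * w = r * d ^ 2 := by rw [h2]; ring
    have e2 : -2 * d * w = -(2 * r) * d ^ 2 := by rw [h2]; ring
    rw [e1, e2, gwLine_mul_sq hr0 hd,
      gwLine_mul_sq (neg_ne_zero.mpr (mul_ne_zero t2 hr0)) hd] at this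
    rw [← this]
    congr 2
    ring
  have hH := (gwLine_add_gwLine_neg (mul_ne_zero t2 hd)).trans
    (gwLine_add_gwLine_neg (mul_ne_zero t2 hr0)).symm
  have e4 : gwLine (4 : E) = gwLine 1 := by
    have := gwLine_mul_sq (c := (1 : E)) (s := 2) one_ne_zero t2
    rw [← this]
    norm_num
  have e4d : gwLine (4 * d) = gwLine d := by
    have := gwLine_mul_sq (c := d) (s := 2) hd t2
    rw [← this]
    congr 1
    ring
  have ew := gwLine_two_mul_add_self hw
  have ew' := hA r hr0
  rw [← h2] at ew'
  have er := gwLine_two_mul_add_self hr0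
  have e1 := gwLine_two_mul_add_self (one_ne_zero (α := E))
  rw [mul_one] at e1
  have ed := gwLine_two_mul_add_self hd
  have ed' := hA 1 one_ne_zero
  rw [mul_one] at ed'
  rw [e4, e4d]
  generalize gwLine (1 : E) = l1 at *
  generalize gwLine (2 : E) = l2 at *
  generalize gwLine (2 * w) = l2w at *
  generalize gwLine w = lw at *
  generalize gwLine d = ld at *
  generalize gwLine (2 * d) = l2d at *
  generalize gwLine r = lr at *
  generalize gwLine (2 * r) = l2r at *
  constructor
  · have a1 : ld + l2r = lr + l2d := by
      have := congrArg₂ (· - ·) hD hH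
      simp only [add_sub_add_comm] at this
      have b : ld - l2d = lr - l2r := by
        have hh : gwLine (-(2 * d)) = l2r + gwLine (-(2 * r)) - l2d := by
          rw [← hH]; abel
        rw [hh] at hD
        have : ld + (l2r + gwLine (-(2 * r)) - l2d) - gwLine (-(2 * r)) = lr := by
          rw [hD]; abel
        rw [← this]; abel
      rw [← sub_eq_zero] at b ⊢
      rw [← b]; abel
    calc l1 + ld + l2w + l2w = l1 + ld + (l2w + l2w) := by abel
      _ = l1 + (ld + l2r) + l2r := by rw [ew, ew', ← er]; abel
      _ = l1 + (lr + l2r) + l2d := by rw [a1]; abel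
      _ = l2 + l2d + 2 • l1 := by rw [← hC]; abel
  · calc 2 • (l2 + l2d) = (l2 + l2) + (l2d + l2d) := by abel
      _ = 4 • l1 := by rw [e1, ed, ed']; abel

end GWRelations

/-! ### Trace forms from orthogonal families. -/

section OrthogonalFamily
variable {E M : Type v} [Field E] [NeZero (2 : E)] [Field M] [Algebra E M]
  [FiniteDimensional E M] [Algebra.IsSeparable E M]

/-- Pairwise orthogonal vectors of nonzero value are linearly independent, so as many of them as the
degree form a basis. -/
theorem traceFormSpace_cls_eq_sum {n : ℕ} (v : Fin n → M) (c : Fin n → E)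
    (hn : Module.finrank E M = n) (hc : ∀ i, c i ≠ 0)
    (hv : ∀ i, Algebra.trace E M (v i * v i) = c i)
    (ho : ∀ i j, i ≠ j → Algebra.trace E M (v i * v j) = 0) :
    (traceFormSpace E M).cls = ∑ i, line (c i) := by
  have hli : LinearIndependent E v := by
    rw [Fintype.linearIndependent_iff]
    intro a ha i
    have h := congrArg (fun x => Algebra.trace E M (x * v i)) ha
    simp only [Finset.sum_mul, map_sum, smul_mul_assoc, map_smul, zero_mul, map_zero] at h
    rw [Finset.sum_eq_single i] at h
    · rw [hv, smul_eq_mul] at h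
      exact (mul_eq_zero.mp h).resolve_right (hc i)
    · intro j _ hj
      rw [ho j i hj, smul_zero]
    · simp
  let B : Module.Basis (Fin n) E M :=
    basisOfLinearIndependentOfCardEqFinrank' v hli (by simpa using hn.symm)
  have hB : ∀ i, B i = v i := fun i => by simp [B]
  refine cls_eq_sum_line (traceFormSpace E M) B c hc (fun i => ?_) fun i j hij => ?_
  · change Algebra.trace E M (B i * B i) = c i
    rw [hB, hv]
  · change Algebra.trace E M ((B i + B j) * (B i + B j)) - Algebra.trace E M (B i * B i) -
      Algebra.trace E M (B j * B j) = 0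
    rw [hB, hB, ← map_sub, ← map_sub]
    have : (v i + v j) * (v i + v j) - v i * v i - v j * v j = v i * v j + v j * v i := by ring
    rw [this, map_add, ho i j hij, ho j i hij.symm, add_zero]

end OrthogonalFamily

/-! ### Cyclic layers: traces and normal bases through powers of one automorphism. -/

section CyclicLayer
variable {E K : Type v} [Field E] [Field K] [Algebra E K]

/-- An automorphism of `K` whose fixed elements in the finite Galois extension `M` of `E` are those
of `E` generates the Galois group of `M`. -/
theorem zpowers_restrictNormal_eq_top (M : IntermediateField E K) [FiniteDimensional E M]
    [IsGalois E M] (σ : Gal(K/E)) (hfix : ∀ x ∈ M, σ x = x → x ∈ (⊥ : IntermediateField E K)) :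
    Subgroup.zpowers (σ.restrictNormal M) = ⊤ := by
  have h : IntermediateField.fixedField (Subgroup.zpowers (σ.restrictNormal M)) =
      (⊥ : IntermediateField E M) := by
    rw [eq_bot_iff]
    intro x hx
    rw [IntermediateField.mem_fixedField_iff] at hx
    have h1 := hx _ (Subgroup.mem_zpowers _)
    have h2 := AlgEquiv.restrictNormal_commutes σ M x
    rw [h1] at h2
    obtain ⟨a, ha⟩ := IntermediateField.mem_bot.mp (hfix x x.2 h2.symm)
    exact IntermediateField.mem_bot.mpr ⟨a, Subtype.ext ha⟩
  rw [← IntermediateField.fixingSubgroup_fixedField (Subgroup.zpowers (σ.restrictNormal M)), h,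
    IntermediateField.fixingSubgroup_bot]

theorem coe_restrictNormal_pow (M : IntermediateField E K) [Normal E M] (σ : Gal(K/E)) (i : ℕ)
    (x : M) : (((σ.restrictNormal M) ^ i) x : K) = (σ ^ i) x := by
  have h := AlgEquiv.restrictNormal_commutes (σ ^ i) M x
  have h2 : (σ ^ i).restrictNormal M = (σ.restrictNormal M) ^ i :=
    map_pow (AlgEquiv.restrictNormalHom (F := E) (K₁ := K) M) σ i
  rw [h2] at h
  exact h

variable (M : IntermediateField E K) [FiniteDimensional E M] [IsGalois E M] (σ : Gal(K/E))
  (hfix : ∀ x ∈ M, σ x = x → x ∈ (⊥ : IntermediateField E K))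

include hfix in
theorem orderOf_restrictNormal : orderOf (σ.restrictNormal M) = Module.finrank E M := by
  rw [← Nat.card_zpowers, zpowers_restrictNormal_eq_top M σ hfix, Subgroup.card_top,
    IsGalois.card_aut_eq_finrank]

include hfix in
theorem bijective_restrictNormal_pow :
    Function.Bijective fun i : Fin (Module.finrank E M) => (σ.restrictNormal M) ^ (i : ℕ) := by
  have ho := orderOf_restrictNormal M σ hfix
  rw [Fintype.bijective_iff_injective_and_card]
  constructor
  · intro i j hij
    exact Fin.ext (pow_injOn_Iio_orderOf (by simp [ho]) (by simp [ho]) hij)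
  · rw [Fintype.card_fin, ← Nat.card_eq_fintype_card, IsGalois.card_aut_eq_finrank]

include hfix in
-- The powers of `σ` below the degree run through the Galois group of `M`. The sum is taken in `K`,
-- so that one `σ` serves all layers at once.
theorem trace_eq_sum_pow (x : M) :
    algebraMap E K (Algebra.trace E M x) =
      ∑ i ∈ Finset.range (Module.finrank E M), (σ ^ i) (x : K) := by
  have h := congrArg (algebraMap M K) (trace_eq_sum_automorphisms (K := E) x)
  rw [← IsScalarTower.algebraMap_apply] at h
  rw [h, ← (bijective_restrictNormal_pow M σ hfix).sum_comp (fun g : Gal(M/E) => g x), map_sum,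
    Finset.sum_range]
  exact Finset.sum_congr rfl fun i _ => coe_restrictNormal_pow M σ i x

include hfix in
/-- A normal basis, in terms of powers of `σ`. -/
theorem exists_normal_basis_pow : ∃ x : M,
    LinearIndependent E (fun i : Fin (Module.finrank E M) => (σ ^ (i : ℕ)) (x : K)) ∧
      ∀ v : M, (∀ i < Module.finrank E M,
        Algebra.trace E M (v * ((σ.restrictNormal M) ^ i) x) = 0) → v = 0 := by
  have hb := bijective_restrictNormal_pow M σ hfix
  let b := IsGalois.normalBasis E M
  refine ⟨b 1, ?_, fun v hv => ?_⟩
  · have h1 := (b.linearIndependent.comp _ hb.injective).map' M.val.toLinearMap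
      (LinearMap.ker_eq_bot.mpr M.val.injective)
    have e : (fun i : Fin (Module.finrank E M) => (σ ^ (i : ℕ)) (b 1 : K)) =
        M.val.toLinearMap ∘ b ∘ fun i : Fin (Module.finrank E M) => (σ.restrictNormal M) ^ (i : ℕ) := by
      funext i
      rw [← coe_restrictNormal_pow M σ i (b 1)]
      exact congrArg Subtype.val (IsGalois.normalBasis_apply _).symm
    rw [e]
    exact h1
  · refine (traceForm_nondegenerate E M).1 v fun y => ?_
    have : (Algebra.traceForm E M v) = 0 := by
      refine b.ext fun g => ?_
      obtain ⟨i, rfl⟩ := hb.surjective g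
      rw [IsGalois.normalBasis_apply]
      exact hv i i.2
    rw [this, LinearMap.zero_apply]

end CyclicLayer

/-! ### A non-degenerate element in a cyclic octic extension. -/

section CyclicOctic
variable {E K : Type v} [Field E] [Field K] [Algebra E K]

theorem apply_mem_of_normal (M : IntermediateField E K) [Normal E M] (σ : Gal(K/E)) :
    ∀ x ∈ M, σ x ∈ M := fun x hx => by
  have h := AlgEquiv.restrictNormal_commutes σ M ⟨x, hx⟩
  change _ = σ x at h
  rw [← h]
  exact Subtype.property _

theorem pow_finrank_apply (M : IntermediateField E K) [FiniteDimensional E M] [IsGalois E M]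
    (σ : Gal(K/E)) (hfix : ∀ x ∈ M, σ x = x → x ∈ (⊥ : IntermediateField E K)) :
    ∀ x ∈ M, (σ ^ Module.finrank E M) x = x := fun x hx => by
  have h := coe_restrictNormal_pow M σ (Module.finrank E M) ⟨x, hx⟩
  rw [← orderOf_restrictNormal M σ hfix, pow_orderOf_eq_one] at h
  rw [← orderOf_restrictNormal M σ hfix]
  exact h.symm

/-- In a cyclic octic extension there is an element `y` with `σ⁴ y = -y` for which a certain
quartic form does not vanish. -/
theorem exists_octic_generator (M : IntermediateField E K) [FiniteDimensional E M]
    [IsGalois E M] (σ : Gal(K/E)) (hfix : ∀ x ∈ M, σ x = x → x ∈ (⊥ : IntermediateField E K))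
    (hn : Module.finrank E M = 8) :
    ∃ y ∈ M, (σ ^ 4) y = -y ∧
      (y ^ 2 + σ y ^ 2 + (σ ^ 2) y ^ 2 + (σ ^ 3) y ^ 2) ^ 2 -
        2 * (y * σ y + σ y * (σ ^ 2) y + (σ ^ 2) y * (σ ^ 3) y - (σ ^ 3) y * y) ^ 2 ≠ 0 := by
  have hσM : ∀ x ∈ M, σ x ∈ M := apply_mem_of_normal M σ
  have hσ8 : ∀ x ∈ M, (σ ^ 8) x = x := hn ▸ pow_finrank_apply M σ hfix
  obtain ⟨⟨x, hx⟩, hli, hspan⟩ := exists_normal_basis_pow M σ hfix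
  have hadd : ∀ (i j : ℕ) (z : K), (σ ^ i) ((σ ^ j) z) = (σ ^ (i + j)) z := fun i j z => by
    rw [pow_add, AlgEquiv.mul_apply]
  have hM : ∀ (i : ℕ) (z : K), z ∈ M → (σ ^ i) z ∈ M := by
    intro i
    induction i with
    | zero => exact fun z hz => hz
    | succ i ih => exact fun z hz => by rw [pow_succ]; exact ih _ (hσM z hz)
  -- The normal basis generator is projected, up to a factor `2`, to the `-1` eigenspace of `σ⁴`.
  set y : K := x - (σ ^ 4) x with hy
  have hyM : y ∈ M := sub_mem hx (hM 4 x hx)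
  have hy4 : (σ ^ 4) y = -y := by
    rw [hy, map_sub, hadd, hσ8 x hx]
    ring
  refine ⟨y, hyM, hy4, fun h0 => ?_⟩
  set y1 := σ y with hy1
  set y2 := (σ ^ 2) y with hy2
  set y3 := (σ ^ 3) y with hy3
  have s1 : σ y1 = y2 := by rw [hy1, hy2, pow_two, AlgEquiv.mul_apply]
  have s2 : σ y2 = y3 := by rw [hy2, hy3, pow_succ' σ 2, AlgEquiv.mul_apply]
  have s3 : σ y3 = -y := by rw [← hy4, hy3, pow_succ' σ 3, AlgEquiv.mul_apply]
  have y1M : y1 ∈ M := hσM _ hyM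
  have y2M : y2 ∈ M := hM 2 _ hyM
  have y3M : y3 ∈ M := hM 3 _ hyM
  -- Put `B(v, v') = ∑_{j<4} σ^j v · σ^j v'` on the `-1` eigenspace. Then `U = B(y, y)`, `A = B(y, σ
  -- y)`, `B(y, σ² y) = 0` and `B(y, σ³ y) = -A`. The Gram matrix of `y, σ y, σ² y, σ³ y` is thus `U
  -- + A (S - S³)` with `S⁴ = -1` and `(S - S³)² = 2`, which is why `U² - 2A²` governs its
  -- degeneracy.
  set U : K := y ^ 2 + y1 ^ 2 + y2 ^ 2 + y3 ^ 2 with hU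
  set A : K := y * y1 + y1 * y2 + y2 * y3 - y3 * y with hA
  have hUM : U ∈ M := by
    simp only [hU]
    exact add_mem (add_mem (add_mem (pow_mem hyM 2) (pow_mem y1M 2)) (pow_mem y2M 2))
      (pow_mem y3M 2)
  have hAM : A ∈ M := by
    simp only [hA]
    exact sub_mem (add_mem (add_mem (mul_mem hyM y1M) (mul_mem y1M y2M)) (mul_mem y2M y3M))
      (mul_mem y3M hyM)
  have hσU : σ U = U := by
    simp only [hU, map_add, map_pow, s1, s2, s3, ← hy1]
    ring
  have hσA : σ A = A := by
    simp only [hA, map_add, map_sub, map_mul, s1, s2, s3, ← hy1]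
    ring
  obtain ⟨u, hu⟩ := IntermediateField.mem_bot.mp (hfix U hUM hσU)
  obtain ⟨a, ha⟩ := IntermediateField.mem_bot.mp (hfix A hAM hσA)
  -- a vector of the minus eigenspace is zero once it is orthogonal to `y, σ y, σ² y, σ³ y`
  have key : ∀ v ∈ M, (σ ^ 4) v = -v →
      (∀ k < 4, v * (σ ^ k) y + σ v * (σ ^ (k + 1)) y + (σ ^ 2) v * (σ ^ (k + 2)) y +
        (σ ^ 3) v * (σ ^ (k + 3)) y = 0) → v = 0 := by
    intro v hv hv4 hk
    have htr : ∀ i < Module.finrank E M,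
        Algebra.trace E M ((⟨v, hv⟩ : M) * ((σ.restrictNormal M) ^ i) ⟨x, hx⟩) = 0 := by
      -- Because `σ⁴ v = -v`, the eight terms of the trace fold into four and `x` is replaced by `y
      -- = x - σ⁴ x`.
      have hT : ∀ i : ℕ, algebraMap E K
          (Algebra.trace E M ((⟨v, hv⟩ : M) * ((σ.restrictNormal M) ^ i) ⟨x, hx⟩)) =
          v * (σ ^ i) y + σ v * (σ ^ (i + 1)) y + (σ ^ 2) v * (σ ^ (i + 2)) y +
        (σ ^ 3) v * (σ ^ (i + 3)) y := by
        intro i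
        rw [trace_eq_sum_pow M σ hfix, hn]
        have e : (((⟨v, hv⟩ : M) * ((σ.restrictNormal M) ^ i) ⟨x, hx⟩ : M) : K) =
            v * (σ ^ i) x := by
          rw [MulMemClass.coe_mul, coe_restrictNormal_pow]
        have v5 : (σ ^ 5) v = -σ v := by rw [← hadd 1 4, hv4, map_neg, pow_one]
        have v6 : (σ ^ 6) v = -(σ ^ 2) v := by rw [← hadd 2 4, hv4, map_neg]
        have v7 : (σ ^ 7) v = -(σ ^ 3) v := by rw [← hadd 3 4, hv4, map_neg]
        rw [e]
        simp only [Finset.sum_range_succ, Finset.sum_range_zero, map_mul, hv4, v5, v6, v7,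
          hy, map_sub, pow_zero, pow_one, AlgEquiv.one_apply, zero_add]
        rw [show σ ((σ ^ i) x) = (σ ^ (1 + i)) x by rw [← hadd 1 i, pow_one]]
        simp only [hadd]
        rw [show i + 1 + 4 = i + 5 by ring, show i + 2 + 4 = i + 6 by ring,
          show i + 3 + 4 = i + 7 by ring]
        simp only [add_comm i]
        ring
      intro i hi
      rw [hn] at hi
      apply (algebraMap E K).injective
      rw [hT, map_zero]
      by_cases h4 : i < 4
      · exact hk i h4
      · obtain ⟨j, rfl⟩ := Nat.exists_eq_add_of_le (not_lt.mp h4)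
        have hj : ∀ k, (σ ^ (4 + k)) y = -(σ ^ k) y := fun k => by
          rw [add_comm, ← hadd k 4, hy4, map_neg]
        simp only [add_assoc 4 j, hj]
        linear_combination -hk j (by omega)
    exact congrArg Subtype.val (hspan ⟨v, hv⟩ htr)
  have hLI : ∀ c : ℕ → E, ∑ i ∈ Finset.range 8, algebraMap E K (c i) * (σ ^ i) x = 0 →
      ∀ i < 8, c i = 0 := by
    intro c hc i hi
    rw [← hn, Finset.sum_range] at hc
    refine Fintype.linearIndependent_iff.mp hli (fun i => c i) ?_ ⟨i, by rw [hn]; exact hi⟩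
    simpa only [Algebra.smul_def] using hc
  have p4 : (σ ^ 4) y = -y := hy4
  have p5 : (σ ^ 5) y = -y1 := by rw [← hadd 1 4, hy4, map_neg, pow_one]
  have p6 : (σ ^ 6) y = -y2 := by rw [← hadd 2 4, hy4, map_neg]
  -- The conjugate `U - A (S - S³)` of the Gram operator is applied to `y`: the pairings of the
  -- result with the `σ^k y` are `U² - 2A²` for `k = 0` and zero otherwise, so under `h0` it
  -- vanishes.
  have hv0 := key (U * y - A * (y1 - y3))
    (sub_mem (mul_mem hUM hyM) (mul_mem hAM (sub_mem y1M y3M))) (by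
      have q1 : ∀ z, (σ ^ 4) z = σ (σ (σ (σ z))) := fun z => by
        simp only [pow_succ, pow_zero, one_mul, AlgEquiv.mul_apply]
      simp only [q1, map_sub, map_mul, hσU, hσA, ← hy1, s1, s2, s3, map_neg]
      ring) (by
      have q2 : ∀ z, (σ ^ 2) z = σ (σ z) := fun z => by
        simp only [pow_succ, pow_zero, one_mul, AlgEquiv.mul_apply]
      have q3 : ∀ z, (σ ^ 3) z = σ (σ (σ z)) := fun z => by
        simp only [pow_succ, pow_zero, one_mul, AlgEquiv.mul_apply]
      have r2 : σ y1 = y2 := s1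
      intro k hk
      interval_cases k <;>
      simp only [zero_add, pow_zero, pow_one, AlgEquiv.one_apply, Nat.reduceAdd, p4, p5, p6,
        ← hy1, ← hy2, ← hy3] <;>
      simp only [q2, q3, map_sub, map_mul, hσU, hσA, ← hy1, s1, s2, s3, map_neg]
      · linear_combination h0 - U * hU + 2 * A * hA
      · linear_combination -U * hA + A * hU
      · ring
      · linear_combination U * hA - A * hU)
  have hx0 : ∀ z, (σ ^ 0) z = z := fun z => rfl
  -- The coefficients are those of `U y - A (σ y - σ³ y)` expanded in the normal basis through `y =
  -- x - σ⁴ x`.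
  have hua := hLI (fun i => match i with
    | 0 => u
    | 1 => -a
    | 3 => a
    | 4 => -u
    | 5 => a
    | 7 => -a
    | _ => 0) (by
      simp only [Finset.sum_range_succ, Finset.sum_range_zero, map_neg, map_zero, hu, ha]
      refine Eq.trans ?_ hv0
      have e1 : y1 = σ x - (σ ^ 5) x := by rw [hy1, hy, map_sub, ← hadd 1 4, pow_one]
      have e3 : y3 = (σ ^ 3) x - (σ ^ 7) x := by rw [hy3, hy, map_sub, hadd 3 4]
      rw [e1, e3, hy, hx0, pow_one]
      ring)
  have hu0 : u = 0 := hua 0 (by norm_num)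
  have ha0 : a = 0 := neg_eq_zero.mp (hua 1 (by norm_num))
  rw [hu0, map_zero] at hu
  rw [ha0, map_zero] at ha
  -- With `U = A = 0` every pairing of `y` with the `σ^k y` is zero, so `y = 0`, against the
  -- independence of `x` and `σ⁴ x`.
  have hy0 := key y hyM hy4 (by
    intro k hk
    interval_cases k <;>
      simp only [zero_add, pow_zero, pow_one, AlgEquiv.one_apply, Nat.reduceAdd, p4, p5, p6,
        ← hy1, ← hy2, ← hy3]
    · linear_combination -hu - hU
    · linear_combination -ha - hA
    · ring
    · linear_combination ha + hA)
  have h10 := hLI (fun i => match i with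
    | 0 => 1
    | 4 => -1
    | _ => 0) (by
      simp only [Finset.sum_range_succ, Finset.sum_range_zero, map_neg, map_zero, map_one]
      refine Eq.trans ?_ hy0
      rw [hy, hx0]
      ring) 0 (by norm_num)
  exact one_ne_zero h10

end CyclicOctic

/-! ### Trace forms of the quadratic and quartic layers. -/

section OcticTower
variable {E K : Type v} [Field E] [NeZero (2 : E)] [Field K] [Algebra E K]

/-- The trace forms of the quadratic and the quartic layer of a cyclic octic extension. -/
theorem traceFormSpace_octic_tower (M₁ M₂ M₃ : IntermediateField E K)
    [FiniteDimensional E M₁] [IsGalois E M₁] [FiniteDimensional E M₂] [IsGalois E M₂]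
    [FiniteDimensional E M₃] [IsGalois E M₃] (σ : Gal(K/E))
    (hfix : ∀ x ∈ M₃, σ x = x → x ∈ (⊥ : IntermediateField E K))
    (hn1 : Module.finrank E M₁ = 2) (hn2 : Module.finrank E M₂ = 4)
    (hn3 : Module.finrank E M₃ = 8)
    (hM1 : ∀ x, x ∈ M₁ ↔ x ∈ M₃ ∧ (σ ^ 2) x = x) (hM2 : ∀ x, x ∈ M₂ ↔ x ∈ M₃ ∧ (σ ^ 4) x = x) :
    Algebra.GrothendieckAddGroup.of (traceFormSpace E M₂).cls =
        Algebra.GrothendieckAddGroup.of (traceFormSpace E M₁).cls + 2 • gwLine (1 : E) ∧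
      2 • Algebra.GrothendieckAddGroup.of (traceFormSpace E M₁).cls = 4 • gwLine (1 : E) ∧
      Algebra.GrothendieckAddGroup.of (traceFormSpace E M₁).cls ≠ 2 • gwLine (1 : E) := by
  have t2 : (2 : E) ≠ 0 := NeZero.ne _
  have k2 : (2 : K) ≠ 0 := by
    rw [← map_ofNat (algebraMap E K)]
    exact (map_ne_zero _).mpr t2
  have a2 : algebraMap E K 2 = 2 := map_ofNat _ 2
  have a4 : algebraMap E K 4 = 4 := map_ofNat _ 4
  have hinj := (algebraMap E K).injective
  have hfix1 : ∀ x ∈ M₁, σ x = x → x ∈ (⊥ : IntermediateField E K) :=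
    fun x hx => hfix x ((hM1 x).mp hx).1
  have hfix2 : ∀ x ∈ M₂, σ x = x → x ∈ (⊥ : IntermediateField E K) :=
    fun x hx => hfix x ((hM2 x).mp hx).1
  have q2 : ∀ z, (σ ^ 2) z = σ (σ z) := fun z => by
    simp only [pow_succ, pow_zero, one_mul, AlgEquiv.mul_apply]
  have q3 : ∀ z, (σ ^ 3) z = σ (σ (σ z)) := fun z => by
    simp only [pow_succ, pow_zero, one_mul, AlgEquiv.mul_apply]
  have q4 : ∀ z, (σ ^ 4) z = σ (σ (σ (σ z))) := fun z => by
    simp only [pow_succ, pow_zero, one_mul, AlgEquiv.mul_apply]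
  have htr1 : ∀ x : M₁, algebraMap E K (Algebra.trace E M₁ x) = x + σ x := fun x => by
    rw [trace_eq_sum_pow M₁ σ hfix1, hn1]
    simp [Finset.sum_range_succ]
  have htr2 : ∀ x : M₂, algebraMap E K (Algebra.trace E M₂ x) =
      x + σ x + σ (σ x) + σ (σ (σ x)) := fun x => by
    rw [trace_eq_sum_pow M₂ σ hfix2, hn2]
    simp [Finset.sum_range_succ]
  have hσM : ∀ x ∈ M₃, σ x ∈ M₃ := apply_mem_of_normal M₃ σ
  have hE : ∀ x ∈ M₃, σ x = x → ∃ a, algebraMap E K a = x := fun x hx h =>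
    IntermediateField.mem_bot.mp (hfix x hx h)
  have hEσ : ∀ a : E, σ (algebraMap E K a) = algebraMap E K a := fun a => σ.commutes a
  -- a generator of the quadratic layer
  obtain ⟨g, hgM, hg0, hσg⟩ : ∃ g ∈ M₃, g ≠ 0 ∧ σ g = -g := by
    obtain ⟨x, hx, hx'⟩ : ∃ x ∈ M₁, x ∉ (⊥ : IntermediateField E K) := by
      by_contra! hcon
      have h1 : M₁ = ⊥ := le_bot_iff.mp hcon
      have h2 := IntermediateField.finrank_eq_one_iff.mpr h1
      omega
    obtain ⟨hx3, hxx⟩ := (hM1 x).mp hx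
    rw [q2] at hxx
    refine ⟨x - σ x, sub_mem hx3 (hσM x hx3), fun h => hx' (hfix1 x hx (sub_eq_zero.mp h).symm), ?_⟩
    rw [map_sub, hxx, neg_sub]
  -- The quadratic layer is generated by `g = √d`.
  obtain ⟨d, hd⟩ := hE (g ^ 2) (pow_mem hgM 2) (by rw [map_pow, hσg, neg_sq])
  have hd0 : d ≠ 0 := by
    rintro rfl
    rw [map_zero] at hd
    exact pow_ne_zero 2 hg0 hd.symm
  -- odd elements are multiples of `g`
  have hodd : ∀ x ∈ M₃, σ x = -x → ∃ a, algebraMap E K a * g = x := by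
    intro x hx hσx
    obtain ⟨a, ha⟩ := hE (x / g) (div_mem hx hgM) (by rw [map_div₀, hσx, hσg, neg_div_neg_eq])
    exact ⟨a, by rw [ha, div_mul_cancel₀ _ hg0]⟩
  obtain ⟨y, hyM, hy4, hne⟩ := exists_octic_generator M₃ σ hfix hn3
  rw [q4] at hy4
  rw [q2, q3] at hne
  set y1 := σ y with hy1
  set y2 := σ y1 with hy2
  set y3 := σ y2 with hy3
  have y1M : y1 ∈ M₃ := hσM _ hyM
  have y2M : y2 ∈ M₃ := hσM _ y1M
  have y3M : y3 ∈ M₃ := hσM _ y2M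
  -- Formally, let `ζ` be a primitive eighth root of unity and let `ρ_j = ∑ ζ^{ij} σ^i y` for odd
  -- `j`. Then `w = ρ₁ρ₃ρ₅ρ₇`, and pairing the factors in the three possible ways writes it as a
  -- norm from `ℚ(i)`, `ℚ(√2)` and `ℚ(√-2)`: `ρ₁ρ₅ = z - i z1`, `ρ₁ρ₇ = U + √2 A`, and `ρ₁ρ₃` gives
  -- `w = S² + 2T²`. All three are polynomial identities in `y, σ y, σ² y, σ³ y`, so no root of
  -- unity is required.
  set z : K := y ^ 2 - y2 ^ 2 + 2 * y1 * y3 with hz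
  set z1 : K := y1 ^ 2 - y3 ^ 2 - 2 * y * y2 with hz1
  have two_mem : (2 : K) ∈ M₃ := ofNat_mem M₃ 2
  have hzM : z ∈ M₃ := add_mem (sub_mem (pow_mem hyM 2) (pow_mem y2M 2))
    (mul_mem (mul_mem two_mem y1M) y3M)
  have hz1M : z1 ∈ M₃ := sub_mem (sub_mem (pow_mem y1M 2) (pow_mem y3M 2))
    (mul_mem (mul_mem two_mem hyM) y2M)
  have hσz : σ z = z1 := by
    simp only [hz, hz1, map_add, map_sub, map_mul, map_pow, map_ofNat, hy4, ← hy1, ← hy2, ← hy3]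
    ring
  have hσz1 : σ z1 = -z := by
    simp only [hz, hz1, map_sub, map_mul, map_pow, map_ofNat, hy4, ← hy1, ← hy2, ← hy3]
    ring
  obtain ⟨w, hw⟩ := hE (z ^ 2 + z1 ^ 2) (add_mem (pow_mem hzM 2) (pow_mem hz1M 2)) (by
    rw [map_add, map_pow, map_pow, hσz, hσz1]
    ring)
  obtain ⟨U, hU⟩ := hE (y ^ 2 + y1 ^ 2 + y2 ^ 2 + y3 ^ 2)
    (add_mem (add_mem (add_mem (pow_mem hyM 2) (pow_mem y1M 2)) (pow_mem y2M 2))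
      (pow_mem y3M 2)) (by
    simp only [map_add, map_pow, hy4, ← hy1, ← hy2, ← hy3]
    ring)
  obtain ⟨A, hA⟩ := hE (y * y1 + y1 * y2 + y2 * y3 - y3 * y)
    (sub_mem (add_mem (add_mem (mul_mem hyM y1M) (mul_mem y1M y2M)) (mul_mem y2M y3M))
      (mul_mem y3M hyM)) (by
    simp only [map_add, map_sub, map_mul, hy4, ← hy1, ← hy2, ← hy3]
    ring)
  -- The components `S` and `T` of `ρ₁ρ₃` change sign under `σ`, hence are multiples of `g`; this is
  -- what brings the factor `d` into `e2`.
  obtain ⟨s, hs⟩ := hodd (y ^ 2 - y1 ^ 2 + y2 ^ 2 - y3 ^ 2)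
    (sub_mem (add_mem (sub_mem (pow_mem hyM 2) (pow_mem y1M 2)) (pow_mem y2M 2))
      (pow_mem y3M 2)) (by
    simp only [map_add, map_sub, map_pow, hy4, ← hy1, ← hy2, ← hy3]
    ring)
  obtain ⟨t, ht⟩ := hodd (y * y1 - y1 * y2 + y2 * y3 + y3 * y)
    (add_mem (add_mem (sub_mem (mul_mem hyM y1M) (mul_mem y1M y2M)) (mul_mem y2M y3M))
      (mul_mem y3M hyM)) (by
    simp only [map_add, map_sub, map_mul, hy4, ← hy1, ← hy2, ← hy3]
    ring)
  obtain ⟨t', ht'⟩ := hodd (z ^ 2 - z1 ^ 2) (sub_mem (pow_mem hzM 2) (pow_mem hz1M 2)) (by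
    rw [map_sub, map_pow, map_pow, hσz, hσz1]
    ring)
  obtain ⟨s', hs'⟩ := hodd (2 * z * z1) (mul_mem (mul_mem two_mem hzM) hz1M) (by
    rw [map_mul, map_mul, map_ofNat, hσz, hσz1]
    ring)
  have e1 : w = U ^ 2 - 2 * A ^ 2 := hinj (by
    simp only [map_sub, map_mul, map_pow, map_ofNat]
    rw [hw, hU, hA]
    ring)
  have e2 : w = d * (s ^ 2 + 2 * t ^ 2) := hinj (by
    simp only [map_add, map_mul, map_pow, map_ofNat]
    have : algebraMap E K d * (algebraMap E K s ^ 2 + 2 * algebraMap E K t ^ 2) =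
        (algebraMap E K s * g) ^ 2 + 2 * (algebraMap E K t * g) ^ 2 := by rw [hd]; ring
    rw [this, hs, ht, hw]
    ring)
  -- This is `(z² + z1²)² = (z² - z1²)² + (2 z z1)²`, where both terms on the right are squares of
  -- odd elements.
  have e3 : w ^ 2 = d * (t' ^ 2 + s' ^ 2) := hinj (by
    simp only [map_add, map_mul, map_pow]
    have : algebraMap E K d * (algebraMap E K t' ^ 2 + algebraMap E K s' ^ 2) =
        (algebraMap E K t' * g) ^ 2 + (algebraMap E K s' * g) ^ 2 := by rw [hd]; ring
    rw [this, ht', hs', hw]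
    ring)
  have hw0 : w ≠ 0 := by
    rintro rfl
    rw [← hU, ← hA] at hne
    refine hne ?_
    rw [← map_pow, ← map_pow, ← map_ofNat (algebraMap E K) 2, ← map_mul, ← map_sub, ← e1, map_zero]
  have hg1 : g ∈ M₁ := (hM1 g).mpr ⟨hgM, by rw [q2, hσg, map_neg, hσg, neg_neg]⟩
  have hg2 : g ∈ M₂ := (hM2 g).mpr ⟨hgM, by simp only [q4, hσg, map_neg, neg_neg]⟩
  have hz2 : z ∈ M₂ := (hM2 z).mpr ⟨hzM, by simp only [q4, hσz, hσz1, map_neg, neg_neg]⟩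
  have hz12 : z1 ∈ M₂ := (hM2 z1).mpr ⟨hz1M, by simp only [q4, hσz, hσz1, map_neg, neg_neg]⟩
  have c1 : (traceFormSpace E M₁).cls = line 2 + line (2 * d) := by
    have := traceFormSpace_cls_eq_sum (E := E) ![(1 : M₁), ⟨g, hg1⟩] ![2, 2 * d] hn1
      (by intro i; fin_cases i <;> simp [t2, hd0])
      (by
        intro i
        refine hinj ?_
        rw [htr1]
        fin_cases i
        · simp [a2]
          norm_num
        · simp [a2, hσg, hd]
          ring)
      (by
        intro i j hij
        refine hinj ?_
        rw [htr1]
        fin_cases i <;> fin_cases j <;> first | exact absurd rfl hij | simp [hσg])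
    simpa [Fin.sum_univ_two] using this
  -- The orthogonal basis is `1, g, z, σ z`. Since `σ² z = -z`, the last two have trace form value
  -- `2 (z² + z1²) = 2w`.
  have c2 : (traceFormSpace E M₂).cls = line 4 + line (4 * d) + line (2 * w) + line (2 * w) := by
    have t4 : (4 : E) ≠ 0 := by
      have : (4 : E) = 2 * 2 := by norm_num
      rw [this]
      exact mul_ne_zero t2 t2
    have := traceFormSpace_cls_eq_sum (E := E) ![(1 : M₂), ⟨g, hg2⟩, ⟨z, hz2⟩, ⟨z1, hz12⟩]
      ![4, 4 * d, 2 * w, 2 * w] hn2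
      (by intro i; fin_cases i <;> simp [t2, t4, hd0, hw0])
      (by
        intro i
        refine hinj ?_
        rw [htr2]
        fin_cases i
        · simp [a4]
          norm_num
        · simp [a4, hσg, hd]
          ring
        · simp [a2, hσz, hσz1, hw]
          ring
        · simp [a2, hσz, hσz1, hw]
          ring)
      (by
        intro i j hij
        refine hinj ?_
        rw [htr2]
        fin_cases i <;> fin_cases j <;> try exact absurd rfl hij
        all_goals simp [hσg, hσz, hσz1] <;> ring)
    simpa [Fin.sum_univ_four] using this
  rw [c1, c2]
  simp only [map_add]
  obtain ⟨r1, r2⟩ := gwLine_quartic_relation hd0 hw0 e1 e2 e3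
  refine ⟨r1, r2, fun hcon => ?_⟩
  rw [two_nsmul] at hcon
  -- Equality with `2⟨1⟩` would make the discriminant `4d = (2g)²` a square in `E`, so `2g` would be
  -- fixed by `σ`, although `σ g = -g`.
  obtain ⟨c, hc⟩ := isSquare_of_gwLine_add_eq t2 (mul_ne_zero t2 hd0) one_ne_zero one_ne_zero hcon
  have hc' := congrArg (algebraMap E K) hc
  simp only [map_mul, map_pow, map_ofNat, map_one, hd] at hc'
  have h3 : (2 * g - algebraMap E K c) * (2 * g + algebraMap E K c) = 0 := by
    linear_combination hc'
  have h4 : σ (2 * g) = 2 * g := by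
    rcases mul_eq_zero.mp h3 with h | h
    · rw [sub_eq_zero.mp h, hEσ]
    · rw [eq_neg_of_add_eq_zero_left h, map_neg, hEσ]
  rw [map_mul, map_ofNat, hσg] at h4
  have h5 : 2 * (2 * g) = 0 := by linear_combination -h4
  simp [k2, hg0] at h5

end OcticTower

/-! ### Orthonormal bases in odd abelian extensions. -/

section OddAbelian
variable {E L : Type v} [Field E] [Field L] [Algebra E L] [FiniteDimensional E L]
  [IsAbelianGalois E L]

open scoped IsMulCommutative Matrix

/-- An abelian extension of odd degree has a basis that is orthonormal for the trace form. -/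
theorem exists_orthonormal_of_odd (hodd : Odd (Module.finrank E L)) :
    ∃ y : Gal(L/E) → L, (∀ g, Algebra.trace E L (y g * y g) = 1) ∧
      ∀ g h, g ≠ h → Algebra.trace E L (y g * y h) = 0 := by
  classical
  obtain ⟨m, hm⟩ := hodd
  let b := IsGalois.normalBasis E L
  let x := b 1
  -- The group matrix `X` satisfies `τ(X) = X S_τ` for the regular permutation matrices `S_τ`. An
  -- orthogonal matrix `Z` with `τ(Z) = Z S_τ` is what is sought: its rows are then the conjugates
  -- of elements forming an orthonormal family.
  let X : Matrix Gal(L/E) Gal(L/E) L := Matrix.of fun g h => (g⁻¹ * h) x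
  let S : Gal(L/E) → Matrix Gal(L/E) Gal(L/E) L := fun τ =>
    Matrix.of fun g h => if g = h * τ then 1 else 0
  have hAS : ∀ (A : Matrix Gal(L/E) Gal(L/E) L) τ g h, (A * S τ) g h = A g (h * τ) := by
    intro A τ g h
    simp [Matrix.mul_apply, S]
  have hSA : ∀ (A : Matrix Gal(L/E) Gal(L/E) L) τ g h, (S τ * A) g h = A (g * τ⁻¹) h := by
    intro A τ g h
    rw [Matrix.mul_apply, Finset.sum_eq_single (g * τ⁻¹)]
    · simp [S]
    · intro k _ hk
      have : g ≠ k * τ := fun h => hk (by rw [h, mul_inv_cancel_right])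
      simp [S, this]
    · simp
  have hSS : ∀ τ ρ, S τ * S ρ = S (τ * ρ) := by
    intro τ ρ
    ext g h
    rw [hAS]
    simp only [S, Matrix.of_apply]
    rw [mul_assoc, mul_comm ρ τ]
  have hS1 : S 1 = 1 := by
    ext g h
    simp [S, Matrix.one_apply]
  have hSpow : ∀ τ (k : ℕ), S τ ^ k = S (τ ^ k) := by
    intro τ k
    induction k with
    | zero => rw [pow_zero, pow_zero, hS1]
    | succ k ih => rw [pow_succ, pow_succ, ih, hSS]
  have hcard : ∀ τ : Gal(L/E), τ ^ (2 * (m + 1)) = τ := by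
    intro τ
    have h1 : τ ^ Module.finrank E L = 1 := by
      rw [← IsGalois.card_aut_eq_finrank, pow_card_eq_one']
    rw [show 2 * (m + 1) = Module.finrank E L + 1 by omega, pow_succ, h1, one_mul]
  -- the Gram matrix of the normal basis
  have hXX : X * Xᵀ = (Algebra.traceMatrix E (fun g : Gal(L/E) => b g⁻¹)).map (algebraMap E L) := by
    ext g h
    rw [Matrix.map_apply, Algebra.traceMatrix_apply, Algebra.traceForm_apply,
      trace_eq_sum_automorphisms, Matrix.mul_apply]
    refine Finset.sum_congr rfl fun k _ => ?_
    rw [IsGalois.normalBasis_apply g⁻¹, IsGalois.normalBasis_apply h⁻¹, map_mul]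
    simp only [X, Matrix.transpose_apply, Matrix.of_apply, ← AlgEquiv.mul_apply]
    rw [mul_comm g⁻¹, mul_comm h⁻¹]
  -- The two sums correspond under `k ↦ g h / k`, by commutativity of the Galois group.
  have hcomm : X * Xᵀ = Xᵀ * X := by
    ext g h
    rw [Matrix.mul_apply, Matrix.mul_apply,
      ← (Equiv.divLeft (g * h)).sum_comp]
    refine Finset.sum_congr rfl fun k _ => ?_
    simp only [X, Matrix.transpose_apply, Matrix.of_apply, Equiv.divLeft_apply]
    have e1 : g⁻¹ * (g * h / k) = k⁻¹ * h := by
      rw [div_eq_mul_inv]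
      group
      rw [mul_comm]
    have e2 : h⁻¹ * (g * h / k) = k⁻¹ * g := by
      rw [div_eq_mul_inv, mul_comm g h]
      group
      rw [mul_comm]
    rw [e1, e2, mul_comm]
  have hdet : IsUnit X.det := by
    have h1 : (X * Xᵀ).det ≠ 0 := by
      rw [hXX, ← RingHom.mapMatrix_apply, ← RingHom.map_det, map_ne_zero]
      have := Algebra.discr_not_zero_of_basis E (b.reindex (Equiv.inv _))
      rwa [Module.Basis.coe_reindex] at this
    rw [Matrix.det_mul] at h1
    exact (left_ne_zero_of_mul h1).isUnit
  have hdetT : IsUnit Xᵀ.det := by rwa [Matrix.det_transpose]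
  have hSX : ∀ τ, S τ * X = X * S τ := by
    intro τ
    ext g h
    rw [hAS, hSA]
    simp only [X, Matrix.of_apply]
    congr 1
    rw [mul_inv_rev, inv_inv, mul_comm τ, mul_assoc, mul_comm τ]
  have hSXT : ∀ τ, S τ * Xᵀ = Xᵀ * S τ := by
    intro τ
    ext g h
    rw [hAS, hSA]
    simp only [X, Matrix.transpose_apply, Matrix.of_apply]
    congr 1
    rw [mul_inv_rev, mul_comm g, mul_assoc, ← mul_assoc, mul_comm h⁻¹]
    rw [mul_assoc]
  have hΦX : ∀ τ : Gal(L/E), (τ : L →+* L).mapMatrix X = X * S τ := by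
    intro τ
    ext g h
    rw [hAS]
    simp only [X, RingHom.mapMatrix_apply, Matrix.map_apply, Matrix.of_apply]
    change (τ * (g⁻¹ * h)) x = _
    rw [mul_comm τ, mul_assoc]
  have hΦXT : ∀ τ : Gal(L/E), (τ : L →+* L).mapMatrix Xᵀ * S τ = Xᵀ := by
    intro τ
    ext g h
    rw [hAS]
    simp only [X, RingHom.mapMatrix_apply, Matrix.map_apply, Matrix.of_apply,
      Matrix.transpose_apply]
    change (τ * ((h * τ)⁻¹ * g)) x = _
    rw [mul_inv_rev, mul_assoc, mul_inv_cancel_left]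
  set V := (Xᵀ)⁻¹ with hV
  have hVX : V * Xᵀ = 1 := Matrix.nonsing_inv_mul _ hdetT
  have hXV : Xᵀ * V = 1 := Matrix.mul_nonsing_inv _ hdetT
  have hSV : ∀ τ, S τ * V = V * S τ := by
    intro τ
    calc S τ * V = V * Xᵀ * S τ * V := by rw [hVX, one_mul]
      _ = V * (S τ * Xᵀ) * V := by rw [hSXT, mul_assoc V]
      _ = V * S τ := by rw [mul_assoc, mul_assoc, hXV, mul_one]
  have hΦV : ∀ τ : Gal(L/E), (τ : L →+* L).mapMatrix V = V * S τ := by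
    intro τ
    have h1 : (τ : L →+* L).mapMatrix V * (τ : L →+* L).mapMatrix Xᵀ = 1 := by
      rw [← map_mul, hVX, map_one]
    calc (τ : L →+* L).mapMatrix V
        = (τ : L →+* L).mapMatrix V * ((τ : L →+* L).mapMatrix Xᵀ * S τ * V) := by
          rw [hΦXT, hXV, mul_one]
      _ = V * S τ := by rw [← mul_assoc, ← mul_assoc, h1, one_mul, hSV]
  have hXVc : X * V = V * X := by
    calc X * V = V * (Xᵀ * X) * V := by rw [← mul_assoc, hVX, one_mul]
      _ = V * X := by rw [← hcomm, mul_assoc, mul_assoc, hXV, mul_one]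
  -- `Y = X (Xᵀ)⁻¹` is orthogonal because `X` and `Xᵀ` commute, but it transforms by `S_τ²` rather
  -- than by `S_τ`.
  let Y := X * V
  have hYY : Y * Yᵀ = 1 := by
    have hVT : Vᵀ = X⁻¹ := by rw [hV, Matrix.transpose_nonsing_inv, Matrix.transpose_transpose]
    change X * V * (X * V)ᵀ = 1
    rw [Matrix.transpose_mul, hVT, hXVc, mul_assoc, ← mul_assoc X, Matrix.mul_nonsing_inv _ hdet,
      one_mul, hVX]
  have hSY : ∀ τ, Commute Y (S τ) := by
    intro τ
    change X * V * S τ = S τ * (X * V)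
    rw [mul_assoc, ← hSV, ← mul_assoc, ← mul_assoc, hSX]
  have hΦY : ∀ τ : Gal(L/E), (τ : L →+* L).mapMatrix Y = Y * S τ ^ 2 := by
    intro τ
    change (τ : L →+* L).mapMatrix (X * V) = X * V * S τ ^ 2
    rw [map_mul, hΦX, hΦV, mul_assoc, ← mul_assoc (S τ), hSV, pow_two, mul_assoc, mul_assoc]
  -- In a group of order `2m + 1` one has `τ^{2(m+1)} = τ`, so this power of `Y` is the desired
  -- square root: it transforms by `S_τ` itself.
  let Z := Y ^ (m + 1)
  have hZZ : Z * Zᵀ = 1 := by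
    change Y ^ (m + 1) * (Y ^ (m + 1))ᵀ = 1
    rw [Matrix.transpose_pow]
    exact pow_mul_pow_eq_one _ hYY
  have hΦZ : ∀ τ : Gal(L/E), (τ : L →+* L).mapMatrix Z = Z * S τ := by
    intro τ
    change (τ : L →+* L).mapMatrix (Y ^ (m + 1)) = Y ^ (m + 1) * S τ
    rw [map_pow, hΦY, ((hSY τ).pow_right 2).mul_pow, ← pow_mul, hSpow, hcard]
  have hZ : ∀ g h, Z g h = h (Z g 1) := by
    intro g h
    have := congrFun (congrFun (hΦZ h) g) 1
    rw [hAS, one_mul] at this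
    exact this.symm
  have hT : ∀ g h, algebraMap E L (Algebra.trace E L (Z g 1 * Z h 1)) = (1 : Matrix _ _ L) g h := by
    intro g h
    rw [trace_eq_sum_automorphisms, ← hZZ, Matrix.mul_apply]
    simp only [Matrix.transpose_apply, map_mul, ← hZ]
  refine ⟨fun g => Z g 1, fun g => (algebraMap E L).injective ?_,
    fun g h hgh => (algebraMap E L).injective ?_⟩
  · rw [hT, Matrix.one_apply_eq, map_one]
  · rw [hT, Matrix.one_apply_ne hgh, map_zero]

variable [NeZero (2 : E)]

/-- The trace form of an abelian extension of odd degree `n` is `n⟨1⟩`. -/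
theorem traceFormSpace_cls_of_odd (hodd : Odd (Module.finrank E L)) :
    (traceFormSpace E L).cls = Module.finrank E L • line (1 : E) := by
  obtain ⟨y, hy⟩ := exists_orthonormal_of_odd hodd
  let e : Fin (Module.finrank E L) ≃ Gal(L/E) := (Fintype.equivFinOfCardEq (by
    rw [← Nat.card_eq_fintype_card, IsGalois.card_aut_eq_finrank])).symm
  rw [traceFormSpace_cls_eq_sum (fun i => y (e i)) (fun _ => 1) rfl (fun _ => one_ne_zero)
    (fun i => hy.1 _)
    (fun i j hij => hy.2 _ _ (e.injective.ne hij))]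
  simp

end OddAbelian

/-! ### Signs of monomial permutations. -/

section PermSign

/-- The sign of a permutation of a finite type. -/
noncomputable def permSign {α : Type*} [Finite α] : Equiv.Perm α →* ℤˣ :=
  letI := Fintype.ofFinite α
  letI := Classical.decEq α
  Equiv.Perm.sign

theorem permSign_eq_sign {α : Type*} [Fintype α] [DecidableEq α] (f : Equiv.Perm α) :
    permSign f = Equiv.Perm.sign f := by
  rw [permSign]
  congr!

theorem permSign_eq_of_equiv {α β : Type*} [Finite α] [Finite β] (f : Equiv.Perm α)
    (g : Equiv.Perm β) (e : α ≃ β) (h : ∀ x, e (f x) = g (e x)) : permSign f = permSign g := by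
  classical
  have := Fintype.ofFinite α
  have := Fintype.ofFinite β
  rw [permSign_eq_sign, permSign_eq_sign]
  exact Equiv.Perm.sign_eq_sign_of_equiv f g e h

/-- A sign character of a symmetric group is trivial on even permutations. -/
theorem hom_eq_one_of_permSign {α : Type*} [Finite α] (D : Equiv.Perm α →* ℤˣ)
    {f : Equiv.Perm α} (hf : permSign f = 1) : D f = 1 := by
  classical
  have := Fintype.ofFinite α
  -- A surjective character to `ℤˣ` is the sign; a non-surjective one is trivial.
  by_cases hD : Function.Surjective D
  · rw [Equiv.Perm.eq_sign_of_surjective_hom hD, ← permSign_eq_sign, hf]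
  · by_contra hne
    refine hD fun u => ?_
    rcases Int.units_eq_one_or u with rfl | rfl
    · exact ⟨1, map_one D⟩
    · exact ⟨f, (Int.units_eq_one_or _).resolve_left hne⟩

/-- A tuple is a product of tuples supported at one coordinate, and on each coordinate the character
is trivial on even permutations. No formula for the sign on a function space is needed. -/
theorem hom_pi_eq_one_of_permSign {Q α : Type*} [Finite Q] [Finite α]
    (D : (Q → Equiv.Perm α) →* ℤˣ) {f : Q → Equiv.Perm α} (hf : ∀ q, permSign (f q) = 1) :
    D f = 1 := by
  classical
  have := Fintype.ofFinite Q
  rw [← Finset.noncommProd_mulSingle f]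
  refine Finset.noncommProd_induction _ _ _ (fun x => D x = 1) (fun a b ha hb => ?_) (map_one D)
    fun q _ => ?_
  · rw [map_mul, ha, hb, one_mul]
  · exact hom_eq_one_of_permSign (D.comp (MonoidHom.mulSingle (fun _ => Equiv.Perm α) q)) (hf q)

/-- Two monomial permutations of function spaces have the same sign if the underlying permutations
agree and the coefficients have the same signs. -/
theorem permSign_arrow_congr {Q X Y M N : Type*} [Finite Q] [Finite X] [Finite Y] [Finite M]
    [Finite N] (ρ : Equiv.Perm Q) (a : Q → Equiv.Perm X) (b : Q → Equiv.Perm Y) (e : X ≃ Y)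
    (hab : ∀ q, permSign (a q) = permSign (b q)) (P : Equiv.Perm M) (P' : Equiv.Perm N)
    (E : M ≃ (Q → X)) (E' : N ≃ (Q → Y)) (hP : ∀ m q, E (P m) q = a q (E m (ρ q)))
    (hP' : ∀ m q, E' (P' m) q = b q (E' m (ρ q))) : permSign P = permSign P' := by
  let hom : (Q → Equiv.Perm X) →* Equiv.Perm (Q → X) :=
    { toFun := Equiv.piCongrRight
      map_one' := rfl
      map_mul' := fun _ _ => rfl }
  let R : Equiv.Perm (Q → X) := Equiv.arrowCongr ρ.symm (Equiv.refl X)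
  have h1 : permSign P = permSign (hom a * R) :=
    permSign_eq_of_equiv _ _ E fun m => funext fun q => hP m q
  let b' : Q → Equiv.Perm X := fun q => e.trans ((b q).trans e.symm)
  have hb' : ∀ q, permSign (b' q) = permSign (b q) := fun q =>
    permSign_eq_of_equiv _ _ e fun x => e.apply_symm_apply _
  have h2 : permSign P' = permSign (hom b' * R) := by
    refine permSign_eq_of_equiv _ _ (E'.trans (Equiv.arrowCongr (Equiv.refl Q) e.symm))
      fun m => funext fun q => ?_
    change e.symm (E' (P' m) q) = e.symm (b q (e (e.symm (E' m (ρ q)))))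
    rw [hP', e.apply_symm_apply]
  -- The reindexing `R` is common to both sides. The coefficient parts differ by a tuple of even
  -- permutations, on which any sign character of the product group is trivial.
  have h3 : permSign (hom a) = permSign (hom b') := by
    have := hom_pi_eq_one_of_permSign (permSign.comp hom) (f := a * b'⁻¹) (fun q => by
      rw [Pi.mul_apply, Pi.inv_apply, map_mul, map_inv, hb', hab, mul_inv_cancel])
    rwa [map_mul, map_inv, mul_inv_eq_one] at this
  rw [h1, h2, map_mul, map_mul, h3]

/-- The analogue of `permSign_arrow_congr` for monomial permutations of products. -/
theorem permSign_prod_congr {Q X Y M N : Type*} [Finite Q] [Finite X] [Finite Y] [Finite M]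
    [Finite N] (ρ : Equiv.Perm Q) (a : Q → Equiv.Perm X) (b : Q → Equiv.Perm Y) (e : X ≃ Y)
    (hab : ∀ q, permSign (a q) = permSign (b q)) (P : Equiv.Perm M) (P' : Equiv.Perm N)
    (E : M ≃ Q × X) (E' : N ≃ Q × Y) (hP : ∀ m, E (P m) = (ρ (E m).1, a (E m).1 (E m).2))
    (hP' : ∀ m, E' (P' m) = (ρ (E' m).1, b (E' m).1 (E' m).2)) : permSign P = permSign P' := by
  classical
  have := Fintype.ofFinite Q
  have := Fintype.ofFinite X
  have := Fintype.ofFinite Y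
  let R : Equiv.Perm (Q × X) := Equiv.prodCongr ρ (Equiv.refl X)
  have h1 : permSign P = permSign (R * Equiv.prodCongrRight a) :=
    permSign_eq_of_equiv _ _ E fun m => hP m
  let b' : Q → Equiv.Perm X := fun q => e.trans ((b q).trans e.symm)
  have hb' : ∀ q, permSign (b' q) = permSign (b q) := fun q =>
    permSign_eq_of_equiv _ _ e fun x => e.apply_symm_apply _
  have h2 : permSign P' = permSign (R * Equiv.prodCongrRight b') := by
    refine permSign_eq_of_equiv _ _ (E'.trans (Equiv.prodCongr (Equiv.refl Q) e.symm)) fun m => ?_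
    change ((E' (P' m)).1, e.symm (E' (P' m)).2) =
      (ρ (E' m).1, e.symm (b (E' m).1 (e (e.symm (E' m).2))))
    rw [hP', e.apply_symm_apply]
  rw [h1, h2, map_mul, map_mul, permSign_eq_sign (Equiv.prodCongrRight a),
    permSign_eq_sign (Equiv.prodCongrRight b'), Equiv.Perm.sign_prodCongrRight,
    Equiv.Perm.sign_prodCongrRight]
  congr 1
  refine Finset.prod_congr rfl fun q _ => ?_
  rw [← permSign_eq_sign, ← permSign_eq_sign, hb', hab]

end PermSign

/-! ### Tambara ideals from additive invariants. -/

section InvariantIdeals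
variable {G : Type v} [Group G] [TopologicalSpace G] [IsTopologicalGroup G] [CompactSpace G]

/-- A family of additive invariants of finite `H`-sets whose equality is preserved by products,
restriction, induction, coinduction and conjugation defines a Tambara ideal. -/
noncomputable def TambaraIdeal.ofInvariant {A : OpenSubgroup G → Type*}
    [∀ H, AddCommGroup (A H)] (I : ∀ H : OpenSubgroup G, FinGSetClass H →+ A H)
    (hmul : ∀ {H : OpenSubgroup G} (c a b : FinGSetClass H), I H a = I H b →
      I H (c * a) = I H (c * b))
    (hres : ∀ {L H : OpenSubgroup G} (h : L ≤ H) (a b : FinGSetClass H), I H a = I H b →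
      I L (FinGSetClass.pullback (incl h) (continuous_incl h) a) =
        I L (FinGSetClass.pullback (incl h) (continuous_incl h) b))
    (hind : ∀ {L H : OpenSubgroup G} (h : L ≤ H) (a b : FinGSetClass L), I L a = I L b →
      I H (FinGSetClass.ind h a) = I H (FinGSetClass.ind h b))
    (hcoind : ∀ {L H : OpenSubgroup G} (h : L ≤ H) (a b : FinGSetClass L), I L a = I L b →
      I H (FinGSetClass.coind h a) = I H (FinGSetClass.coind h b))
    (hconj : ∀ (g : G) (H : OpenSubgroup G) (a b : FinGSetClass H), I H a = I H b →
      I (conjSubgroup g H) (FinGSetClass.pullback (conjHom g H) (continuous_conjHom g H) a) =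
        I (conjSubgroup g H) (FinGSetClass.pullback (conjHom g H) (continuous_conjHom g H) b)) :
    TambaraIdeal G :=
  have key : ∀ {H : OpenSubgroup G} (a b : FinGSetClass H),
      GrothendieckRing.of a - GrothendieckRing.of b ∈ (GrothendieckRing.liftAdd (I H)).ker ↔
        I H a = I H b := fun a b => by
    rw [AddMonoidHom.mem_ker, map_sub, GrothendieckRing.liftAdd_of, GrothendieckRing.liftAdd_of,
      sub_eq_zero]
  { level := fun H =>
      { carrier := (GrothendieckRing.liftAdd (I H)).ker
        zero_mem' := zero_mem _
        add_mem' := fun ha hb => add_mem ha hb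
        smul_mem' := fun c x hx => by
          change c * x ∈ (GrothendieckRing.liftAdd (I H)).ker
          replace hx : x ∈ (GrothendieckRing.liftAdd (I H)).ker := hx
          obtain ⟨a, b, rfl⟩ := GrothendieckRing.exists_rep x
          induction c using GrothendieckRing.induction with
          | h c =>
            rw [mul_sub, ← GrothendieckRing.of_mul, ← GrothendieckRing.of_mul, key]
            exact hmul c a b ((key a b).mp hx)
          | hs c d hc hd =>
            rw [sub_mul]
            exact sub_mem hc hd }
    res_mem := fun {L H} h x hx => by
      change _ ∈ (GrothendieckRing.liftAdd (I L)).ker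
      replace hx : x ∈ (GrothendieckRing.liftAdd (I H)).ker := hx
      obtain ⟨a, b, rfl⟩ := GrothendieckRing.exists_rep x
      have h1 : ∀ a : FinGSetClass H, burnsideRes h (GrothendieckRing.of a) =
        GrothendieckRing.of (FinGSetClass.pullback (incl h) (continuous_incl h) a) :=
          fun a => GrothendieckRing.liftAdd_of _ _
      rw [map_sub, h1, h1, key]
      exact hres h a b ((key a b).mp hx)
    tr_mem := fun {L H} h x hx => by
      change _ ∈ (GrothendieckRing.liftAdd (I H)).ker
      replace hx : x ∈ (GrothendieckRing.liftAdd (I L)).ker := hx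
      obtain ⟨a, b, rfl⟩ := GrothendieckRing.exists_rep x
      have h1 : ∀ a : FinGSetClass L, burnsideTr h (GrothendieckRing.of a) =
        GrothendieckRing.of (FinGSetClass.ind h a) := fun a => GrothendieckRing.liftAdd_of _ _
      rw [map_sub, h1, h1, key]
      exact hind h a b ((key a b).mp hx)
    norm_mem := fun {L H} h x hx => by
      change _ ∈ (GrothendieckRing.liftAdd (I H)).ker
      replace hx : x ∈ (GrothendieckRing.liftAdd (I L)).ker := hx
      obtain ⟨a, b, rfl⟩ := GrothendieckRing.exists_rep x
      rw [key] at hx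
      -- Zero is represented as `b - b`, with the same `b` as in `x = a - b`. The two Newton sums
      -- then differ term by term in `a + k b` against `b + k b`, which have equal invariants.
      have h0 : burnsideNorm h (0 : Burnside L) = newton
          (fun a : FinGSetClass L => GrothendieckRing.of (FinGSetClass.coind h a))
          (cosetIndex L H) b b := by
        rw [← burnsideNorm_of_sub_of, sub_self]
      rw [h0, burnsideNorm_of_sub_of, newton, newton, ← Finset.sum_sub_distrib]
      refine sum_mem fun k _ => ?_
      rw [← smul_sub]
      refine zsmul_mem ?_ _
      rw [key]
      refine hcoind h _ _ ?_
      rw [map_add, map_add, hx]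
    conj_mem := fun g H x hx => by
      change _ ∈ (GrothendieckRing.liftAdd (I (conjSubgroup g H))).ker
      replace hx : x ∈ (GrothendieckRing.liftAdd (I H)).ker := hx
      obtain ⟨a, b, rfl⟩ := GrothendieckRing.exists_rep x
      have h1 : ∀ a : FinGSetClass H, burnsideConj g H (GrothendieckRing.of a) =
        GrothendieckRing.of (FinGSetClass.pullback (conjHom g H) (continuous_conjHom g H) a) :=
          fun a => GrothendieckRing.liftAdd_of _ _
      rw [map_sub, h1, h1, key]
      exact hconj g H a b ((key a b).mp hx) }

end InvariantIdeals

/-! ### The Tambara ideal of cardinality and signs. -/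

section SignInvariant

section
variable {H : Type v} [Group H] [TopologicalSpace H]

/-- The cardinality of a finite `H`-set, together with the signs of the permutations by which the
elements of `H` act. -/
noncomputable def signInvariant (H : Type v) [Group H] [TopologicalSpace H] :
    FinGSetClass H →+ ℤ × (H → Additive ℤˣ) where
  toFun := Quotient.lift (fun X : FinGSet H => ((Nat.card X.carrier : ℤ), fun k : H =>
      Additive.ofMul (permSign (MulAction.toPerm k : Equiv.Perm X.carrier)))) (by
    rintro X Y ⟨e, he⟩
    refine Prod.ext (congrArg (Nat.cast : ℕ → ℤ) (Nat.card_congr e)) (funext fun k => congrArg Additive.ofMul ?_)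
    exact permSign_eq_of_equiv _ _ e fun x => he k x)
  map_zero' := by
    refine Prod.ext ?_ (funext fun k => ?_)
    · change ((Nat.card PEmpty : ℕ) : ℤ) = 0
      rw [Nat.card_of_isEmpty, Nat.cast_zero]
    · have : (MulAction.toPerm k : Equiv.Perm (FinGSet.empty H).carrier) = 1 :=
        Equiv.ext fun x => x.elim
      change Additive.ofMul (permSign (MulAction.toPerm k :
        Equiv.Perm (FinGSet.empty H).carrier)) = 0
      rw [this, map_one]
      rfl
  map_add' := by
    rintro ⟨X⟩ ⟨Y⟩
    refine Prod.ext ?_ (funext fun k => ?_)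
    · change ((Nat.card (X.carrier ⊕ Y.carrier) : ℕ) : ℤ) = Nat.card X.carrier + Nat.card Y.carrier
      rw [Nat.card_sum, Nat.cast_add]
    · classical
      have := Fintype.ofFinite X.carrier
      have := Fintype.ofFinite Y.carrier
      change permSign (MulAction.toPerm k : Equiv.Perm (X.sum Y).carrier) =
        permSign (MulAction.toPerm k : Equiv.Perm X.carrier) *
          permSign (MulAction.toPerm k : Equiv.Perm Y.carrier)
      refine (permSign_eq_of_equiv _ (Equiv.sumCongr (MulAction.toPerm k : Equiv.Perm X.carrier)
        (MulAction.toPerm k : Equiv.Perm Y.carrier)) (Equiv.refl (X.carrier ⊕ Y.carrier)) ?_).trans ?_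
      · rintro (x | y) <;> rfl
      · rw [permSign_eq_sign, permSign_eq_sign, permSign_eq_sign]
        exact Equiv.Perm.sign_sumCongr _ _

theorem signInvariant_eq_iff {X Y : FinGSet H} :
    signInvariant H X.cls = signInvariant H Y.cls ↔ Nat.card X.carrier = Nat.card Y.carrier ∧
      ∀ k : H, permSign (MulAction.toPerm k : Equiv.Perm X.carrier) =
        permSign (MulAction.toPerm k : Equiv.Perm Y.carrier) := by
  refine Prod.ext_iff.trans (and_congr Nat.cast_inj ?_)
  exact funext_iff

theorem signInvariant_mul (c a b : FinGSetClass H) (h : signInvariant H a = signInvariant H b) :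
    signInvariant H (c * a) = signInvariant H (c * b) := by
  induction a using Quotient.ind with | _ X
  induction b using Quotient.ind with | _ Y
  induction c using Quotient.ind with | _ Z
  obtain ⟨hc, hs⟩ := signInvariant_eq_iff.mp h
  refine signInvariant_eq_iff (X := Z.prod X) (Y := Z.prod Y).mpr ⟨?_, fun k => ?_⟩
  · exact (Nat.card_prod _ _).trans ((congrArg _ hc).trans (Nat.card_prod _ _).symm)
  · exact permSign_prod_congr (MulAction.toPerm k : Equiv.Perm Z.carrier)
      (fun _ => (MulAction.toPerm k : Equiv.Perm X.carrier))
      (fun _ => (MulAction.toPerm k : Equiv.Perm Y.carrier)) (Finite.card_eq.mp hc).some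
      (fun _ => hs k) _ _ (Equiv.refl _) (Equiv.refl _) (fun _ => rfl) (fun _ => rfl)

theorem signInvariant_pullback {H' : Type v} [Group H'] [TopologicalSpace H'] (f : H' →* H)
    (hf : Continuous f) (a b : FinGSetClass H) (h : signInvariant H a = signInvariant H b) :
    signInvariant H' (FinGSetClass.pullback f hf a) =
      signInvariant H' (FinGSetClass.pullback f hf b) := by
  induction a using Quotient.ind with | _ X
  induction b using Quotient.ind with | _ Y
  obtain ⟨hc, hs⟩ := signInvariant_eq_iff.mp h
  have key : ∀ (Z : FinGSet H) (k : H'),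
      permSign (MulAction.toPerm k : Equiv.Perm (Z.pullback f hf).carrier) =
        permSign (MulAction.toPerm (f k) : Equiv.Perm Z.carrier) :=
    fun Z k => permSign_eq_of_equiv _ _ (Equiv.refl Z.carrier) fun _ => rfl
  exact (signInvariant_eq_iff (X := X.pullback f hf) (Y := Y.pullback f hf)).mpr
    ⟨hc, fun k => (key X k).trans ((hs (f k)).trans (key Y k).symm)⟩

end

variable {G : Type v} [Group G] [TopologicalSpace G] {L H : OpenSubgroup G} (h : L ≤ H)

/-- The coset of an element `g` of `H`, in the labelling for which `rep` is a section. -/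
def cosetOf (L : OpenSubgroup G) {H : OpenSubgroup G} (g : H) :
    H ⧸ (L : Subgroup G).subgroupOf (H : Subgroup G) := ((g⁻¹ : H) : H ⧸ _)

theorem cosetOf_rep (q : H ⧸ (L : Subgroup G).subgroupOf (H : Subgroup G)) :
    cosetOf L (rep q) = q := by
  rw [cosetOf, rep, inv_inv]
  exact Quotient.out_eq' q

theorem cosetOf_incl_mul (l : L) (g : H) : cosetOf L (incl h l * g) = cosetOf L g := by
  refine QuotientGroup.eq.mpr ?_
  rw [Subgroup.mem_subgroupOf]
  simp [coe_incl]

theorem cosetOf_mul (g k : H) : cosetOf L (g * k) = k⁻¹ • cosetOf L g := by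
  rw [cosetOf, mul_inv_rev]
  rfl

theorem exists_eq_incl_mul_rep_cosetOf (g : H) : ∃ l : L, g = incl h l * rep (cosetOf L g) := by
  obtain ⟨l, q, hg⟩ := exists_eq_incl_mul_rep h g
  have : cosetOf L g = q := by rw [hg, cosetOf_incl_mul, cosetOf_rep]
  exact ⟨l, by rw [this]; exact hg⟩

/-- The component in `L` of an element of `H`. -/
noncomputable def lPart (g : H) : L := (exists_eq_incl_mul_rep_cosetOf h g).choose

theorem incl_lPart_mul_rep (g : H) : incl h (lPart h g) * rep (cosetOf L g) = g :=
  (exists_eq_incl_mul_rep_cosetOf h g).choose_spec.symm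

theorem incl_injective : Function.Injective (incl h) := fun _ _ hab =>
  Subtype.ext (congrArg (fun x : H => (x : G)) hab)

theorem lPart_incl_mul (l : L) (g : H) : lPart h (incl h l * g) = l * lPart h g := by
  apply incl_injective h
  have h1 := incl_lPart_mul_rep h (incl h l * g)
  rw [cosetOf_incl_mul] at h1
  rw [map_mul, eq_mul_inv_of_mul_eq h1, mul_assoc, ← eq_mul_inv_of_mul_eq (incl_lPart_mul_rep h g)]

theorem lPart_rep (q : H ⧸ (L : Subgroup G).subgroupOf (H : Subgroup G)) :
    lPart h (rep q) = 1 := by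
  apply incl_injective h
  have h1 := incl_lPart_mul_rep h (rep q)
  rw [cosetOf_rep] at h1
  rw [eq_mul_inv_of_mul_eq h1, mul_inv_cancel, map_one]

/-- An equivariant map is determined by its values on coset representatives. -/
noncomputable def mapLEquiv (X : FinGSet L) :
    MapL h X ≃ ((H ⧸ (L : Subgroup G).subgroupOf (H : Subgroup G)) → X.carrier) where
  toFun φ q := φ.1 (rep q)
  invFun f := ⟨fun g => lPart h g • f (cosetOf L g), fun l g => by
    change lPart h (incl h l * g) • f (cosetOf L (incl h l * g)) = l • lPart h g • f (cosetOf L g)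
    rw [lPart_incl_mul, cosetOf_incl_mul, mul_smul]⟩
  left_inv φ := Subtype.ext (funext fun g => by
    change lPart h g • φ.1 (rep (cosetOf L g)) = φ.1 g
    rw [← φ.2, incl_lPart_mul_rep])
  right_inv f := funext fun q => by
    change lPart h (rep q) • f (cosetOf L (rep q)) = f q
    rw [lPart_rep, cosetOf_rep, one_smul]

/-- Monomial form of the coinduced action: cosets are permuted independently of `X`, and elements of
`L`, also independent of `X`, act as coefficients. -/
theorem mapLEquiv_smul (X : FinGSet L) (k : H) (φ : MapL h X)
    (q : H ⧸ (L : Subgroup G).subgroupOf (H : Subgroup G)) :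
    mapLEquiv h X (k • φ) q = lPart h (rep q * k) • mapLEquiv h X φ (k⁻¹ • q) := by
  change φ.1 (rep q * k) = lPart h (rep q * k) • φ.1 (rep (k⁻¹ • q))
  rw [← φ.2]
  have := incl_lPart_mul_rep h (rep q * k)
  rw [cosetOf_mul, cosetOf_rep] at this
  exact congrArg φ.1 this.symm

variable [IsTopologicalGroup G] [CompactSpace G]

/-- An induced set is a union of translates indexed by the cosets. -/
noncomputable def indEquiv (X : FinGSet L) :
    (X.ind h).carrier ≃ (H ⧸ (L : Subgroup G).subgroupOf (H : Subgroup G)) × X.carrier where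
  toFun := Quotient.lift (fun a => (cosetOf L a.1⁻¹, (lPart h a.1⁻¹)⁻¹ • a.2)) (by
    rintro ⟨g, x⟩ _ ⟨l, rfl⟩
    refine Prod.ext ?_ ?_
    · change _ = cosetOf L (g * (incl h l)⁻¹)⁻¹
      rw [mul_inv_rev, inv_inv, cosetOf_incl_mul]
    · change _ = (lPart h (g * (incl h l)⁻¹)⁻¹)⁻¹ • l • x
      rw [mul_inv_rev, inv_inv, lPart_incl_mul, mul_inv_rev, mul_smul, inv_smul_smul])
  invFun a := Quotient.mk (indSetoid h X) ((rep a.1)⁻¹, a.2)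
  left_inv := by
    rintro ⟨g, x⟩
    refine Quotient.sound ⟨lPart h g⁻¹, Prod.ext ?_ ?_⟩
    · change g = (rep (cosetOf L g⁻¹))⁻¹ * (incl h (lPart h g⁻¹))⁻¹
      rw [← mul_inv_rev, incl_lPart_mul_rep, inv_inv]
    · exact (smul_inv_smul _ _).symm
  right_inv := by
    rintro ⟨q, x⟩
    refine Prod.ext ?_ ?_
    · change cosetOf L (rep q)⁻¹⁻¹ = q
      rw [inv_inv, cosetOf_rep]
    · change (lPart h (rep q)⁻¹⁻¹)⁻¹ • x = x
      rw [inv_inv, lPart_rep, inv_one, one_smul]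

theorem indEquiv_smul (X : FinGSet L) (k : H) (m : (X.ind h).carrier) :
    indEquiv h X (k • m) = (k • (indEquiv h X m).1,
      (lPart h (rep (indEquiv h X m).1 * k⁻¹))⁻¹ • (indEquiv h X m).2) := by
  obtain ⟨⟨q, x⟩, rfl⟩ := (indEquiv h X).symm.surjective m
  rw [Equiv.apply_symm_apply]
  refine Prod.ext ?_ ?_
  · change cosetOf L (k * (rep q)⁻¹)⁻¹ = k • q
    rw [mul_inv_rev, inv_inv, cosetOf_mul, cosetOf_rep, inv_inv]
  · change (lPart h (k * (rep q)⁻¹)⁻¹)⁻¹ • x = _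
    rw [mul_inv_rev, inv_inv]

/-- The monomial description makes the two actions agree in the coset part and in the signs of all
coefficients, so `permSign_prod_congr` applies; coinduction below is the same with
`permSign_arrow_congr`. -/
theorem signInvariant_ind (a b : FinGSetClass L) (hab : signInvariant L a = signInvariant L b) :
    signInvariant H (FinGSetClass.ind h a) = signInvariant H (FinGSetClass.ind h b) := by
  induction a using Quotient.ind with | _ X
  induction b using Quotient.ind with | _ Y
  obtain ⟨hc, hs⟩ := signInvariant_eq_iff.mp hab
  refine (signInvariant_eq_iff (X := X.ind h) (Y := Y.ind h)).mpr ⟨?_, fun k => ?_⟩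
  · rw [Nat.card_congr (indEquiv h X), Nat.card_congr (indEquiv h Y), Nat.card_prod,
      Nat.card_prod, hc]
  · exact permSign_prod_congr (MulAction.toPerm k)
      (fun q => MulAction.toPerm (lPart h (rep q * k⁻¹))⁻¹)
      (fun q => MulAction.toPerm (lPart h (rep q * k⁻¹))⁻¹) (Finite.card_eq.mp hc).some
      (fun q => hs _) _ _ (indEquiv h X) (indEquiv h Y) (indEquiv_smul h X k)
      (indEquiv_smul h Y k)

theorem signInvariant_coind (a b : FinGSetClass L)
    (hab : signInvariant L a = signInvariant L b) :
    signInvariant H (FinGSetClass.coind h a) = signInvariant H (FinGSetClass.coind h b) := by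
  induction a using Quotient.ind with | _ X
  induction b using Quotient.ind with | _ Y
  obtain ⟨hc, hs⟩ := signInvariant_eq_iff.mp hab
  refine (signInvariant_eq_iff (X := X.coind h) (Y := Y.coind h)).mpr ⟨?_, fun k => ?_⟩
  · exact Nat.card_congr ((mapLEquiv h X).trans (((Equiv.refl _).arrowCongr
      (Finite.card_eq.mp hc).some).trans (mapLEquiv h Y).symm))
  · exact permSign_arrow_congr (MulAction.toPerm k⁻¹)
      (fun q => MulAction.toPerm (lPart h (rep q * k)))
      (fun q => MulAction.toPerm (lPart h (rep q * k))) (Finite.card_eq.mp hc).some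
      (fun q => hs _) _ _ (mapLEquiv h X) (mapLEquiv h Y) (mapLEquiv_smul h X k)
      (mapLEquiv_smul h Y k)

variable (G) in
/-- The Tambara ideal of differences of finite sets with the same number of elements on which all
group elements act by permutations of the same sign. -/
noncomputable def signIdeal : TambaraIdeal G :=
  TambaraIdeal.ofInvariant (fun H => signInvariant H) signInvariant_mul
    (fun h => signInvariant_pullback (incl h) (continuous_incl h)) (fun h => signInvariant_ind h)
    (fun h => signInvariant_coind h) (fun g H => signInvariant_pullback (conjHom g H) (continuous_conjHom g H))

theorem mem_signIdeal (H : OpenSubgroup G) (x : Burnside H) :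
    x ∈ (signIdeal G).level H ↔ GrothendieckRing.liftAdd (signInvariant H) x = 0 := Iff.rfl

end SignInvariant

/-! ### Transitive sets in the Burnside ring. -/

section CosetClasses
variable {G : Type v} [Group G] [TopologicalSpace G] [IsTopologicalGroup G] [CompactSpace G]
  {H : OpenSubgroup G}

theorem smul_mem_orbit_iff' {M X : Type*} [Group M] [MulAction M X] (x : X) (k : M) (y : X) :
    k • y ∈ MulAction.orbit M x ↔ y ∈ MulAction.orbit M x := by
  rw [← MulAction.orbit_eq_iff, MulAction.orbit_smul, MulAction.orbit_eq_iff]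

/-- An orbit of a finite `H`-set is of the form `H / L`. -/
theorem exists_orbit_cls_eq (X : FinGSet H) (x : X.carrier) :
    ∃ L : OpenSubgroup G, L ≤ H ∧
      (X.sub (fun y => y ∈ MulAction.orbit H x) (smul_mem_orbit_iff' x)).cls =
        (cosetSet H L).cls := by
  let S : Subgroup H := MulAction.stabilizer H x
  let T : Subgroup G := S.map (Subgroup.subtype (H : Subgroup G))
  have hT : IsOpen (T : Set G) := by
    have := H.isOpen.isOpenMap_subtype_val _ (X.isOpen_stabilizer x)
    convert this using 1
    ext g
    rfl
  have hST : S = T.subgroupOf (H : Subgroup G) :=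
    (Subgroup.comap_map_eq_self_of_injective (Subgroup.subtype_injective _) S).symm
  refine ⟨⟨T, hT⟩, ?_, ?_⟩
  · rintro _ ⟨s, _, rfl⟩
    exact s.2
  · let E := (MulAction.orbitEquivQuotientStabilizer H x).trans (Subgroup.quotientEquivOfEq hST)
    refine (FinGSet.cls_eq (X := cosetSet H ⟨T, hT⟩)
      (Y := X.sub (fun y => y ∈ MulAction.orbit H x) (smul_mem_orbit_iff' x)) E.symm
      fun g y => ?_).symm
    induction y using QuotientGroup.induction_on with
    | H a => exact Subtype.ext (mul_smul g a x)

/-- The isomorphism classes of finite `H`-sets are sums of classes of transitive ones. -/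
theorem FinGSet.cls_mem_closure (X : FinGSet H) :
    X.cls ∈ AddSubmonoid.closure {c | ∃ L : OpenSubgroup G, L ≤ H ∧ c = (cosetSet H L).cls} := by
  induction hn : Nat.card X.carrier using Nat.strong_induction_on generalizing X with
  | _ n ih =>
  have hX : X.cls = (X.sub (fun _ => True) fun _ _ => Iff.rfl).cls :=
    FinGSet.cls_eq (Equiv.Set.univ X.carrier).symm fun _ _ => rfl
  by_cases hne : IsEmpty X.carrier
  · rw [hX, FinGSet.cls_sub_of_forall_not _ _ _ fun m => hne.elim m]
    exact zero_mem _
  · obtain ⟨x⟩ := not_isEmpty_iff.mp hne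
    have hP : ∀ (k : H) (m : X.carrier), k • m ∈ MulAction.orbit H x ↔ m ∈ MulAction.orbit H x :=
      smul_mem_orbit_iff' x
    have hQ : ∀ (k : H) (m : X.carrier), k • m ∉ MulAction.orbit H x ↔ m ∉ MulAction.orbit H x :=
      fun k m => not_congr (hP k m)
    rw [hX, FinGSet.cls_sub_congr X _ (fun k m => or_congr (hP k m) (hQ k m))
      fun m => (iff_of_true trivial (em _)), FinGSet.cls_sub_or X _ _ hP hQ fun m h h' => h' h]
    obtain ⟨L, hL, h⟩ := exists_orbit_cls_eq X x
    refine add_mem ?_ (ih _ ?_ _ rfl)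
    · rw [h]
      exact AddSubmonoid.subset_closure ⟨L, hL, rfl⟩
    · rw [← hn]
      exact Finite.card_subtype_lt (p := fun m => m ∉ MulAction.orbit H x) (x := x)
        (not_not.mpr (MulAction.mem_orbit_self x))

theorem mem_closure_cosetClass (x : Burnside H) :
    x ∈ AddSubgroup.closure {c | ∃ L : OpenSubgroup G, L ≤ H ∧ c = cosetClass H L} := by
  induction x using GrothendieckRing.induction with
  | hs x y hx hy => exact sub_mem hx hy
  | h a =>
    induction a using Quotient.ind with | _ X
    refine AddSubmonoid.closure_induction (motive := fun c _ => GrothendieckRing.of c ∈ _) ?_ ?_ ?_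
      X.cls_mem_closure
    · rintro _ ⟨L, hL, rfl⟩
      exact AddSubgroup.subset_closure ⟨L, hL, rfl⟩
    · rw [map_zero]
      exact zero_mem _
    · intro a b _ _ ha hb
      rw [map_add]
      exact add_mem ha hb

theorem cosetClass_self (H : OpenSubgroup G) : cosetClass H H = 1 := by
  have : Subsingleton (cosetSet H H).carrier := by
    refine ⟨fun a b => ?_⟩
    induction a using QuotientGroup.induction_on with | H a
    induction b using QuotientGroup.induction_on with | H b
    exact QuotientGroup.eq.mpr (a⁻¹ * b).2
  refine congrArg GrothendieckRing.of (FinGSet.cls_eq (X := cosetSet H H) (Y := FinGSet.point H)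
    { toFun := fun _ => PUnit.unit
      invFun := fun _ => ((1 : H) : H ⧸ _)
      left_inv := fun _ => Subsingleton.elim (α := (cosetSet H H).carrier) _ _
      right_inv := fun _ => rfl } fun _ _ => rfl)

/-- Transitivity of induction, for transitive sets. -/
theorem burnsideTr_cosetClass {L M : OpenSubgroup G} (hML : M ≤ L) (hLH : L ≤ H) :
    burnsideTr hLH (cosetClass L M) = cosetClass H M := by
  rw [cosetClass, burnsideTr_toBurnside]
  refine congrArg GrothendieckRing.of ?_
  let j : L ⧸ (M : Subgroup G).subgroupOf (L : Subgroup G) →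
      H ⧸ (M : Subgroup G).subgroupOf (H : Subgroup G) :=
    Quotient.map' (incl hLH) fun x y hxy => by
      rw [QuotientGroup.leftRel_apply, Subgroup.mem_subgroupOf] at hxy ⊢
      exact hxy
  let f : ((cosetSet L M).ind hLH).carrier → (cosetSet H M).carrier :=
    Quotient.lift (fun a : H × (cosetSet L M).carrier => a.1 • j a.2) (by
      rintro ⟨g, x⟩ _ ⟨l, rfl⟩
      induction x using QuotientGroup.induction_on with | H x
      refine congrArg (QuotientGroup.mk : H → H ⧸ (M : Subgroup G).subgroupOf (H : Subgroup G)) ?_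
      change g * incl hLH x = g * (incl hLH l)⁻¹ * incl hLH (l * x)
      rw [map_mul]
      group)
  have hf : Function.Bijective f := by
    constructor
    · rintro ⟨g, x⟩ ⟨g', x'⟩ hgx
      induction x using QuotientGroup.induction_on with | H x
      induction x' using QuotientGroup.induction_on with | H x'
      replace hgx : ((g * incl hLH x : H) : H ⧸ (M : Subgroup G).subgroupOf (H : Subgroup G)) =
        (g' * incl hLH x' : H) := hgx
      have h1 : ((g * incl hLH x : H) : G)⁻¹ * (g' * incl hLH x' : H) ∈ M :=
        (QuotientGroup.eq (s := (M : Subgroup G).subgroupOf (H : Subgroup G))).mp hgx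
      refine Quotient.sound ⟨x' * ⟨_, hML h1⟩⁻¹ * x⁻¹, Prod.ext ?_ ?_⟩
      · ext
        simp [coe_incl, mul_assoc]
      · refine QuotientGroup.eq.mpr ?_
        rw [Subgroup.mem_subgroupOf, ← inv_mem_iff]
        simpa [mul_assoc] using h1
    · intro y
      induction y using QuotientGroup.induction_on with | H g
      refine ⟨Quotient.mk _ (g, ((1 : L) : L ⧸ (M : Subgroup G).subgroupOf (L : Subgroup G))), ?_⟩
      refine congrArg (QuotientGroup.mk : H → H ⧸ (M : Subgroup G).subgroupOf (H : Subgroup G)) ?_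
      change g * incl hLH 1 = g
      rw [map_one, mul_one]
  refine FinGSet.cls_eq (X := (cosetSet L M).ind hLH) (Y := cosetSet H M)
    (Equiv.ofBijective f hf) ?_
  rintro k ⟨g, x⟩
  exact mul_smul (α := H) (β := (cosetSet H M).carrier) k g (j x)

/-- The product of two comparable transitive sets of a commutative group. -/
theorem cosetClass_mul_cosetClass (hcomm : ∀ a b : G, a * b = b * a) {L M : OpenSubgroup G}
    (hML : M ≤ L) :
    cosetClass H L * cosetClass H M = Nat.card (cosetSet H L).carrier • cosetClass H M := by
  have hc : ∀ a b : H, a * b = b * a := fun a b => Subtype.ext (hcomm a b)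
  -- With `ŷ` a representative of `y`, the map `(x, y) ↦ (ŷ⁻¹ x, y)` removes the action on the first
  -- factor. A change of representative lies in `M ≤ L` and acts trivially on `H / L`, the group
  -- being commutative.
  have key : ∀ (k : H) (x : (cosetSet H L).carrier) (y : (cosetSet H M).carrier),
      (Quotient.out (k • y))⁻¹ • k • x = (Quotient.out y)⁻¹ • x := by
    intro k x y
    have h1 : ((k * Quotient.out y : H) : H ⧸ (M : Subgroup G).subgroupOf (H : Subgroup G)) =
        ((Quotient.out (k • y) : H) : H ⧸ _) := by
      refine Eq.trans ?_ (Quotient.out_eq' (k • y)).symm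
      conv_rhs => rw [← Quotient.out_eq' y]
      rfl
    have h2 : ((k * Quotient.out y)⁻¹ * Quotient.out (k • y) : H) ∈
      (M : Subgroup G).subgroupOf (H : Subgroup G) := QuotientGroup.eq.mp h1
    rw [inv_smul_eq_iff]
    induction x using QuotientGroup.induction_on with | H x
    have h3 : (k * x)⁻¹ * (Quotient.out (k • y) * ((Quotient.out y)⁻¹ * x)) =
        (k * Quotient.out y)⁻¹ * Quotient.out (k • y) := by
      let _ : CommGroup H := { (inferInstance : Group H) with mul_comm := hc }
      exact Additive.ofMul.injective (by simp only [ofMul_mul, ofMul_inv]; abel)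
    refine QuotientGroup.eq.mpr (show (k * x)⁻¹ * (Quotient.out (k • y) *
      ((Quotient.out y)⁻¹ * x)) ∈ (L : Subgroup G).subgroupOf (H : Subgroup G) from ?_)
    rw [h3]
    exact hML h2
  have e := Finite.equivFin (cosetSet H L).carrier
  have h1 := FinGSet.cls_copies (Fin (Nat.card (cosetSet H L).carrier)) (cosetSet H M)
  rw [Nat.card_fin] at h1
  have h2 : ((cosetSet H L).prod (cosetSet H M)).cls =
      ((cosetSet H M).copies (Fin (Nat.card (cosetSet H L).carrier))).cls := by
    refine FinGSet.cls_eq (X := (cosetSet H L).prod (cosetSet H M))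
      (Y := (cosetSet H M).copies (Fin (Nat.card (cosetSet H L).carrier)))
      { toFun := fun a => (e ((Quotient.out a.2)⁻¹ • a.1), a.2)
        invFun := fun a => (Quotient.out a.2 • e.symm a.1, a.2)
        left_inv := fun a => Prod.ext (by simp) rfl
        right_inv := fun a => Prod.ext (by simp) rfl } fun k a => Prod.ext ?_ rfl
    exact congrArg e (key k a.1 a.2)
  rw [cosetClass, cosetClass, FinGSet.toBurnside, FinGSet.toBurnside, ← GrothendieckRing.of_mul,
    ← map_nsmul, ← h1, ← h2]
  rfl

end CosetClasses

/-! ### Open subgroups of `ℤ_p` and the action of a topological generator. -/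

section Padic
variable {p : ℕ} [Fact p.Prime] {G : Type v} [Group G] [TopologicalSpace G]
  (e : G ≃ₜ* Multiplicative ℤ_[p])

theorem mem_padicSubgroup {n : ℕ} {g : G} :
    g ∈ padicSubgroup e n ↔ (p : ℤ_[p]) ^ n ∣ (e g).toAdd := Iff.rfl

theorem padicSubgroup_le {n m : ℕ} (h : n ≤ m) : padicSubgroup e m ≤ padicSubgroup e n :=
  fun _ hg => (pow_dvd_pow _ h).trans hg

include e in
theorem mul_comm_of_padic (a b : G) : a * b = b * a := e.injective (by
  rw [map_mul, map_mul, mul_comm])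

/-- The element of `G` corresponding to `p ^ n`. -/
noncomputable def padicGen (n : ℕ) : padicSubgroup e n :=
  ⟨e.symm (Multiplicative.ofAdd ((p : ℤ_[p]) ^ n)), by
    rw [mem_padicSubgroup, ContinuousMulEquiv.apply_symm_apply]
    exact dvd_rfl⟩

theorem toAdd_padicGen_pow (n k : ℕ) :
    (e ((padicGen e n ^ k : padicSubgroup e n) : G)).toAdd = k * (p : ℤ_[p]) ^ n := by
  have : ((padicGen e n ^ k : padicSubgroup e n) : G) =
    e.symm (Multiplicative.ofAdd ((p : ℤ_[p]) ^ n)) ^ k := rfl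
  rw [this, map_pow, ContinuousMulEquiv.apply_symm_apply, toAdd_pow, toAdd_ofAdd, nsmul_eq_mul]

theorem padicGen_pow_mem_iff (n m k : ℕ) :
    ((padicGen e n ^ k : padicSubgroup e n) : G) ∈ padicSubgroup e (n + m) ↔ p ^ m ∣ k := by
  have hp : (p : ℤ_[p]) ^ n ≠ 0 := pow_ne_zero _ (NeZero.ne _)
  rw [mem_padicSubgroup, toAdd_padicGen_pow, pow_add, mul_comm, mul_dvd_mul_iff_right hp,
    ← Int.cast_natCast k, PadicInt.pow_p_dvd_int_iff]
  exact_mod_cast Iff.rfl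

theorem exists_natCast_add_mul (z : ℤ_[p]) (m : ℕ) :
    ∃ (k : ℕ) (b : ℤ_[p]), z = k + (p : ℤ_[p]) ^ m * b := by
  obtain ⟨b, hb⟩ := Ideal.mem_span_singleton.mp (PadicInt.appr_spec m z)
  exact ⟨z.appr m, b, by rw [← hb]; ring⟩

/-- The natural numbers meet every class modulo `p^m`. As `s` acts trivially on `p^n ℤ_p / p^{n+m}
ℤ_p`, and fixes the corresponding field, only powers of the generator matter there. -/
theorem exists_eq_padicGen_pow_mul (n m : ℕ) (h : padicSubgroup e n) :
    ∃ (k : ℕ) (s : padicSubgroup e n), (s : G) ∈ padicSubgroup e (n + m) ∧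
      h = padicGen e n ^ k * s := by
  obtain ⟨z, hz⟩ := h.2
  obtain ⟨k, b, rfl⟩ := exists_natCast_add_mul z m
  refine ⟨k, (padicGen e n ^ k)⁻¹ * h, ?_, by rw [mul_inv_cancel_left]⟩
  refine (mem_padicSubgroup e).mpr ⟨b, ?_⟩
  have : (((padicGen e n ^ k)⁻¹ * h : padicSubgroup e n) : G) =
    ((padicGen e n ^ k : padicSubgroup e n) : G)⁻¹ * h := rfl
  rw [this, map_mul, map_inv, toAdd_mul, toAdd_inv, toAdd_padicGen_pow, hz]
  ring

/-- An open subgroup contains some `p^N ℤ_p`, and every `p`-adic integer is a natural number modulo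
`p^N`. So the subgroup is a nonzero ideal of `ℤ_p`. -/
theorem exists_eq_padicSubgroup (H : OpenSubgroup G) : ∃ n, H = padicSubgroup e n := by
  let O : Set ℤ_[p] := {z | e.symm (Multiplicative.ofAdd z) ∈ H}
  have hO : IsOpen O := H.isOpen.preimage (e.symm.continuous.comp continuous_ofAdd)
  have h0 : (0 : ℤ_[p]) ∈ O := by
    change e.symm 1 ∈ H
    rw [map_one]
    exact one_mem H
  have hadd : ∀ {a b : ℤ_[p]}, a ∈ O → b ∈ O → a + b ∈ O := fun {a b} ha hb => by
    change e.symm (Multiplicative.ofAdd a * Multiplicative.ofAdd b) ∈ H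
    rw [map_mul]
    exact mul_mem ha hb
  obtain ⟨ε, hε, hball⟩ := Metric.isOpen_iff.mp hO 0 h0
  obtain ⟨N, hN⟩ := PadicInt.exists_pow_neg_lt p hε
  have hpN : ∀ b : ℤ_[p], (p : ℤ_[p]) ^ N * b ∈ O := fun b => hball (by
    rw [mem_ball_zero_iff]
    refine lt_of_le_of_lt ?_ hN
    rw [PadicInt.norm_le_pow_iff_mem_span_pow, Ideal.mem_span_singleton]
    exact dvd_mul_right _ _)
  let J : Ideal ℤ_[p] :=
    { carrier := O
      zero_mem' := h0
      add_mem' := hadd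
      smul_mem' := fun c x hx => by
        obtain ⟨k, b, rfl⟩ := exists_natCast_add_mul c N
        have : ((k : ℤ_[p]) + (p : ℤ_[p]) ^ N * b) • x = k • x + (p : ℤ_[p]) ^ N * (b * x) := by
          rw [smul_eq_mul, nsmul_eq_mul]
          ring
        rw [this]
        refine hadd ?_ (hpN _)
        change e.symm (Multiplicative.ofAdd x ^ k) ∈ H
        rw [map_pow]
        exact pow_mem hx k }
  have hJ : J ≠ ⊥ := fun h => by
    have : (p : ℤ_[p]) ^ N * 1 ∈ J := hpN 1
    rw [h, Ideal.mem_bot, mul_one] at this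
    exact pow_ne_zero N (NeZero.ne (p : ℤ_[p])) this
  obtain ⟨n, hn⟩ := PadicInt.ideal_eq_span_pow_p hJ
  refine ⟨n, OpenSubgroup.ext fun g => ?_⟩
  rw [mem_padicSubgroup, ← Ideal.mem_span_singleton, ← hn]
  change _ ↔ e.symm (e g) ∈ H
  rw [ContinuousMulEquiv.symm_apply_apply]

/-! ### The Burnside ring of `ℤ_p`: generators, products and signs. -/

section Burnside
variable [IsTopologicalGroup G] [CompactSpace G]

theorem mem_closure_padicCoset (n : ℕ) (x : Burnside (padicSubgroup e n)) :
    x ∈ AddSubgroup.closure (Set.range (padicCoset e n)) := by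
  refine AddSubgroup.closure_mono ?_ (mem_closure_cosetClass x)
  rintro _ ⟨L, hL, rfl⟩
  obtain ⟨k, rfl⟩ := exists_eq_padicSubgroup e L
  have hnk : n ≤ k := by
    have h1 : ((padicGen e k ^ 1 : padicSubgroup e k) : G) ∈ padicSubgroup e n :=
      hL (padicGen e k ^ 1 : padicSubgroup e k).2
    rw [mem_padicSubgroup, toAdd_padicGen_pow, Nat.cast_one, one_mul] at h1
    exact (pow_dvd_pow_iff (NeZero.ne _) PadicInt.prime_p.not_isUnit).mp h1
  obtain ⟨m, rfl⟩ := Nat.exists_eq_add_of_le hnk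
  exact ⟨m, rfl⟩

theorem padicCoset_zero (n : ℕ) : padicCoset e n 0 = 1 := cosetClass_self _

theorem burnsideTr_padicCoset (n m k : ℕ) :
    burnsideTr (padicSubgroup_le e (Nat.le_add_right n m)) (padicCoset e (n + m) k) =
      padicCoset e n (m + k) := by
  rw [padicCoset, padicCoset, burnsideTr_cosetClass (padicSubgroup_le e (Nat.le_add_right _ _)),
    add_assoc]

theorem burnsideTr_one_padic (n m : ℕ) :
    burnsideTr (padicSubgroup_le e (Nat.le_add_right n m)) 1 = padicCoset e n m := by
  rw [← padicCoset_zero, burnsideTr_padicCoset, add_zero]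

theorem isCycleOn_padicGen (n m : ℕ) :
    (MulAction.toPerm (padicGen e n) :
      Equiv.Perm (cosetSet (padicSubgroup e n) (padicSubgroup e (n + m))).carrier).IsCycleOn
      Set.univ := by
  refine ⟨Set.bijOn_univ.mpr (Equiv.bijective _), fun x _ y _ => ?_⟩
  have key : ∀ y : (cosetSet (padicSubgroup e n) (padicSubgroup e (n + m))).carrier,
      (MulAction.toPerm (padicGen e n) : Equiv.Perm _).SameCycle
        ((1 : padicSubgroup e n) : padicSubgroup e n ⧸ _) y := by
    intro y
    induction y using QuotientGroup.induction_on with | H y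
    obtain ⟨k, s, hs, rfl⟩ := exists_eq_padicGen_pow_mul e n m y
    refine ⟨k, ?_⟩
    rw [zpow_natCast]
    have := (MulAction.toPermHom (padicSubgroup e n)
      (cosetSet (padicSubgroup e n) (padicSubgroup e (n + m))).carrier).map_pow (padicGen e n) k
    refine (DFunLike.congr_fun this.symm _).trans ?_
    refine QuotientGroup.eq.mpr (Subgroup.mem_subgroupOf.mpr ?_)
    change (((padicGen e n ^ k * 1)⁻¹ * (padicGen e n ^ k * s) : padicSubgroup e n) : G) ∈ _
    rwa [mul_one, inv_mul_cancel_left]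
  exact (key x).symm.trans (key y)

theorem padicGen_pow_smul_eq_iff (n m k : ℕ) :
    ((MulAction.toPerm (padicGen e n) :
      Equiv.Perm (cosetSet (padicSubgroup e n) (padicSubgroup e (n + m))).carrier) ^ k)
        ((1 : padicSubgroup e n) : padicSubgroup e n ⧸ _) =
        ((1 : padicSubgroup e n) : padicSubgroup e n ⧸ _) ↔ p ^ m ∣ k := by
  have := (MulAction.toPermHom (padicSubgroup e n)
    (cosetSet (padicSubgroup e n) (padicSubgroup e (n + m))).carrier).map_pow (padicGen e n) k
  rw [← padicGen_pow_mem_iff e n m k]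
  refine (Iff.of_eq (congrArg (· = _) (DFunLike.congr_fun this.symm _))).trans ?_
  refine eq_comm.trans (QuotientGroup.eq.trans ?_)
  rw [Subgroup.mem_subgroupOf]
  simp

/-- The generator acts as a single cycle, so its `k`-th power fixes a point exactly when the
cardinality divides `k`; that condition is also `p^m ∣ k`. -/
theorem card_padicCoset (n m : ℕ) :
    Nat.card (cosetSet (padicSubgroup e n) (padicSubgroup e (n + m))).carrier = p ^ m := by
  have := Fintype.ofFinite (cosetSet (padicSubgroup e n) (padicSubgroup e (n + m))).carrier
  have h1 := isCycleOn_padicGen e n m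
  rw [← Finset.coe_univ] at h1
  have h2 := fun k => (h1.pow_apply_eq (n := k) (Finset.mem_univ
    (α := (cosetSet (padicSubgroup e n) (padicSubgroup e (n + m))).carrier) _)).symm.trans
      (padicGen_pow_smul_eq_iff e n m k)
  rw [Nat.card_eq_fintype_card, ← Finset.card_univ]
  exact Nat.dvd_antisymm ((h2 _).mpr dvd_rfl) ((h2 _).mp dvd_rfl)

theorem padicCoset_mul_padicCoset (n : ℕ) {a b : ℕ} (hab : a ≤ b) :
    padicCoset e n a * padicCoset e n b = (p : Burnside (padicSubgroup e n)) ^ a *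
      padicCoset e n b := by
  rw [padicCoset, padicCoset, cosetClass_mul_cosetClass (mul_comm_of_padic e)
    (padicSubgroup_le e (Nat.add_le_add_left hab n)), card_padicCoset, nsmul_eq_mul, Nat.cast_pow]

/-- Elements of `p ^ (n + m) ℤ_p` act trivially on `p ^ n ℤ_p / p ^ (n + m) ℤ_p`. -/
theorem toPerm_eq_one_of_mem (n m : ℕ) (s : padicSubgroup e n)
    (hs : (s : G) ∈ padicSubgroup e (n + m)) :
    (MulAction.toPerm s :
      Equiv.Perm (cosetSet (padicSubgroup e n) (padicSubgroup e (n + m))).carrier) = 1 := by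
  ext y
  induction y using QuotientGroup.induction_on with | H y
  refine QuotientGroup.eq.mpr (show (s * y)⁻¹ * y ∈ _ from ?_)
  have : (s * y)⁻¹ * y = s⁻¹ := Subtype.ext (by
    rw [mul_inv_rev]
    change ((y : G)⁻¹ * (s : G)⁻¹) * y = (s : G)⁻¹
    rw [mul_comm_of_padic e (y : G)⁻¹, inv_mul_cancel_right])
  rw [this, Subgroup.mem_subgroupOf]
  exact inv_mem hs

/-- The number of elements and the signs of the group elements, on the Burnside ring. -/
noncomputable abbrev burnsideSign (H : Type v) [Group H] [TopologicalSpace H] :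
    Burnside H →+ ℤ × (H → Additive ℤˣ) :=
  GrothendieckRing.liftAdd (signInvariant H)

theorem burnsideSign_one (H : Type v) [Group H] [TopologicalSpace H] : burnsideSign H 1 = (1, 0) := by
  refine (GrothendieckRing.liftAdd_of (signInvariant H) 1).trans (Prod.ext ?_ (funext fun k => ?_))
  · change ((Nat.card PUnit : ℕ) : ℤ) = 1
    rw [Nat.card_unique, Nat.cast_one]
  · have : (MulAction.toPerm k : Equiv.Perm (FinGSet.point H).carrier) = 1 := Equiv.ext fun _ => rfl
    change Additive.ofMul (permSign (MulAction.toPerm k :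
      Equiv.Perm (FinGSet.point H).carrier)) = 0
    rw [this, map_one]
    rfl

theorem burnsideSign_intCast (H : Type v) [Group H] [TopologicalSpace H] (c : ℤ) :
    burnsideSign H c = (c, 0) := by
  rw [← mul_one (c : Burnside H), ← zsmul_eq_mul, map_zsmul, burnsideSign_one]
  simp

theorem burnsideSign_padicCoset (n m : ℕ) :
    burnsideSign _ (padicCoset e n m) = ((p : ℤ) ^ m, fun k => Additive.ofMul (permSign
      (MulAction.toPerm k :
        Equiv.Perm (cosetSet (padicSubgroup e n) (padicSubgroup e (n + m))).carrier))) := by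
  refine (GrothendieckRing.liftAdd_of _ _).trans (Prod.ext ?_ rfl)
  rw [← Nat.cast_pow, ← card_padicCoset e n m]
  rfl

theorem permSign_pow_mul (n m l k : ℕ) (hlm : l ≤ m) (s : padicSubgroup e n)
    (hs : (s : G) ∈ padicSubgroup e (n + m)) :
    permSign (MulAction.toPerm (padicGen e n ^ k * s) :
      Equiv.Perm (cosetSet (padicSubgroup e n) (padicSubgroup e (n + l))).carrier) =
    permSign (MulAction.toPerm (padicGen e n) :
      Equiv.Perm (cosetSet (padicSubgroup e n) (padicSubgroup e (n + l))).carrier) ^ k := by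
  have h := (MulAction.toPermHom (padicSubgroup e n)
      (cosetSet (padicSubgroup e n) (padicSubgroup e (n + l))).carrier).map_mul (padicGen e n ^ k) s
  rw [map_pow] at h
  refine (congrArg permSign h).trans ?_
  rw [map_mul, map_pow]
  refine (congrArg (_ * permSign ·) (toPerm_eq_one_of_mem e n l s
    (padicSubgroup_le e (Nat.add_le_add_left hlm n) hs))).trans ?_
  rw [map_one, mul_one]
  rfl

/-- The `p^m`-th power of the generator acts trivially, and `-1` has no odd power equal to `1`. -/
theorem permSign_padicCoset_of_odd (hp : Odd p) (n m : ℕ) (h : padicSubgroup e n) :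
    permSign (MulAction.toPerm h :
      Equiv.Perm (cosetSet (padicSubgroup e n) (padicSubgroup e (n + m))).carrier) = 1 := by
  have hgen : permSign (MulAction.toPerm (padicGen e n) :
      Equiv.Perm (cosetSet (padicSubgroup e n) (padicSubgroup e (n + m))).carrier) = 1 := by
    have h1 := permSign_pow_mul e n m m (p ^ m) le_rfl (padicGen e n ^ p ^ m)⁻¹
      (inv_mem ((padicGen_pow_mem_iff e n m (p ^ m)).mpr dvd_rfl))
    rw [mul_inv_cancel] at h1
    have h2 : (MulAction.toPerm (1 : padicSubgroup e n) : Equiv.Perm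
      (cosetSet (padicSubgroup e n) (padicSubgroup e (n + m))).carrier) = 1 :=
        (MulAction.toPermHom _ _).map_one
    rw [h2, map_one] at h1
    rcases Int.units_eq_one_or (permSign (MulAction.toPerm (padicGen e n) :
      Equiv.Perm (cosetSet (padicSubgroup e n) (padicSubgroup e (n + m))).carrier)) with h3 | h3
    · exact h3
    · rw [h3, hp.pow.neg_one_pow] at h1
      exact absurd h1 (by decide)
  obtain ⟨k, s, hs, rfl⟩ := exists_eq_padicGen_pow_mul e n m h
  rw [permSign_pow_mul e n m m k le_rfl s hs, hgen, one_pow]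

/-- The generator is a cycle of even length `p^m`. For `m = 0` the action is trivial, hence the
bound on `m`. -/
theorem permSign_padicGen_of_even (hp : Even p) (n m : ℕ) (hm : 1 ≤ m) :
    permSign (MulAction.toPerm (padicGen e n) :
      Equiv.Perm (cosetSet (padicSubgroup e n) (padicSubgroup e (n + m))).carrier) = -1 := by
  classical
  have := Fintype.ofFinite (cosetSet (padicSubgroup e n) (padicSubgroup e (n + m))).carrier
  have hcard : Fintype.card (cosetSet (padicSubgroup e n) (padicSubgroup e (n + m))).carrier =
      p ^ m := by rw [← Nat.card_eq_fintype_card, card_padicCoset]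
  have hnt : Nontrivial (cosetSet (padicSubgroup e n) (padicSubgroup e (n + m))).carrier := by
    rw [← Fintype.one_lt_card_iff_nontrivial, hcard]
    exact Nat.one_lt_pow (by omega) (Fact.out : p.Prime).one_lt
  have hc := isCycleOn_padicGen e n m
  have hcyc : (MulAction.toPerm (padicGen e n) : Equiv.Perm
      (cosetSet (padicSubgroup e n) (padicSubgroup e (n + m))).carrier).IsCycle :=
    Equiv.Perm.isCycle_iff_exists_isCycleOn.mpr
      ⟨Set.univ, Set.nontrivial_univ, hc, fun _ _ => Set.mem_univ _⟩
  have hsupp : (MulAction.toPerm (padicGen e n) : Equiv.Perm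
      (cosetSet (padicSubgroup e n) (padicSubgroup e (n + m))).carrier).support = Finset.univ :=
    Finset.eq_univ_of_forall fun x => Equiv.Perm.mem_support.mpr
      (hc.apply_ne Set.nontrivial_univ (Set.mem_univ x))
  rw [permSign_eq_sign, hcyc.sign, hsupp, Finset.card_univ, hcard,
    (hp.pow_of_ne_zero (by omega)).neg_one_pow]

/-- Up to an element acting trivially on both sets, `h` is a power of the generator, whose sign is
`-1` on each. -/
theorem permSign_padicCoset_eq (hp : Even p) (n m : ℕ) (hm : 1 ≤ m) (h : padicSubgroup e n) :
    permSign (MulAction.toPerm h :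
      Equiv.Perm (cosetSet (padicSubgroup e n) (padicSubgroup e (n + m))).carrier) =
    permSign (MulAction.toPerm h :
      Equiv.Perm (cosetSet (padicSubgroup e n) (padicSubgroup e (n + 1))).carrier) := by
  obtain ⟨k, s, hs, rfl⟩ := exists_eq_padicGen_pow_mul e n m h
  rw [permSign_pow_mul e n m m k le_rfl s hs, permSign_pow_mul e n m 1 k hm s hs,
    permSign_padicGen_of_even e hp n m hm, permSign_padicGen_of_even e hp n 1 le_rfl]

theorem padicCoset_sub_mem_signIdeal (hp : Odd p) (n m : ℕ) :
    padicCoset e n m - (p : Burnside (padicSubgroup e n)) ^ m ∈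
      (signIdeal G).level (padicSubgroup e n) := by
  rw [mem_signIdeal]
  change burnsideSign _ _ = 0
  have h : (p : Burnside (padicSubgroup e n)) ^ m = (((p : ℤ) ^ m : ℤ) : Burnside _) := by
    push_cast; rfl
  rw [map_sub, burnsideSign_padicCoset, h, burnsideSign_intCast]
  refine Prod.ext (sub_self _) (funext fun k => ?_)
  change Additive.ofMul (permSign _) - 0 = 0
  rw [permSign_padicCoset_of_odd e hp, sub_zero]
  rfl

theorem padicCoset_add_sub_mem_signIdeal (hp : p = 2) (n m : ℕ) (hm : 1 ≤ m) :
    padicCoset e n m + padicCoset e n 1 - 2 ^ m - 2 ∈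
      (signIdeal G).level (padicSubgroup e n) := by
  rw [mem_signIdeal]
  change burnsideSign _ _ = 0
  have h : (2 : Burnside (padicSubgroup e n)) ^ m = ((2 ^ m : ℤ) : Burnside _) := by
    push_cast; rfl
  have h2 : (2 : Burnside (padicSubgroup e n)) = ((2 : ℤ) : Burnside _) := by
    push_cast; rfl
  rw [map_sub, map_sub, map_add, burnsideSign_padicCoset, burnsideSign_padicCoset, h,
    burnsideSign_intCast, h2, burnsideSign_intCast]
  refine Prod.ext ?_ (funext fun k => ?_)
  · change (p : ℤ) ^ m + (p : ℤ) ^ 1 - 2 ^ m - 2 = 0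
    subst hp
    push_cast
    ring
  · change Additive.ofMul (permSign _) + Additive.ofMul (permSign _) - 0 - 0 = 0
    rw [permSign_padicCoset_eq e (hp ▸ even_two) n m hm, sub_zero, sub_zero, ← ofMul_mul,
      Int.units_mul_self]
    rfl

end Burnside

end Padic

/-! ### Transfer between intermediate fields. -/

section RelativeTransfer
variable {F : Type u} {K : Type v} [Field F] [Field K] [Algebra F K] [IsGalois F K]

/-- The transfer between intermediate fields is compatible with trace forms. -/
theorem exists_transfer {A B : IntermediateField F K} (hAB : A ≤ B) [FiniteDimensional F B]
    [NeZero (2 : A)] [NeZero (2 : B)] :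
    ∃ T : GW B →+ GW A, ∀ (M : IntermediateField A K) (N : IntermediateField B K)
      [FiniteDimensional A M] [FiniteDimensional B N], (∀ x, x ∈ M ↔ x ∈ N) →
      T (Algebra.GrothendieckAddGroup.of (traceFormSpace B N).cls) =
        Algebra.GrothendieckAddGroup.of (traceFormSpace A M).cls := by
  let _ : Algebra A B := (IntermediateField.inclusion hAB).toAlgebra
  have : IsScalarTower A B K := IsScalarTower.of_algebraMap_eq fun _ => rfl
  have : IsScalarTower F A B := IsScalarTower.of_algebraMap_eq fun _ => rfl
  have : FiniteDimensional A B := Module.Finite.of_restrictScalars_finite F A B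
  have : Algebra.IsSeparable A B := Algebra.isSeparable_tower_bot_of_isSeparable A B K
  refine ⟨gwTransfer A, fun M N _ _ hMN => ?_⟩
  have : IsScalarTower A B N := IsScalarTower.of_algebraMap_eq fun _ => rfl
  have : FiniteDimensional A N := Module.Finite.trans B N
  have : Algebra.IsSeparable A N := Algebra.IsSeparable.trans A B N
  rw [gwTransfer_traceFormSpace]
  let φ : N ≃ₐ[A] M :=
    { toFun := fun x => ⟨x, (hMN x).mpr x.2⟩
      invFun := fun x => ⟨x, (hMN x).mp x.2⟩
      left_inv := fun _ => rfl
      right_inv := fun _ => rfl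
      map_add' := fun _ _ => rfl
      map_mul' := fun _ _ => rfl
      commutes' := fun _ => rfl }
  rw [traceFormSpace_cls_congr φ]

end RelativeTransfer

/-! ### The layers of a `ℤ_p`-extension and their trace forms. -/

section PadicExtension
variable {F : Type u} {K : Type v} [Field F] [Field K] [Algebra F K] {p : ℕ} [Fact p.Prime]
  (e : Gal(K/F) ≃ₜ* Multiplicative ℤ_[p])

/-- The fixed field of `p ^ (n + m) ℤ_p` as an extension of that of `p ^ n ℤ_p`. -/
noncomputable def padicExt (n m : ℕ) : IntermediateField (fixedFld (padicSubgroup e n)) K :=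
  fixedExt (padicSubgroup e n)
    ((padicSubgroup e (n + m) : Subgroup Gal(K/F)).subgroupOf (padicSubgroup e n : Subgroup _))

theorem mem_padicExt {n m : ℕ} {x : K} :
    x ∈ padicExt e n m ↔ ∀ s ∈ padicSubgroup e (n + m), s x = x := by
  rw [padicExt, mem_fixedExt]
  exact ⟨fun h s hs => h ⟨s, padicSubgroup_le e (Nat.le_add_right n m) hs⟩ hs,
    fun h s hs => h s hs⟩

/-- The automorphism of `K` over the fixed field of `p ^ n ℤ_p` corresponding to `p ^ n`. -/
noncomputable def padicAut (n : ℕ) : Gal(K/fixedFld (padicSubgroup e n)) :=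
  IntermediateField.fixingSubgroupEquiv (fixedFld (padicSubgroup e n))
    ⟨(padicGen e n : Gal(K/F)), (IntermediateField.le_iff_le _ _).mp le_rfl (padicGen e n).2⟩

theorem padicAut_pow_apply (n k : ℕ) (x : K) :
    (padicAut e n ^ k) x = ((padicGen e n ^ k : padicSubgroup e n) : Gal(K/F)) x := by
  induction k generalizing x with
  | zero => rfl
  | succ k ih =>
    rw [pow_succ, AlgEquiv.mul_apply, ih, pow_succ]
    rfl

/-- On layer `m` the group acts through powers of the generator, so layer `k` is cut out by its
`p^k`-th power alone. The octic computation takes the layers in this form. -/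
theorem mem_padicExt_iff_of_le (n : ℕ) {k m : ℕ} (hkm : k ≤ m) (x : K) :
    x ∈ padicExt e n k ↔ x ∈ padicExt e n m ∧ (padicAut e n ^ p ^ k) x = x := by
  rw [mem_padicExt, mem_padicExt, padicAut_pow_apply]
  refine ⟨fun h => ⟨fun s hs => h s (padicSubgroup_le e (Nat.add_le_add_left hkm n) hs),
    h _ ((padicGen_pow_mem_iff e n k _).mpr dvd_rfl)⟩, fun ⟨h1, h2⟩ s hs => ?_⟩
  obtain ⟨j, s', hs', hj⟩ := exists_eq_padicGen_pow_mul e n m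
    ⟨s, padicSubgroup_le e (Nat.le_add_right n k) hs⟩
  have hj' : s = ((padicGen e n ^ j : padicSubgroup e n) : Gal(K/F)) * s' := congrArg Subtype.val hj
  have hmem : ((padicGen e n ^ j : padicSubgroup e n) : Gal(K/F)) ∈ padicSubgroup e (n + k) := by
    rw [eq_mul_inv_of_mul_eq hj'.symm]
    exact mul_mem hs (inv_mem (padicSubgroup_le e (Nat.add_le_add_left hkm n) hs'))
  obtain ⟨c, rfl⟩ := (padicGen_pow_mem_iff e n k j).mp hmem
  rw [hj', AlgEquiv.mul_apply, h1 _ hs', ← padicAut_pow_apply, pow_mul]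
  rw [← padicAut_pow_apply] at h2
  have hpow : ∀ c, ((padicAut e n ^ p ^ k) ^ c) x = x := fun c => by
    induction c with
    | zero => rfl
    | succ c ih => rw [pow_succ, AlgEquiv.mul_apply, h2, ih]
  exact hpow c

theorem mem_bot_of_padicAut_apply_eq (n m : ℕ) (x : K) (hx : x ∈ padicExt e n m)
    (h : padicAut e n x = x) : x ∈ (⊥ : IntermediateField (fixedFld (padicSubgroup e n)) K) := by
  have h0 : x ∈ padicExt e n 0 := (mem_padicExt_iff_of_le e n (Nat.zero_le m) x).mpr
    ⟨hx, by rwa [pow_zero, pow_one]⟩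
  exact IntermediateField.mem_bot.mpr ⟨⟨x, (IntermediateField.mem_fixedField_iff _ _).mpr
    ((mem_padicExt e).mp h0)⟩, rfl⟩

variable [IsGalois F K]

instance finiteDimensional_padicExt (n m : ℕ) :
    FiniteDimensional (fixedFld (padicSubgroup e n)) (padicExt e n m) :=
  finiteDimensional_fixedExt _ _ (Subgroup.subgroupOf_isOpen _ _ (padicSubgroup e (n + m)).isOpen)

include e in
theorem isAbelianGalois_of_padic : IsAbelianGalois F K :=
  { is_comm := ⟨mul_comm_of_padic e⟩ }

theorem isAbelianGalois_padicExt (n m : ℕ) :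
    IsAbelianGalois (fixedFld (padicSubgroup e n)) (padicExt e n m) := by
  have := isAbelianGalois_of_padic e
  infer_instance

/-- The degree is the order of the generator on the layer. A power acts trivially exactly when it
lies in the fixing subgroup, which by the Galois correspondence is `p^{n+m} ℤ_p`. -/
theorem finrank_padicExt (n m : ℕ) :
    Module.finrank (fixedFld (padicSubgroup e n)) (padicExt e n m) = p ^ m := by
  have := isAbelianGalois_padicExt e n m
  rw [← orderOf_restrictNormal (padicExt e n m) (padicAut e n)
    fun x => mem_bot_of_padicAut_apply_eq e n m x]
  have key : ∀ k, ((padicAut e n).restrictNormal (padicExt e n m)) ^ k = 1 ↔ p ^ m ∣ k := by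
    intro k
    have h1 : (IntermediateField.fixedField
        (padicSubgroup e (n + m) : Subgroup Gal(K/F))).fixingSubgroup = padicSubgroup e (n + m) :=
      InfiniteGalois.fixingSubgroup_fixedField ⟨_, (padicSubgroup e (n + m)).isClosed⟩
    rw [← padicGen_pow_mem_iff e n m k]
    refine Iff.trans ?_ (SetLike.ext_iff.mp h1 _)
    rw [IntermediateField.mem_fixingSubgroup_iff]
    constructor
    · intro h x hx
      have hx' : x ∈ padicExt e n m :=
        (mem_padicExt e).mpr ((IntermediateField.mem_fixedField_iff _ _).mp hx)
      have h2 := coe_restrictNormal_pow (padicExt e n m) (padicAut e n) k ⟨x, hx'⟩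
      rw [h, padicAut_pow_apply] at h2
      exact h2.symm
    · intro h
      ext x
      rw [coe_restrictNormal_pow, padicAut_pow_apply]
      exact h x ((IntermediateField.mem_fixedField_iff _ _).mpr ((mem_padicExt e).mp x.2))
  exact Nat.dvd_antisymm (orderOf_dvd_of_pow_eq_one ((key _).mpr dvd_rfl))
    ((key _).mp (pow_orderOf_eq_one _))

variable [NeZero (2 : F)]

theorem dress_padicCoset (n m : ℕ) :
    dress (padicSubgroup e n) (padicCoset e n m) =
      Algebra.GrothendieckAddGroup.of (traceFormSpace _ (padicExt e n m)).cls :=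
  dress_cosetClass _ _

theorem dress_padicCoset_of_odd (n m : ℕ) (hp : Odd (p ^ m)) :
    dress (padicSubgroup e n) (padicCoset e n m) = p ^ m • gwLine 1 := by
  have := isAbelianGalois_padicExt e n m
  rw [dress_padicCoset, traceFormSpace_cls_of_odd (by rwa [finrank_padicExt]), finrank_padicExt,
    map_nsmul]
  rfl

/-- The layer `k` steps above level `n + m` is the same field as the layer `m + k` steps above level
`n`. -/
theorem exists_transfer_dress_padicCoset (n m : ℕ) :
    ∃ T : GW (fixedFld (padicSubgroup e (n + m))) →+ GW (fixedFld (padicSubgroup e n)), ∀ k,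
      T (dress _ (padicCoset e (n + m) k)) = dress _ (padicCoset e n (m + k)) := by
  have hle : fixedFld (padicSubgroup e n) ≤ fixedFld (padicSubgroup e (n + m)) := fun x hx =>
    (IntermediateField.mem_fixedField_iff _ _).mpr fun s hs =>
      (IntermediateField.mem_fixedField_iff _ _).mp hx s
        (padicSubgroup_le e (Nat.le_add_right n m) hs)
  have : FiniteDimensional F (fixedFld (padicSubgroup e (n + m))) := by
    rw [← InfiniteGalois.isOpen_iff_finite, InfiniteGalois.fixingSubgroup_fixedField
      ⟨_, (padicSubgroup e (n + m)).isClosed⟩]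
    exact (padicSubgroup e (n + m)).isOpen
  obtain ⟨T, hT⟩ := exists_transfer hle
  refine ⟨T, fun k => ?_⟩
  rw [dress_padicCoset, dress_padicCoset]
  refine hT (padicExt e n (m + k)) (padicExt e (n + m) k) fun x => ?_
  rw [mem_padicExt, mem_padicExt, add_assoc]

/-- The third layer of the infinite tower provides the cyclic octic extension that contains the
first two. -/
theorem dress_padicCoset_two (hp : p = 2) (n : ℕ) :
    dress _ (padicCoset e n 2) = dress _ (padicCoset e n 1) + 2 • gwLine 1 ∧
      2 • dress _ (padicCoset e n 1) = 4 • gwLine 1 ∧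
      dress _ (padicCoset e n 1) ≠ 2 • gwLine 1 := by
  subst hp
  have := fun m => isAbelianGalois_padicExt e n m
  have h := traceFormSpace_octic_tower (padicExt e n 1) (padicExt e n 2) (padicExt e n 3)
    (padicAut e n) (fun x => mem_bot_of_padicAut_apply_eq e n 3 x) (finrank_padicExt e n 1)
    (finrank_padicExt e n 2) (finrank_padicExt e n 3)
    (mem_padicExt_iff_of_le e n (by norm_num)) (mem_padicExt_iff_of_le e n (by norm_num))
  rwa [← dress_padicCoset, ← dress_padicCoset] at h

/-- The images satisfy the recursion `t_{m+2} = t_{m+1} + 2 t_m`, and multiples of `τ` collapse by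
`2τ = 4⟨1⟩`. -/
theorem dress_padicCoset_eq (hp : p = 2) (n m : ℕ) :
    dress _ (padicCoset e n (m + 1)) =
      ((2 : ℤ) ^ (m + 1) - 2) • gwLine 1 + dress _ (padicCoset e n 1) := by
  induction m using Nat.strong_induction_on with
  | _ m ih =>
  have h1 : dress _ (padicCoset e n 0) = gwLine 1 := by
    rw [dress_padicCoset_of_odd e n 0 (by simp), pow_zero, one_nsmul]
  match m, ih with
  | 0, _ => simp
  | m + 1, ih =>
    -- This is the relation between the first two layers over level `n + m`, transferred down to
    -- level `n`.
    have step : dress _ (padicCoset e n (m + 2)) =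
        dress _ (padicCoset e n (m + 1)) + 2 • dress _ (padicCoset e n m) := by
      obtain ⟨T, hT⟩ := exists_transfer_dress_padicCoset e n m
      have h := congrArg T (dress_padicCoset_two e hp (n + m)).1
      have h0 := hT 0
      rw [dress_padicCoset_of_odd e (n + m) 0 (by simp), pow_zero, one_nsmul, add_zero] at h0
      rwa [map_add, map_nsmul, hT, hT, h0] at h
    rw [step, ih m (by omega)]
    match m, ih with
    | 0, _ =>
      rw [h1]
      module
    | m + 1, ih =>
      rw [ih m (by omega), smul_add, (dress_padicCoset_two e hp n).2.1, pow_succ _ (m + 1 + 1),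
        pow_succ _ (m + 1)]
      module

end PadicExtension

theorem TambaraIdeal.mem_span_level {G : Type v} [Group G] [TopologicalSpace G]
    [IsTopologicalGroup G] [CompactSpace G] {S : Set (Σ H : OpenSubgroup G, Burnside H)}
    {H : OpenSubgroup G} {x : Burnside H} :
    x ∈ (TambaraIdeal.span S).level H ↔
      ∀ I : TambaraIdeal G, (∀ a ∈ S, a.2 ∈ I.level a.1) → x ∈ I.level H := by
  rw [TambaraIdeal.span, Submodule.mem_iInf, Subtype.forall]

/-! ### The ring generators inside the Tambara ideal. -/

section TambaraGenerators
variable {p : ℕ} [Fact p.Prime] {G : Type v} [Group G] [TopologicalSpace G]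
  [IsTopologicalGroup G] [CompactSpace G] (e : G ≃ₜ* Multiplicative ℤ_[p]) (I : TambaraIdeal G)

theorem burnsideTr_natCast_padic (n m c : ℕ) :
    burnsideTr (padicSubgroup_le e (Nat.le_add_right n m)) c = c * padicCoset e n m := by
  rw [← nsmul_one, map_nsmul, burnsideTr_one_padic, nsmul_eq_mul]

theorem padicCoset_sub_pow_mem
    (hI : ∀ i, padicCoset e i 1 - (p : Burnside (padicSubgroup e i)) ∈ I.level (padicSubgroup e i))
    (n m : ℕ) :
    padicCoset e n m - (p : Burnside (padicSubgroup e n)) ^ m ∈ I.level (padicSubgroup e n) := by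
  induction m with
  | zero =>
    rw [padicCoset_zero, pow_zero, sub_self]
    exact zero_mem _
  | succ m ih =>
    -- The transfer of `t_1 - p` from level `n + m` is `t_{m+1} - p t_m`.
    have h1 := I.tr_mem (padicSubgroup_le e (Nat.le_add_right n m)) _ (hI (n + m))
    rw [map_sub, burnsideTr_padicCoset, burnsideTr_natCast_padic] at h1
    have h2 : padicCoset e n (m + 1) - (p : Burnside (padicSubgroup e n)) ^ (m + 1) =
        (padicCoset e n (m + 1) - p * padicCoset e n m) + p * (padicCoset e n m - p ^ m) := by
      ring
    rw [h2]
    exact add_mem h1 (Ideal.mul_mem_left _ _ ih)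

theorem padicCoset_add_sub_mem (hp : p = 2)
    (hI : ∀ i, padicCoset e i 2 - padicCoset e i 1 - 2 ∈ I.level (padicSubgroup e i)) (n m : ℕ) :
    padicCoset e n (m + 1) + padicCoset e n 1 - 2 ^ (m + 1) - 2 ∈
      I.level (padicSubgroup e n) := by
  have hp' : (p : Burnside (padicSubgroup e n)) = 2 := by
    exact_mod_cast congrArg (Nat.cast : ℕ → Burnside (padicSubgroup e n)) hp
  have h1 : padicCoset e n (0 + 1) + padicCoset e n 1 - 2 ^ (0 + 1) - 2 ∈
      I.level (padicSubgroup e n) := by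
    have h11 := padicCoset_mul_padicCoset e n (le_refl 1)
    have h12 := padicCoset_mul_padicCoset e n one_le_two
    rw [pow_one, hp'] at h11 h12
    -- Since `t_1² = 2 t_1` and `t_1 t_2 = 2 t_2`, the product `(2 - t_1)(t_2 - t_1 - 2)` equals `2
    -- t_1 - 4`.
    have : padicCoset e n (0 + 1) + padicCoset e n 1 - 2 ^ (0 + 1) - 2 =
        (2 - padicCoset e n 1) * (padicCoset e n 2 - padicCoset e n 1 - 2) := by
      rw [zero_add]
      linear_combination h12 - h11
    rw [this]
    exact Ideal.mul_mem_left _ _ (hI n)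
  induction m using Nat.strong_induction_on with
  | _ m ih =>
  match m, ih with
  | 0, _ => exact h1
  | 1, _ =>
    have : padicCoset e n (1 + 1) + padicCoset e n 1 - 2 ^ (1 + 1) - 2 =
        (padicCoset e n 2 - padicCoset e n 1 - 2) +
          (padicCoset e n (0 + 1) + padicCoset e n 1 - 2 ^ (0 + 1) - 2) := by
      rw [zero_add, one_add_one_eq_two]
      ring
    rw [this]
    exact add_mem (hI n) h1
  | m + 2, ih =>
    have h2 := I.tr_mem (padicSubgroup_le e (Nat.le_add_right n (m + 1))) _ (hI (n + (m + 1)))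
    have h3 := burnsideTr_natCast_padic e n (m + 1) 2
    rw [Nat.cast_ofNat] at h3
    rw [map_sub, map_sub, burnsideTr_padicCoset, burnsideTr_padicCoset, h3, Nat.cast_ofNat] at h2
    -- The transferred element is `t_{m+3} - t_{m+2} - 2 t_{m+1}`. Adding the previous case and
    -- twice the one before leaves a surplus `2 t_1 - 4`, which is subtracted.
    have h4 := add_mem h2 (sub_mem (add_mem (ih (m + 1) (by omega))
      (Ideal.mul_mem_left _ 2 (ih m (by omega)))) h1)
    convert h4 using 1
    rw [zero_add]
    ring

end TambaraGenerators

/-! ### The kernel of the Dress map is the sign ideal. -/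

section TraceIdeal
variable {F : Type u} {K : Type v} [Field F] [NeZero (2 : F)] [Field K] [Algebra F K]
  [IsGalois F K] {p : ℕ} [Fact p.Prime] (e : Gal(K/F) ≃ₜ* Multiplicative ℤ_[p])

theorem zsmul_gwLine_one_eq_zero_iff {E : Type v} [Field E] [NeZero (2 : E)] {c : ℤ} :
    c • gwLine (1 : E) = 0 ↔ c = 0 := by
  refine ⟨fun h => ?_, fun h => by rw [h, zero_smul]⟩
  have := congrArg gwRank h
  rwa [map_zsmul, gwRank_gwLine one_ne_zero, map_zero, smul_eq_mul, mul_one] at this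

/-- Both assertions are additive in `x` and hold for the `t_m`. Together they say that the kernel,
the given ideal and the elements of cardinality zero coincide. -/
theorem dress_padic_eq_of_odd (hp : Odd p) (n : ℕ) (x : Burnside (padicSubgroup e n)) :
    dress _ x = (burnsideSign _ x).1 • gwLine 1 ∧
      x - ((burnsideSign _ x).1 : Burnside (padicSubgroup e n)) ∈
        Ideal.span {x | ∃ m : ℕ, x = padicCoset e n m - (p : Burnside (padicSubgroup e n)) ^ m} := by
  refine AddSubgroup.closure_induction (p := fun x _ => dress _ x = (burnsideSign _ x).1 • gwLine 1 ∧
      x - ((burnsideSign _ x).1 : Burnside (padicSubgroup e n)) ∈ _) ?_ ?_ ?_ ?_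
      (mem_closure_padicCoset e n x)
  · rintro _ ⟨m, rfl⟩
    rw [burnsideSign_padicCoset]
    refine ⟨?_, Ideal.subset_span ⟨m, by push_cast; rfl⟩⟩
    rw [dress_padicCoset_of_odd e n m hp.pow, ← natCast_zsmul, Nat.cast_pow]
  · simp
  · rintro x y _ _ ⟨hx, hx'⟩ ⟨hy, hy'⟩
    rw [map_add, map_add, Prod.fst_add, hx, hy, add_smul, Int.cast_add, add_sub_add_comm]
    exact ⟨rfl, add_mem hx' hy'⟩
  · rintro x _ ⟨hx, hx'⟩
    rw [map_neg, map_neg, Prod.fst_neg, hx, neg_smul, Int.cast_neg, ← neg_sub', neg_mem_iff]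
    exact ⟨rfl, hx'⟩

theorem traceIdeal_padic_of_odd (hp : Odd p) (n : ℕ) :
    (traceIdeal F K (padicSubgroup e n) : Set (Burnside (padicSubgroup e n))) =
        Ideal.span {x | ∃ m : ℕ, x = padicCoset e n m - (p : Burnside (padicSubgroup e n)) ^ m} ∧
      (traceIdeal F K (padicSubgroup e n) : Set (Burnside (padicSubgroup e n))) =
        (signIdeal Gal(K/F)).level (padicSubgroup e n) := by
  have h1 : ∀ x ∈ traceIdeal F K (padicSubgroup e n), x ∈
      Ideal.span {x | ∃ m : ℕ, x = padicCoset e n m - (p : Burnside (padicSubgroup e n)) ^ m} := by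
    intro x hx
    obtain ⟨h, h'⟩ := dress_padic_eq_of_odd e hp n x
    replace hx : dress _ x = 0 := hx
    rw [zsmul_gwLine_one_eq_zero_iff.mp (h.symm.trans hx), Int.cast_zero, sub_zero] at h'
    exact h'
  have h2 : Ideal.span {x | ∃ m : ℕ,
      x = padicCoset e n m - (p : Burnside (padicSubgroup e n)) ^ m} ≤
        (signIdeal Gal(K/F)).level (padicSubgroup e n) := by
    rw [Ideal.span_le]
    rintro _ ⟨m, rfl⟩
    exact padicCoset_sub_mem_signIdeal e hp n m
  have h3 : ∀ x ∈ (signIdeal Gal(K/F)).level (padicSubgroup e n),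
      x ∈ traceIdeal F K (padicSubgroup e n) := by
    intro x hx
    have hx' : burnsideSign _ x = 0 := hx
    change dress _ x = 0
    rw [(dress_padic_eq_of_odd e hp n x).1, hx']
    exact zero_smul _ _
  exact ⟨Set.Subset.antisymm h1 fun x hx => h3 x (h2 hx),
    Set.Subset.antisymm (fun x hx => h2 (h1 x hx)) h3⟩

/-- Modulo the given ideal every element is an integer `c` or `c + (t_1 - 2)`, because `2 (t_1 - 2)`
lies in the ideal. The sign of the generator tells the two cases apart, and the Dress map follows
the same pattern by `2τ = 4⟨1⟩`. -/
theorem dress_padic_eq_of_two (hp : p = 2) (n : ℕ) (x : Burnside (padicSubgroup e n)) :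
    ((burnsideSign _ x).2 (padicGen e n) = 0 ∧
      dress _ x = (burnsideSign _ x).1 • gwLine 1 ∧
      x - ((burnsideSign _ x).1 : Burnside (padicSubgroup e n)) ∈
        Ideal.span {x | ∃ m : ℕ, 1 ≤ m ∧
          x = padicCoset e n m + padicCoset e n 1 - 2 ^ m - 2}) ∨
    ((burnsideSign _ x).2 (padicGen e n) = Additive.ofMul (-1) ∧
      dress _ x = (burnsideSign _ x).1 • gwLine 1 +
        (dress _ (padicCoset e n 1) - 2 • gwLine 1) ∧
      x - ((burnsideSign _ x).1 : Burnside (padicSubgroup e n)) - (padicCoset e n 1 - 2) ∈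
        Ideal.span {x | ∃ m : ℕ, 1 ≤ m ∧
          x = padicCoset e n m + padicCoset e n 1 - 2 ^ m - 2}) := by
  set J := Ideal.span {x | ∃ m : ℕ, 1 ≤ m ∧
    x = padicCoset e n m + padicCoset e n 1 - 2 ^ m - 2} with hJ
  have hgen : ∀ m, padicCoset e n (m + 1) + padicCoset e n 1 - 2 ^ (m + 1) - 2 ∈ J := fun m =>
    Ideal.subset_span ⟨m + 1, by omega, rfl⟩
  have h2J : 2 * (padicCoset e n 1 - 2) ∈ J := by
    convert hgen 0 using 1
    rw [zero_add]
    ring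
  have hτ := (dress_padicCoset_two e hp n).2.1
  generalize hτ' : dress _ (padicCoset e n 1) = τ at hτ
  have hpz : (p : ℤ) = 2 := by exact_mod_cast hp
  have hone : Additive.ofMul (-1 : ℤˣ) + Additive.ofMul (-1) = 0 := by decide
  have hneg : - Additive.ofMul (-1 : ℤˣ) = Additive.ofMul (-1) := by decide
  refine AddSubgroup.closure_induction (p := fun x _ =>
    ((burnsideSign _ x).2 (padicGen e n) = 0 ∧
      dress _ x = (burnsideSign _ x).1 • gwLine 1 ∧
      x - ((burnsideSign _ x).1 : Burnside (padicSubgroup e n)) ∈ J) ∨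
    ((burnsideSign _ x).2 (padicGen e n) = Additive.ofMul (-1) ∧
      dress _ x = (burnsideSign _ x).1 • gwLine 1 + (τ - 2 • gwLine 1) ∧
      x - ((burnsideSign _ x).1 : Burnside (padicSubgroup e n)) - (padicCoset e n 1 - 2) ∈ J))
      ?_ ?_ ?_ ?_ (mem_closure_padicCoset e n x)
  · rintro _ ⟨m, rfl⟩
    rcases m with _ | m
    · left
      rw [dress_padicCoset_of_odd e n 0 (by simp), padicCoset_zero, burnsideSign_one]
      simp
    · right
      rw [dress_padicCoset_eq e hp, hτ', burnsideSign_padicCoset]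
      refine ⟨congrArg Additive.ofMul (permSign_padicGen_of_even e (hp ▸ even_two) n (m + 1)
        (by omega)), ?_, ?_⟩
      · rw [hpz]
        module
      · have : padicCoset e n (m + 1) - ((((p : ℤ) ^ (m + 1) : ℤ)) : Burnside _) -
            (padicCoset e n 1 - 2) =
            (padicCoset e n (m + 1) + padicCoset e n 1 - 2 ^ (m + 1) - 2) -
              2 * (padicCoset e n 1 - 2) := by
          rw [hpz]
          push_cast
          ring
        rw [this]
        exact sub_mem (hgen m) h2J
  · simp
  · rintro x y _ _ (⟨hx1, hx2, hx3⟩ | ⟨hx1, hx2, hx3⟩) (⟨hy1, hy2, hy3⟩ | ⟨hy1, hy2, hy3⟩) <;>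
      simp only [map_add, Prod.fst_add, Prod.snd_add, Pi.add_apply, hx1, hx2, hy1, hy2, hone,
        Int.cast_add]
    · refine Or.inl ⟨add_zero _, by module, ?_⟩
      convert add_mem hx3 hy3 using 1
      ring
    · refine Or.inr ⟨zero_add _, by module, ?_⟩
      convert add_mem hx3 hy3 using 1
      ring
    · refine Or.inr ⟨add_zero _, by module, ?_⟩
      convert add_mem hx3 hy3 using 1
      ring
    · refine Or.inl ⟨trivial, ?_, ?_⟩
      · rw [← sub_eq_zero] at hτ ⊢
        rw [← hτ]
        module
      · convert add_mem (add_mem hx3 hy3) h2J using 1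
        ring
  · rintro x _ (⟨hx1, hx2, hx3⟩ | ⟨hx1, hx2, hx3⟩) <;>
      simp only [map_neg, Prod.fst_neg, Prod.snd_neg, Pi.neg_apply, hx1, hx2, hneg, Int.cast_neg]
    · refine Or.inl ⟨neg_zero, by module, ?_⟩
      convert neg_mem hx3 using 1
      ring
    · refine Or.inr ⟨trivial, ?_, ?_⟩
      · rw [← sub_eq_zero] at hτ ⊢
        rw [← neg_zero, ← hτ]
        module
      · convert sub_mem (neg_mem hx3) h2J using 1
        ring

theorem traceIdeal_padic_of_two (hp : p = 2) (n : ℕ) :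
    (traceIdeal F K (padicSubgroup e n) : Set (Burnside (padicSubgroup e n))) =
        Ideal.span {x | ∃ m : ℕ, 1 ≤ m ∧
          x = padicCoset e n m + padicCoset e n 1 - 2 ^ m - 2} ∧
      (traceIdeal F K (padicSubgroup e n) : Set (Burnside (padicSubgroup e n))) =
        (signIdeal Gal(K/F)).level (padicSubgroup e n) := by
  obtain ⟨-, hτ, hτ'⟩ := dress_padicCoset_two e hp n
  have h1 : ∀ x ∈ traceIdeal F K (padicSubgroup e n), x ∈ Ideal.span {x | ∃ m : ℕ, 1 ≤ m ∧
      x = padicCoset e n m + padicCoset e n 1 - 2 ^ m - 2} := by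
    intro x hx
    replace hx : dress _ x = 0 := hx
    rcases dress_padic_eq_of_two e hp n x with ⟨-, h, h'⟩ | ⟨-, h, -⟩
    · rwa [zsmul_gwLine_one_eq_zero_iff.mp (h.symm.trans hx), Int.cast_zero, sub_zero] at h'
    · rw [hx] at h
      -- Doubling eliminates `τ`, so the rank forces cardinality zero; what remains is `τ = 2⟨1⟩`,
      -- which is excluded.
      have h4 : (2 * (burnsideSign _ x).1) • gwLine (1 : fixedFld (padicSubgroup e n)) = 0 := by
        have h5 : (2 * (burnsideSign _ x).1) • gwLine (1 : fixedFld (padicSubgroup e n)) =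
            2 • ((burnsideSign _ x).1 • gwLine 1 +
              (dress _ (padicCoset e n 1) - 2 • gwLine 1)) -
              (2 • dress _ (padicCoset e n 1) - 4 • gwLine 1) := by module
        rw [h5, ← h, hτ, sub_self, smul_zero, sub_zero]
      rw [zsmul_gwLine_one_eq_zero_iff] at h4
      rw [show (burnsideSign _ x).1 = 0 by omega, zero_smul, zero_add] at h
      exact absurd (sub_eq_zero.mp h.symm) hτ'
  have h2 : Ideal.span {x | ∃ m : ℕ, 1 ≤ m ∧
      x = padicCoset e n m + padicCoset e n 1 - 2 ^ m - 2} ≤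
        (signIdeal Gal(K/F)).level (padicSubgroup e n) := by
    rw [Ideal.span_le]
    rintro _ ⟨m, hm, rfl⟩
    exact padicCoset_add_sub_mem_signIdeal e hp n m hm
  have h3 : ∀ x ∈ (signIdeal Gal(K/F)).level (padicSubgroup e n),
      x ∈ traceIdeal F K (padicSubgroup e n) := by
    intro x hx
    have hx' : burnsideSign _ x = 0 := hx
    change dress _ x = 0
    rcases dress_padic_eq_of_two e hp n x with ⟨-, h, -⟩ | ⟨h, -, -⟩
    · rw [h, hx']
      exact zero_smul _ _
    · rw [hx'] at h
      exact absurd h (show (0 : Additive ℤˣ) ≠ Additive.ofMul (-1) by decide)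
  exact ⟨Set.Subset.antisymm h1 fun x hx => h3 x (h2 hx),
    Set.Subset.antisymm (fun x hx => h2 (h1 x hx)) h3⟩

end TraceIdeal

end GalTambara
theorem mainTheorem7 {F : Type u} {K : Type v} [Field F] [NeZero (2 : F)] [Field K] [Algebra F K]
    [IsGalois F K] (p : ℕ) [Fact p.Prime] (e : Gal(K/F) ≃ₜ* Multiplicative ℤ_[p]) :
    (Odd p →
      (∀ n : ℕ, (traceIdeal F K (padicSubgroup e n) : Set (Burnside (padicSubgroup e n))) =
        Ideal.span {x | ∃ m : ℕ,
          x = padicCoset e n m - (p : Burnside (padicSubgroup e n)) ^ m}) ∧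
      (∀ H : OpenSubgroup Gal(K/F), (traceIdeal F K H : Set (Burnside H)) =
        (TambaraIdeal.span {a | ∃ i : ℕ,
          a = ⟨padicSubgroup e i,
            padicCoset e i 1 - (p : Burnside (padicSubgroup e i))⟩}).level H)) ∧
    (p = 2 →
      (∀ n : ℕ, (traceIdeal F K (padicSubgroup e n) : Set (Burnside (padicSubgroup e n))) =
        Ideal.span {x | ∃ m : ℕ, 1 ≤ m ∧
          x = padicCoset e n m + padicCoset e n 1 - 2 ^ m - 2}) ∧
      (∀ H : OpenSubgroup Gal(K/F), (traceIdeal F K H : Set (Burnside H)) =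
        (TambaraIdeal.span {a | ∃ i : ℕ,
          a = ⟨padicSubgroup e i, padicCoset e i 2 - padicCoset e i 1 - 2⟩}).level H)) := by

  refine ⟨fun hp => ⟨fun n => (traceIdeal_padic_of_odd e hp n).1, fun H => ?_⟩,
    fun hp => ⟨fun n => (traceIdeal_padic_of_two e hp n).1, fun H => ?_⟩⟩
  · obtain ⟨n, rfl⟩ := exists_eq_padicSubgroup e H
    obtain ⟨h1, h2⟩ := traceIdeal_padic_of_odd e hp n
    refine Set.Subset.antisymm (fun x hx => TambaraIdeal.mem_span_level.mpr fun I hI => ?_)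
      fun x hx => ?_
    · rw [h1] at hx
      refine Ideal.span_le.mpr ?_ hx
      rintro _ ⟨m, rfl⟩
      exact padicCoset_sub_pow_mem e I (fun i => hI _ ⟨i, rfl⟩) n m
    · rw [h2]
      -- The kernel is the level of a Tambara ideal containing the generators, hence contains the
      -- ideal they generate.
      refine TambaraIdeal.mem_span_level.mp hx (signIdeal _) ?_
      rintro _ ⟨i, rfl⟩
      simpa using padicCoset_sub_mem_signIdeal e hp i 1
  · obtain ⟨n, rfl⟩ := exists_eq_padicSubgroup e H
    obtain ⟨h1, h2⟩ := traceIdeal_padic_of_two e hp n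
    refine Set.Subset.antisymm (fun x hx => TambaraIdeal.mem_span_level.mpr fun I hI => ?_)
      fun x hx => ?_
    · rw [h1] at hx
      refine Ideal.span_le.mpr ?_ hx
      rintro _ ⟨m, hm, rfl⟩
      obtain ⟨m, rfl⟩ := Nat.exists_eq_add_of_le' hm
      exact padicCoset_add_sub_mem e I hp (fun i => hI _ ⟨i, rfl⟩) n m
    · rw [h2]
      refine TambaraIdeal.mem_span_level.mp hx (signIdeal _) ?_
      rintro _ ⟨i, rfl⟩
      -- The generator `t_2 - t_1 - 2` is the difference of the ring generators for `m = 2` and `m =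
      -- 1`.
      have h3 := padicCoset_add_sub_mem_signIdeal e hp i 2 one_le_two
      have h4 := padicCoset_add_sub_mem_signIdeal e hp i 1 le_rfl
      change padicCoset e i 2 - padicCoset e i 1 - 2 ∈ _
      convert sub_mem h3 h4 using 1
      ring
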